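/- Work on a deterministic word RAM: words have $w$ bits, arithmetic ($+,-,\cdot,\div,\bmod$, all modulo $2^w$), comparisons, branches and indirect memory accesses take unit time, and programs do not depend on $w$. For strings $U,V$, let $\mathrm{LCP}(U,V)$ be the length of their longest common prefix. For a finite set $\mathcal F$ of strings over an integer alphabet, the compacted trie $\mathcal T(\mathcal F)$ consists of the root, the terminal nodes (those representing the strings of $\mathcal F$) and the branching nodes of the trie of $\mathcal F$. It is stored with its nodes numbered arbitrarily, the children of every node in a linked list in arbitrary order, and every edge in $O(1)$ space: the first letter of its label, and the label itself as a factor of a string of $\mathcal F$ (the index of the string, and the start and end positions). The Two String Families LCP Problem is as follows. The input is a compacted trie $\mathcal T(\mathcal F)$ of a finite set $\mathcal F$ of strings and two non-empty sets $\mathcal P,\mathcal Q\subseteq\mathcal F^2$, listed in arbitrary order, with each string given by a pointer to its terminal node in $\mathcal T(\mathcal F)$. The output is $$\mathrm{maxPairLCP}(\mathcal P,\mathcal Q)=\max\{\mathrm{LCP}(P_1,Q_1)+\mathrm{LCP}(P_2,Q_2) : (P_1,P_2)\in\mathcal P,\ (Q_1,Q_2)\in\mathcal Q\}.$$ **Lemma.**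 The Two String Families LCP Problem can be solved in $O(|\mathcal F|+N\log N)$ time, where $N=|\mathcal P|+|\mathcal Q|$. More precisely, there are a program and constants $C,c$ such that, for every input and every word size $w$ for which all numbers stored in the input fit into $w$-bit words and $w\ge c\log_2(|\mathcal F|+N+\max_{U\in\mathcal F}|U|)$, the program halts after at most $C\,(|\mathcal F|+N\log N)$ steps and outputs $\mathrm{maxPairLCP}(\mathcal P,\mathcal Q)$. -/

import Mathlib

/-! ### A word RAM

Programs are structured programs over finitely many registers and finitely many memory arrays
(a program mentions only finitely many of each).  A word is a natural number below `2 ^ w`,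
arithmetic is modulo `2 ^ w`, and every elementary operation (a constant, a register access,
an arithmetic operation or comparison, an indirect memory access, a branch) costs one step. -/

namespace WordRAM

/-- The unit-cost arithmetic operations and comparisons. -/
inductive Op where
  | add | sub | mul | div | mod | lt | eq

/-- Value of an operation on words of `w` bits; comparisons return `1` or `0`. -/
def Op.eval (w : ℕ) : Op → ℕ → ℕ → ℕ
  | .add, x, y => (x + y) % 2 ^ w
  | .sub, x, y => (x + (2 ^ w - y)) % 2 ^ w
  | .mul, x, y => (x * y) % 2 ^ w
  | .div, x, y => (x / y) % 2 ^ w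
  | .mod, x, y => (x % y) % 2 ^ w
  | .lt, x, y => if x < y then 1 % 2 ^ w else 0
  | .eq, x, y => if x = y then 1 % 2 ^ w else 0

/-- Expressions: constants, registers, operations, and indirect memory reads
(`load a e` reads array `a` at the position given by `e`). -/
inductive Expr where
  | const (k : ℕ)
  | reg (r : ℕ)
  | op (o : Op) (e₁ e₂ : Expr)
  | load (a : ℕ) (e : Expr)

/-- A machine state: `reg r` is the content of register `r`,
`mem a i` is the content of cell `i` of array `a`. -/
structure State where
  reg : ℕ → ℕ
  mem : ℕ → ℕ → ℕ

/-- Every register and every memory cell holds a `w`-bit word. -/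
def State.Fits (s : State) (w : ℕ) : Prop :=
  (∀ r, s.reg r < 2 ^ w) ∧ ∀ a i, s.mem a i < 2 ^ w

def State.setReg (s : State) (r x : ℕ) : State :=
  { s with reg := Function.update s.reg r x }

def State.setMem (s : State) (a i x : ℕ) : State :=
  { s with mem := Function.update s.mem a (Function.update (s.mem a) i x) }

def Expr.eval (w : ℕ) (s : State) : Expr → ℕ
  | .const k => k % 2 ^ w
  | .reg r => s.reg r
  | .op o e₁ e₂ => o.eval w (e₁.eval w s) (e₂.eval w s)
  | .load a e => s.mem a (e.eval w s)

/-- Number of steps needed to evaluate an expression. -/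
def Expr.cost : Expr → ℕ
  | .const _ => 1
  | .reg _ => 1
  | .op _ e₁ e₂ => e₁.cost + e₂.cost + 1
  | .load _ e => e.cost + 1

/-- Programs. `store a i e` writes the value of `e` to cell `i` of array `a`. -/
inductive Prog where
  | skip
  | assign (r : ℕ) (e : Expr)
  | store (a : ℕ) (i e : Expr)
  | seq (p q : Prog)
  | ite (b : Expr) (p q : Prog)
  | loop (b : Expr) (p : Prog)

/-- `Exec w p s s' t`: on a machine with `w`-bit words, the program `p` started in the state `s`
halts in the state `s'` after exactly `t` steps.  `loop b p` is "while `b ≠ 0` do `p`". -/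
inductive Exec (w : ℕ) : Prog → State → State → ℕ → Prop where
  | skip (s : State) : Exec w .skip s s 1
  | assign (s : State) (r : ℕ) (e : Expr) :
      Exec w (.assign r e) s (s.setReg r (e.eval w s)) (e.cost + 1)
  | store (s : State) (a : ℕ) (i e : Expr) :
      Exec w (.store a i e) s (s.setMem a (i.eval w s) (e.eval w s)) (i.cost + e.cost + 1)
  | seq {p q : Prog} {s s' s'' : State} {t t' : ℕ} :
      Exec w p s s' t → Exec w q s' s'' t' → Exec w (.seq p q) s s'' (t + t')
  | ite_true {b : Expr} {p q : Prog} {s s' : State} {t : ℕ} :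
      b.eval w s ≠ 0 → Exec w p s s' t → Exec w (.ite b p q) s s' (b.cost + 1 + t)
  | ite_false {b : Expr} {p q : Prog} {s s' : State} {t : ℕ} :
      b.eval w s = 0 → Exec w q s s' t → Exec w (.ite b p q) s s' (b.cost + 1 + t)
  | loop_true {b : Expr} {p : Prog} {s s' s'' : State} {t t' : ℕ} :
      b.eval w s ≠ 0 → Exec w p s s' t → Exec w (.loop b p) s' s'' t' →
      Exec w (.loop b p) s s'' (b.cost + 1 + t + t')
  | loop_false {b : Expr} {p : Prog} {s : State} :
      b.eval w s = 0 → Exec w (.loop b p) s s (b.cost + 1)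

/-- The machine is deterministic. -/
theorem Exec.deterministic {w : ℕ} {p : Prog} {s s₁ s₂ : State} {t₁ t₂ : ℕ}
    (h₁ : Exec w p s s₁ t₁) (h₂ : Exec w p s s₂ t₂) : s₁ = s₂ ∧ t₁ = t₂ := by
  induction h₁ generalizing s₂ t₂ with
  | skip s => cases h₂; exact ⟨rfl, rfl⟩
  | assign s r e => cases h₂; exact ⟨rfl, rfl⟩
  | store s a i e => cases h₂; exact ⟨rfl, rfl⟩
  | seq _ _ ih ih' =>
    cases h₂ with
    | seq g g' =>
      obtain ⟨rfl, rfl⟩ := ih g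
      obtain ⟨rfl, rfl⟩ := ih' g'
      exact ⟨rfl, rfl⟩
  | ite_true hb _ ih =>
    cases h₂ with
    | ite_true _ g => obtain ⟨rfl, rfl⟩ := ih g; exact ⟨rfl, rfl⟩
    | ite_false hb' _ => exact absurd hb' hb
  | ite_false hb _ ih =>
    cases h₂ with
    | ite_true hb' _ => exact absurd hb hb'
    | ite_false _ g => obtain ⟨rfl, rfl⟩ := ih g; exact ⟨rfl, rfl⟩
  | loop_true hb _ _ ih ih' =>
    cases h₂ with
    | loop_true _ g g' =>
      obtain ⟨rfl, rfl⟩ := ih g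
      obtain ⟨rfl, rfl⟩ := ih' g'
      exact ⟨rfl, rfl⟩
    | loop_false hb' => exact absurd hb' hb
  | loop_false hb =>
    cases h₂ with
    | loop_true hb' _ _ => exact absurd hb hb'
    | loop_false _ => exact ⟨rfl, rfl⟩

end WordRAM

/-! ### Longest common prefixes -/

namespace TwoFamilies

/-- Strings over an integer alphabet. -/
abbrev Str := List ℕ

/-- The length of the longest common prefix of `U` and `V`: the largest `p ≤ |U|, |V|` such that
the prefixes of length `p` are equal. -/
def LCP (U V : Str) : ℕ :=
  Nat.findGreatest (fun p => U.take p = V.take p) (min U.length V.length)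

/-- The maximum of `LCP P₁ Q₁ + LCP P₂ Q₂` over `(P₁, P₂) ∈ P` and `(Q₁, Q₂) ∈ Q`
(meaningful if `P` and `Q` are non-empty). -/
def maxPairLCP (P Q : Finset (Str × Str)) : ℕ :=
  (P ×ˢ Q).sup fun x => LCP x.1.1 x.2.1 + LCP x.1.2 x.2.2

/-! ### Compacted tries -/

/-- Nodes of the trie of `F` are identified with the prefixes of members of `F`.
A node is branching if it has at least two children in the (uncompacted) trie. -/
def IsBranching (F : Finset Str) (v : Str) : Prop :=
  ∃ a b : ℕ, a ≠ b ∧ (∃ U ∈ F, v ++ [a] <+: U) ∧ ∃ V ∈ F, v ++ [b] <+: V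

/-- The nodes of the compacted trie: the root, the terminal nodes and the branching nodes. -/
def IsNode (F : Finset Str) (v : Str) : Prop :=
  v = [] ∨ v ∈ F ∨ IsBranching F v

/-- `v` is a child of `u` in the compacted trie: a proper extension, with no node in between. -/
def IsChild (F : Finset Str) (u v : Str) : Prop :=
  IsNode F u ∧ IsNode F v ∧ u <+: v ∧ u ≠ v ∧
    ∀ x, IsNode F x → u <+: x → x <+: v → x = u ∨ x = v

/-- The linked list with start pointer `p` and successor pointers `next` contains exactly the
entries of the given list, in this order. -/
def IsLinked {β : Type} (next : β → Option β) : Option β → List β → Prop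
  | p, [] => p = none
  | p, x :: l => p = some x ∧ IsLinked next (next x) l

/-- A data structure storing the compacted trie of `F`.

Its nodes are numbered `0, …, size - 1` in an arbitrary way, and the strings of `F` are numbered
`0, …, |F| - 1` in an arbitrary way.  The children of a node are stored in a linked list, in any
order.  The edge leading to a non-root node `v` is stored in constant space: the first letter of
its label, and a triple (number of a string in `F`, start, stop) saying that the label is the
factor of this string that occupies the positions `start, …, stop - 1`, counted from `0`.
The entries of `nextSibling`, `letter`, `labelStr`, `labelStart`, `labelStop` at the root
are unused and unconstrained. -/
structure CompactedTrie (F : Finset Str) where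
  /-- the number of nodes -/
  size : ℕ
  /-- the string spelled by the path from the root to a node -/
  node : Fin size → Str
  node_injective : Function.Injective node
  isNode_iff : ∀ v, IsNode F v ↔ ∃ i, node i = v
  root : Fin size
  node_root : node root = []
  /-- the numbering of the strings in `F` -/
  str : Fin F.card → Str
  mem_iff : ∀ U, U ∈ F ↔ ∃ i, str i = U
  firstChild : Fin size → Option (Fin size)
  nextSibling : Fin size → Option (Fin size)
  children : ∀ u, ∃ l : List (Fin size), IsLinked nextSibling (firstChild u) l ∧
    ∀ v, v ∈ l ↔ IsChild F (node u) (node v)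
  letter : Fin size → ℕ
  labelStr : Fin size → Fin F.card
  labelStart : Fin size → ℕ
  labelStop : Fin size → ℕ
  letter_spec : ∀ u v, IsChild F (node u) (node v) → node u ++ [letter v] <+: node v
  labelStop_le : ∀ u v, IsChild F (node u) (node v) →
    labelStart v ≤ labelStop v ∧ labelStop v ≤ (str (labelStr v)).length
  label_spec : ∀ u v, IsChild F (node u) (node v) →
    node v = node u ++ ((str (labelStr v)).drop (labelStart v)).take (labelStop v - labelStart v)
  /-- the terminal node of each string in `F` -/
  term : Fin F.card → Fin size
  term_spec : ∀ i, node (term i) = str i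

/-- A listing of the pairs in the set `P`, in any order and without repetitions; each string is
given by a pointer to its (terminal) node in the compacted trie. -/
structure PairListing {F : Finset Str} (T : CompactedTrie F) (P : Finset (Str × Str)) where
  fst : Fin P.card → Fin T.size
  snd : Fin P.card → Fin T.size
  mem_iff : ∀ U, U ∈ P ↔ ∃ i, (T.node (fst i), T.node (snd i)) = U

/-- Pointers as integers; the null pointer is `n`. -/
def encodePtr {n : ℕ} : Option (Fin n) → ℕ
  | none => n
  | some i => i

/-- The contents of the input arrays; arrays other than these are empty. -/
def inputArray {F : Finset Str} {P Q : Finset (Str × Str)} (T : CompactedTrie F)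
    (LP : PairListing T P) (LQ : PairListing T Q) : ℕ → List ℕ
  | 0 => List.ofFn fun v => encodePtr (T.firstChild v)
  | 1 => List.ofFn fun v => encodePtr (T.nextSibling v)
  | 2 => List.ofFn T.letter
  | 3 => List.ofFn fun v => (T.labelStr v : ℕ)
  | 4 => List.ofFn T.labelStart
  | 5 => List.ofFn T.labelStop
  | 6 => List.ofFn fun i => (T.term i : ℕ)
  | 7 => List.ofFn fun i => (LP.fst i : ℕ)
  | 8 => List.ofFn fun i => (LP.snd i : ℕ)
  | 9 => List.ofFn fun i => (LQ.fst i : ℕ)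
  | 10 => List.ofFn fun i => (LQ.snd i : ℕ)
  | _ => []

/-- The contents of the input registers; all other registers are `0`. -/
def inputReg {F : Finset Str} (T : CompactedTrie F) (P Q : Finset (Str × Str)) : ℕ → ℕ
  | 0 => T.size
  | 1 => T.root
  | 2 => F.card
  | 3 => P.card
  | 4 => Q.card
  | _ => 0

/-- The initial state of the machine on the given input; unused memory cells are `0`.
The letters of the strings in `F` are not part of it, except for the first letters of edges. -/
def inputState {F : Finset Str} {P Q : Finset (Str × Str)} (T : CompactedTrie F)
    (LP : PairListing T P) (LQ : PairListing T Q) : WordRAM.State where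
  reg := inputReg T P Q
  mem a i := (inputArray T LP LQ a).getD i 0

end TwoFamilies

/-! Number the pairs of `P` and `Q` as `N` items. A depth-first search of the trie lists the items
by the nodes of their first strings, together with numbers `l` such that one plus the LCP of two
first strings is the minimum of `l` over the positions after the first item up to the second
(`SearchInv.emit`, `SearchInv.push`, `SearchInv.pop`). The same is done for the second strings. Only
the shape of the tree and the lengths of labels are used. The trie has at most `2 * F.card + 1`
nodes (`CompactedTrie.size_le`), so this takes linear time. It remains to maximise `X₁ x y + X₂ x y`
over `P`-items `x` and `Q`-items `y`, where both similarities are range minima in their own order.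

This is divide and conquer on the first order, with all blocks of one size `S = 2 * B` treated in a
single linear pass. For every item let `V` be the minimum of `l` between its position and the middle
of its block. For two items in opposite halves, `X₁ + 1` is the minimum of their two values `V`; for
two items in the same half that minimum is at most `X₁ + 1` (`MidVals.le`). So all `P`-`Q` pairs of
a block may be evaluated by this formula: separated pairs get their exact value, the others are
never overestimated.

The items of a block are listed in the second order. A stack scan joins groups of consecutive items
in the manner of a Cartesian tree. When two groups merge, all pairs across them have the same `X₂`,
and the largest `min (V x) (V y)` over such pairs is the minimum of two group maxima. Hence two
numbers per group suffice, one for the `P`-items and one for the `Q`-items (`ScanInv.merge`).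
Afterwards every block is stably distributed to its halves, and the new neighbour values are minima
of old ones (`SplitInv.step`). When the block size reaches one, every pair has been separated at
some level (`runs_levelBody`, `runs_levelsProg`). There are `O(log N)` levels of cost `O(N)`.

All distances are stored with one added. Thus `0` can mark block boundaries, the ends of lists and
missing values, while `2 ^ w - 1` is the neutral element for minima of words. -/

namespace WordRAM

/-! ### Reasoning about programs -/

@[simp] theorem State.reg_setReg (s : State) (r x r' : ℕ) :
    (s.setReg r x).reg r' = if r' = r then x else s.reg r' := by
  simp [State.setReg, Function.update_apply]

@[simp] theorem State.mem_setReg (s : State) (r x : ℕ) : (s.setReg r x).mem = s.mem := rfl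

@[simp] theorem State.reg_setMem (s : State) (a i x : ℕ) : (s.setMem a i x).reg = s.reg := rfl

@[simp] theorem State.mem_setMem (s : State) (a i x b : ℕ) :
    (s.setMem a i x).mem b = if b = a then Function.update (s.mem a) i x else s.mem b := by
  simp only [State.setMem, Function.update_apply]

/-- The effect of a program without loops. -/
def Prog.den (w : ℕ) : Prog → State → State
  | .skip, s => s
  | .assign r e, s => s.setReg r (e.eval w s)
  | .store a i e, s => s.setMem a (i.eval w s) (e.eval w s)
  | .seq p q, s => q.den w (p.den w s)
  | .ite b p q, s => if b.eval w s ≠ 0 then p.den w s else q.den w s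
  | .loop _ _, s => s

/-- A bound for the running time of a program without loops. -/
def Prog.bound : Prog → ℕ
  | .skip => 1
  | .assign _ e => e.cost + 1
  | .store _ i e => i.cost + e.cost + 1
  | .seq p q => p.bound + q.bound
  | .ite b p q => b.cost + 1 + (p.bound + q.bound)
  | .loop _ _ => 0

def Prog.loopFree : Prog → Bool
  | .seq p q => p.loopFree && q.loopFree
  | .ite _ p q => p.loopFree && q.loopFree
  | .loop _ _ => false
  | _ => true

def Prog.writesReg (r : ℕ) : Prog → Bool
  | .assign r' _ => r == r'
  | .seq p q => p.writesReg r || q.writesReg r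
  | .ite _ p q => p.writesReg r || q.writesReg r
  | .loop _ p => p.writesReg r
  | _ => false

def Prog.writesMem (a : ℕ) : Prog → Bool
  | .store a' _ _ => a == a'
  | .seq p q => p.writesMem a || q.writesMem a
  | .ite _ p q => p.writesMem a || q.writesMem a
  | .loop _ p => p.writesMem a
  | _ => false

theorem Prog.exec_den (w : ℕ) (p : Prog) (hp : p.loopFree = true) (s : State) :
    ∃ t, Exec w p s (p.den w s) t ∧ t ≤ p.bound := by
  induction p generalizing s with
  | skip => exact ⟨_, .skip s, le_rfl⟩
  | assign r e => exact ⟨_, .assign s r e, le_rfl⟩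
  | store a i e => exact ⟨_, .store s a i e, le_rfl⟩
  | seq p q ihp ihq =>
    simp only [loopFree, Bool.and_eq_true] at hp
    obtain ⟨t, h, ht⟩ := ihp hp.1 s
    obtain ⟨t', h', ht'⟩ := ihq hp.2 (p.den w s)
    exact ⟨_, .seq h h', Nat.add_le_add ht ht'⟩
  | ite b p q ihp ihq =>
    simp only [loopFree, Bool.and_eq_true] at hp
    by_cases hb : b.eval w s = 0
    · obtain ⟨t, h, ht⟩ := ihq hp.2 s
      refine ⟨_, by simpa [den, hb] using Exec.ite_false hb h, ?_⟩
      simp only [bound]; omega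
    · obtain ⟨t, h, ht⟩ := ihp hp.1 s
      refine ⟨_, by simpa [den, hb] using Exec.ite_true hb h, ?_⟩
      simp only [bound]; omega
  | loop b p _ => simp [loopFree] at hp

/-- `s` and `s'` agree on everything that `p` does not write. -/
def Frame (p : Prog) (s s' : State) : Prop :=
  (∀ r, p.writesReg r = false → s'.reg r = s.reg r) ∧
    ∀ a, p.writesMem a = false → s'.mem a = s.mem a

theorem Frame.refl (p : Prog) (s : State) : Frame p s s := ⟨fun _ _ => rfl, fun _ _ => rfl⟩

theorem Frame.trans {p : Prog} {s s' s'' : State} (h : Frame p s s') (h' : Frame p s' s'') :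
    Frame p s s'' :=
  ⟨fun r hr => (h'.1 r hr).trans (h.1 r hr), fun a ha => (h'.2 a ha).trans (h.2 a ha)⟩

theorem Exec.frame {w : ℕ} {p : Prog} {s s' : State} {t : ℕ} (h : Exec w p s s' t) :
    Frame p s s' := by
  induction h with
  | skip s => exact .refl _ _
  | assign s r e =>
    refine ⟨fun r' hr => ?_, fun _ _ => rfl⟩
    have : r' ≠ r := by simpa [Prog.writesReg] using hr
    simp [this]
  | store s a i e =>
    refine ⟨fun _ _ => rfl, fun a' ha => ?_⟩
    have : a' ≠ a := by simpa [Prog.writesMem] using ha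
    simp [this]
  | seq _ _ ih ih' =>
    refine ⟨fun r hr => ?_, fun a ha => ?_⟩
    · simp only [Prog.writesReg, Bool.or_eq_false_iff] at hr
      rw [ih'.1 r hr.2, ih.1 r hr.1]
    · simp only [Prog.writesMem, Bool.or_eq_false_iff] at ha
      rw [ih'.2 a ha.2, ih.2 a ha.1]
  | ite_true _ _ ih =>
    refine ⟨fun r hr => ?_, fun a ha => ?_⟩
    · simp only [Prog.writesReg, Bool.or_eq_false_iff] at hr
      exact ih.1 r hr.1
    · simp only [Prog.writesMem, Bool.or_eq_false_iff] at ha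
      exact ih.2 a ha.1
  | ite_false _ _ ih =>
    refine ⟨fun r hr => ?_, fun a ha => ?_⟩
    · simp only [Prog.writesReg, Bool.or_eq_false_iff] at hr
      exact ih.1 r hr.2
    · simp only [Prog.writesMem, Bool.or_eq_false_iff] at ha
      exact ih.2 a ha.2
  | loop_true _ _ _ ih ih' =>
    exact ⟨fun r hr => (ih'.1 r hr).trans (ih.1 r hr), fun a ha => (ih'.2 a ha).trans (ih.2 a ha)⟩
  | loop_false _ => exact .refl _ _

theorem Op.eval_lt_two_pow {w : ℕ} (o : Op) (x y : ℕ) :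
    o.eval w x y < 2 ^ w := by
  have h := Nat.two_pow_pos w
  cases o <;> simp only [Op.eval] <;> first
    | exact Nat.mod_lt _ h
    | (split_ifs
       · exact Nat.mod_lt _ h
       · exact h)

theorem Expr.eval_lt_two_pow {w : ℕ} (e : Expr) {s : State} (hs : s.Fits w) :
    e.eval w s < 2 ^ w := by
  induction e with
  | const k => exact Nat.mod_lt _ (Nat.two_pow_pos w)
  | reg r => exact hs.1 r
  | op o e₁ e₂ _ _ => exact o.eval_lt_two_pow _ _
  | load a e _ => exact hs.2 _ _

theorem Exec.fits {w : ℕ} {p : Prog} {s s' : State} {t : ℕ} (h : Exec w p s s' t)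
    (hs : s.Fits w) : s'.Fits w := by
  induction h with
  | skip s => exact hs
  | assign s r e =>
    refine ⟨fun r' => ?_, hs.2⟩
    rw [State.reg_setReg]
    split_ifs
    · exact e.eval_lt_two_pow hs
    · exact hs.1 r'
  | store s a i e =>
    refine ⟨hs.1, fun a' i' => ?_⟩
    rw [State.mem_setMem]
    split_ifs
    · rw [Function.update_apply]
      split_ifs
      · exact e.eval_lt_two_pow hs
      · exact hs.2 _ _
    · exact hs.2 _ _
  | seq _ _ ih ih' => exact ih' (ih hs)
  | ite_true _ _ ih => exact ih hs
  | ite_false _ _ ih => exact ih hs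
  | loop_true _ _ _ ih ih' => exact ih' (ih hs)
  | loop_false _ => exact hs

/-- Started in `s`, the program `p` halts after at most `n` steps in a state satisfying `Q`. -/
def Runs (w : ℕ) (p : Prog) (s : State) (n : ℕ) (Q : State → Prop) : Prop :=
  ∃ s' t, Exec w p s s' t ∧ t ≤ n ∧ Q s'

/-- Execution preserves the word bounds. They are attached to a postcondition only where a later
phase has to know that stored values are words. -/
theorem Runs.fits {w : ℕ} {p : Prog} {s : State} {n : ℕ} {Q : State → Prop}
    (h : Runs w p s n Q) : Runs w p s n fun s' => (s.Fits w → s'.Fits w) ∧ Q s' := by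
  obtain ⟨s', t, h, ht, hQ⟩ := h
  exact ⟨s', t, h, ht, h.fits, hQ⟩

theorem Runs.mono {w : ℕ} {p : Prog} {s : State} {n n' : ℕ} {Q Q' : State → Prop}
    (h : Runs w p s n Q) (hn : n ≤ n') (hQ : ∀ s', Q s' → Q' s') : Runs w p s n' Q' := by
  obtain ⟨s', t, h, ht, hs⟩ := h
  exact ⟨s', t, h, ht.trans hn, hQ s' hs⟩

/-- The continuation also receives the frame of the first program, so specifications of phases need
to mention only what changes. -/
theorem Runs.seq {w : ℕ} {p q : Prog} {s : State} {n m : ℕ} {Q Q' : State → Prop}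
    (h : Runs w p s n Q) (h' : ∀ s', Frame p s s' → Q s' → Runs w q s' m Q') :
    Runs w (.seq p q) s (n + m) Q' := by
  obtain ⟨s', t, h, ht, hs⟩ := h
  obtain ⟨s'', t', h', ht', hs'⟩ := h' s' h.frame hs
  exact ⟨s'', _, .seq h h', Nat.add_le_add ht ht', hs'⟩

theorem Runs.den {w : ℕ} {p : Prog} {s : State} {Q : State → Prop} (hp : p.loopFree = true)
    (h : Q (p.den w s)) : Runs w p s p.bound Q := by
  obtain ⟨t, ht, hb⟩ := p.exec_den w hp s
  exact ⟨_, t, ht, hb, h⟩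

/-- A loop with an invariant `I m`, where `m` bounds the number of the remaining iterations. -/
theorem Runs.loop {w : ℕ} {b : Expr} {p : Prog} {c : ℕ} {s₀ : State} (I : ℕ → State → Prop)
    (hI : ∀ m s, Frame p s₀ s → I m s → b.eval w s ≠ 0 →
      Runs w p s c fun s' => ∃ m' < m, I m' s') {m : ℕ} (h₀ : I m s₀) :
    Runs w (.loop b p) s₀ (m * (c + b.cost + 1) + (b.cost + 1)) fun s =>
      Frame p s₀ s ∧ b.eval w s = 0 ∧ ∃ m, I m s := by
  suffices H : ∀ m s, Frame p s₀ s → I m s →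
      Runs w (.loop b p) s (m * (c + b.cost + 1) + (b.cost + 1)) fun s =>
        Frame p s₀ s ∧ b.eval w s = 0 ∧ ∃ m, I m s from H m s₀ (.refl _ _) h₀
  intro m
  induction m using Nat.strong_induction_on with
  | _ m ih =>
  intro s hs hm
  by_cases hb : b.eval w s = 0
  · exact ⟨s, _, .loop_false hb, Nat.le_add_left _ _, hs, hb, m, hm⟩
  · obtain ⟨s', t, h, ht, m', hlt, hm'⟩ := hI m s hs hm hb
    obtain ⟨s'', t', h', ht', hQ⟩ := ih m' hlt s' (hs.trans h.frame) hm'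
    refine ⟨s'', _, .loop_true hb h h', ?_, hQ⟩
    have : (m' + 1) * (c + b.cost + 1) ≤ m * (c + b.cost + 1) := Nat.mul_le_mul_right _ hlt
    rw [Nat.add_mul] at this
    omega

/-! ### Operations without overflow -/

theorem Op.eval_add {w x y : ℕ} (h : x + y < 2 ^ w) : Op.add.eval w x y = x + y :=
  Nat.mod_eq_of_lt h

theorem Op.eval_sub {w x y : ℕ} (h : y ≤ x) (hx : x < 2 ^ w) : Op.sub.eval w x y = x - y := by
  have : x + (2 ^ w - y) = (x - y) + 2 ^ w := by omega
  rw [Op.eval, this, Nat.add_mod_right, Nat.mod_eq_of_lt (by omega)]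

theorem Op.eval_mul {w x y : ℕ} (h : x * y < 2 ^ w) : Op.mul.eval w x y = x * y :=
  Nat.mod_eq_of_lt h

theorem Op.eval_div {w x y : ℕ} (h : x < 2 ^ w) : Op.div.eval w x y = x / y :=
  Nat.mod_eq_of_lt ((Nat.div_le_self _ _).trans_lt h)

theorem Op.eval_mod {w x y : ℕ} (h : x < 2 ^ w) : Op.mod.eval w x y = x % y :=
  Nat.mod_eq_of_lt ((Nat.mod_le _ _).trans_lt h)

theorem Op.eval_lt {w x y : ℕ} (h : 1 < 2 ^ w) : Op.lt.eval w x y = if x < y then 1 else 0 := by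
  rw [Op.eval, Nat.mod_eq_of_lt h]

theorem Op.eval_eq {w x y : ℕ} (h : 1 < 2 ^ w) : Op.eq.eval w x y = if x = y then 1 else 0 := by
  rw [Op.eval, Nat.mod_eq_of_lt h]

theorem Expr.eval_const {w k : ℕ} {s : State} (h : k < 2 ^ w) : (Expr.const k).eval w s = k :=
  Nat.mod_eq_of_lt h

@[simp] theorem Expr.eval_reg {w r : ℕ} {s : State} : (Expr.reg r).eval w s = s.reg r := rfl

@[simp] theorem Expr.eval_op {w : ℕ} {o : Op} {e₁ e₂ : Expr} {s : State} :
    (Expr.op o e₁ e₂).eval w s = o.eval w (e₁.eval w s) (e₂.eval w s) := rfl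

@[simp] theorem Expr.eval_load {w a : ℕ} {e : Expr} {s : State} :
    (Expr.load a e).eval w s = s.mem a (e.eval w s) := rfl

@[simp] theorem Prog.den_skip {w : ℕ} {s : State} : Prog.skip.den w s = s := rfl

@[simp] theorem Prog.den_assign {w r : ℕ} {e : Expr} {s : State} :
    (Prog.assign r e).den w s = s.setReg r (e.eval w s) := rfl

@[simp] theorem Prog.den_store {w a : ℕ} {i e : Expr} {s : State} :
    (Prog.store a i e).den w s = s.setMem a (i.eval w s) (e.eval w s) := rfl

@[simp] theorem Prog.den_seq {w : ℕ} {p q : Prog} {s : State} :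
    (Prog.seq p q).den w s = q.den w (p.den w s) := rfl

theorem Prog.den_ite_true {w : ℕ} {b : Expr} {p q : Prog} {s : State} (h : b.eval w s ≠ 0) :
    (Prog.ite b p q).den w s = p.den w s := if_pos h

theorem Prog.den_ite_false {w : ℕ} {b : Expr} {p q : Prog} {s : State} (h : b.eval w s = 0) :
    (Prog.ite b p q).den w s = q.den w s := if_neg (not_not.mpr h)

/-- Replace the content of register `r` by its minimum with `e`. -/
def minReg (r : ℕ) (e : Expr) : Prog := .ite (.op .lt e (.reg r)) (.assign r e) .skip

/-- Replace the content of register `r` by its maximum with `e`. -/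
def maxReg (r : ℕ) (e : Expr) : Prog := .ite (.op .lt (.reg r) e) (.assign r e) .skip

theorem State.setReg_self (s : State) (r : ℕ) : s.setReg r (s.reg r) = s := by
  simp [State.setReg]

theorem den_minReg {w r : ℕ} {e : Expr} {s : State} (h : 1 < 2 ^ w) :
    (minReg r e).den w s = s.setReg r (min (s.reg r) (e.eval w s)) := by
  by_cases hlt : e.eval w s < s.reg r
  · simp [minReg, Prog.den, Op.eval_lt h, hlt, min_eq_right hlt.le]
  · simp [minReg, Prog.den, Op.eval_lt h, hlt, min_eq_left (not_lt.mp hlt), State.setReg_self]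

theorem den_maxReg {w r : ℕ} {e : Expr} {s : State} (h : 1 < 2 ^ w) :
    (maxReg r e).den w s = s.setReg r (max (s.reg r) (e.eval w s)) := by
  by_cases hlt : s.reg r < e.eval w s
  · simp [maxReg, Prog.den, Op.eval_lt h, hlt, max_eq_right hlt.le]
  · simp [maxReg, Prog.den, Op.eval_lt h, hlt, max_eq_left (not_lt.mp hlt), State.setReg_self]

end WordRAM

/-! ### Combinatorics of range minima, strings and compacted tries -/

namespace TwoFamilies

/-! ### Minima over ranges -/

/-- The minimum of `top` and the values `l t` for `a ≤ t < b`. -/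
def rangeMin (top : ℕ) (l : ℕ → ℕ) (a : ℕ) : ℕ → ℕ
  | 0 => top
  | b + 1 => if a ≤ b then min (rangeMin top l a b) (l b) else top

theorem le_rangeMin_iff {top : ℕ} {l : ℕ → ℕ} {a b x : ℕ} :
    x ≤ rangeMin top l a b ↔ x ≤ top ∧ ∀ t, a ≤ t → t < b → x ≤ l t := by
  induction b with
  | zero => simp [rangeMin]
  | succ b ih =>
    rw [rangeMin]
    split_ifs with h
    · rw [le_min_iff, ih]
      constructor
      · rintro ⟨⟨h1, h2⟩, h3⟩
        refine ⟨h1, fun t ht ht' => ?_⟩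
        rcases Nat.lt_succ_iff_lt_or_eq.mp ht' with h4 | rfl
        · exact h2 t ht h4
        · exact h3
      · rintro ⟨h1, h2⟩
        exact ⟨⟨h1, fun t ht ht' => h2 t ht (by omega)⟩, h2 b h (by omega)⟩
    · exact ⟨fun h1 => ⟨h1, fun t _ _ => by omega⟩, fun h1 => h1.1⟩

theorem rangeMin_le_top (top : ℕ) (l : ℕ → ℕ) (a b : ℕ) : rangeMin top l a b ≤ top :=
  (le_rangeMin_iff.mp le_rfl).1

theorem rangeMin_le {top : ℕ} {l : ℕ → ℕ} {a b t : ℕ} (h : a ≤ t) (h' : t < b) :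
    rangeMin top l a b ≤ l t := (le_rangeMin_iff.mp le_rfl).2 t h h'

theorem rangeMin_of_le {top : ℕ} {l : ℕ → ℕ} {a b : ℕ} (h : b ≤ a) : rangeMin top l a b = top :=
  (rangeMin_le_top _ _ _ _).antisymm (le_rangeMin_iff.mpr ⟨le_rfl, fun t _ _ => by omega⟩)

theorem rangeMin_succ {top : ℕ} {l : ℕ → ℕ} {a b : ℕ} (h : a ≤ b) :
    rangeMin top l a (b + 1) = min (rangeMin top l a b) (l b) := by
  rw [rangeMin, if_pos h]

/-- Used at the middle of a block: the distance of two items in opposite halves splits into two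
one-sided minima. -/
theorem rangeMin_split {top : ℕ} {l : ℕ → ℕ} {a b c : ℕ} (h : a ≤ b) (h' : b ≤ c) :
    rangeMin top l a c = min (rangeMin top l a b) (rangeMin top l b c) := by
  refine eq_of_forall_le_iff fun x => ?_
  simp only [le_min_iff, le_rangeMin_iff]
  constructor
  · rintro ⟨h1, h2⟩
    exact ⟨⟨h1, fun t _ _ => h2 t (by omega) (by omega)⟩,
      h1, fun t _ _ => h2 t (by omega) (by omega)⟩
  · rintro ⟨⟨h1, h2⟩, _, h3⟩
    refine ⟨h1, fun t _ _ => ?_⟩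
    rcases lt_or_ge t b with h4 | h4
    · exact h2 t (by omega) h4
    · exact h3 t h4 (by omega)

theorem rangeMin_succ_left {top : ℕ} {l : ℕ → ℕ} {a b : ℕ} (h : a < b) (hl : l a ≤ top) :
    rangeMin top l a b = min (l a) (rangeMin top l (a + 1) b) := by
  rw [rangeMin_split (Nat.le_succ a) h, rangeMin_succ le_rfl, rangeMin_of_le le_rfl,
    min_eq_right hl]

theorem rangeMin_congr {top : ℕ} {l l' : ℕ → ℕ} {a b : ℕ}
    (h : ∀ t, a ≤ t → t < b → l t = l' t) : rangeMin top l a b = rangeMin top l' a b := by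
  refine eq_of_forall_le_iff fun x => ?_
  simp only [le_rangeMin_iff]
  refine and_congr_right fun _ => forall_congr' fun t => ?_
  constructor
  · intro h1 h2 h3; rw [← h t h2 h3]; exact h1 h2 h3
  · intro h1 h2 h3; rw [h t h2 h3]; exact h1 h2 h3

theorem rangeMin_mono {top : ℕ} {l : ℕ → ℕ} {a a' b b' : ℕ} (h : a' ≤ a) (h' : b ≤ b') :
    rangeMin top l a' b' ≤ rangeMin top l a b :=
  le_rangeMin_iff.mpr ⟨rangeMin_le_top _ _ _ _, fun _ _ _ =>
    rangeMin_le (by omega) (by omega)⟩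

/-! ### Longest common prefixes -/

theorem le_LCP_iff {U V : Str} {p : ℕ} :
    p ≤ LCP U V ↔ p ≤ U.length ∧ p ≤ V.length ∧ U.take p = V.take p := by
  have h0 : U.take (LCP U V) = V.take (LCP U V) :=
    Nat.findGreatest_spec (P := fun p => U.take p = V.take p) (Nat.zero_le _) rfl
  constructor
  · intro h
    have h1 : LCP U V ≤ min U.length V.length := Nat.findGreatest_le _
    refine ⟨by omega, by omega, ?_⟩
    have := congrArg (List.take p) h0
    rwa [List.take_take, List.take_take, min_eq_left h] at this
  · rintro ⟨h1, h2, h3⟩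
    exact Nat.le_findGreatest (le_min h1 h2) h3

theorem LCP_comm (U V : Str) : LCP U V = LCP V U := by
  refine eq_of_forall_le_iff fun p => ?_
  rw [le_LCP_iff, le_LCP_iff]
  tauto

theorem LCP_self (U : Str) : LCP U U = U.length := by
  refine eq_of_forall_le_iff fun p => ?_
  rw [le_LCP_iff]
  tauto

theorem LCP_le_left (U V : Str) : LCP U V ≤ U.length := (le_LCP_iff.mp le_rfl).1

theorem LCP_le_right (U V : Str) : LCP U V ≤ V.length := (le_LCP_iff.mp le_rfl).2.1

/-- The first disagreement with `y` already occurs inside `u`. In the search this transfers LCPs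
from a node to its children. -/
theorem LCP_eq_of_prefix_of_not_prefix {u x y : Str} (h : u <+: x) (h' : ¬ u <+: y) :
    LCP x y = LCP u y := by
  refine eq_of_forall_le_iff fun p => ?_
  rw [le_LCP_iff, le_LCP_iff]
  have key : ∀ p, p ≤ u.length → x.take p = u.take p := by
    obtain ⟨t, rfl⟩ := h
    intro p hp
    rw [List.take_append_of_le_length hp]
  constructor
  · rintro ⟨h1, h2, h3⟩
    have hp : p ≤ u.length := by
      by_contra hp
      refine h' ?_
      have h4 := congrArg (List.take u.length) h3
      rw [List.take_take, List.take_take, min_eq_left (by omega), key _ le_rfl,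
        List.take_length] at h4
      rw [h4]
      exact List.take_prefix _ _
    exact ⟨hp, h2, by rw [← key p hp, h3]⟩
  · rintro ⟨h1, h2, h3⟩
    exact ⟨h1.trans h.length_le, h2, by rw [key p h1, h3]⟩

theorem LCP_eq_of_prefix {U V : Str} (h : U <+: V) : LCP U V = U.length := by
  refine (LCP_le_left _ _).antisymm (le_LCP_iff.mpr ⟨le_rfl, h.length_le, ?_⟩)
  obtain ⟨t, rfl⟩ := h
  simp

theorem LCP_eq_of_diverge {z U V : Str} {a b : ℕ} (hab : a ≠ b) (hU : z ++ [a] <+: U)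
    (hV : z ++ [b] <+: V) : LCP U V = z.length := by
  obtain ⟨s, rfl⟩ := hU
  obtain ⟨t, rfl⟩ := hV
  refine eq_of_forall_le_iff fun p => ?_
  rw [le_LCP_iff]
  constructor
  · rintro ⟨_, _, h⟩
    by_contra hp
    have h1 := congrArg (fun l : List ℕ => l[z.length]?) h
    simp only [List.getElem?_take, List.append_assoc] at h1
    rw [if_pos (by omega), if_pos (by omega)] at h1
    simp at h1
    exact hab h1
  · intro h
    refine ⟨by simp; omega, by simp; omega, ?_⟩
    rw [List.append_assoc, List.append_assoc, List.take_append_of_le_length h,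
      List.take_append_of_le_length h]

/-- The witness is the longest common prefix: it is shorter than both strings, and equal next
letters would extend it. -/
theorem exists_diverge {U V : Str} (h : ¬ U <+: V) (h' : ¬ V <+: U) :
    ∃ (z : Str) (a b : ℕ), a ≠ b ∧ z ++ [a] <+: U ∧ z ++ [b] <+: V := by
  obtain ⟨h1, h2, h3⟩ := le_LCP_iff.mp (le_refl (LCP U V))
  have h4 : LCP U V < U.length := by
    refine lt_of_le_of_ne h1 fun e => h ?_
    rw [e, List.take_length] at h3
    rw [h3]
    exact List.take_prefix _ _
  have h5 : LCP U V < V.length := by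
    refine lt_of_le_of_ne h2 fun e => h' ?_
    rw [e, List.take_length] at h3
    rw [← h3]
    exact List.take_prefix _ _
  have hU : U.take (LCP U V + 1) = U.take (LCP U V) ++ [U[LCP U V]] :=
    List.take_succ_eq_append_getElem h4
  have hV : V.take (LCP U V + 1) = U.take (LCP U V) ++ [V[LCP U V]] := by
    rw [h3]; exact List.take_succ_eq_append_getElem h5
  refine ⟨U.take (LCP U V), U[LCP U V], V[LCP U V], fun e => ?_, ?_, ?_⟩
  · have : LCP U V + 1 ≤ LCP U V := le_LCP_iff.mpr ⟨h4, h5, by rw [hU, hV, e]⟩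
    omega
  · rw [← hU]; exact List.take_prefix _ _
  · rw [← hV]; exact List.take_prefix _ _

/-! ### The number of nodes of a compacted trie -/

/-- Induction on `F`: inserting `U` creates at most one branching node. Two new ones would both be
prefixes of `U`. The longer one is also a prefix of an old string, which therefore follows `U`
beyond the shorter one, while another old string leaves `U` there; so the shorter one was branching
before. -/
theorem exists_branching_finset (F : Finset Str) :
    ∃ S : Finset Str, S.card ≤ F.card ∧ ∀ v, IsBranching F v → v ∈ S := by
  classical
  induction F using Finset.induction_on with
  | empty =>
    refine ⟨∅, le_rfl, fun v h => ?_⟩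
    obtain ⟨_, _, _, ⟨U, hU, _⟩, _⟩ := h
    simp at hU
  | insert U F hU ih =>
    obtain ⟨S, hS, hv⟩ := ih
    -- a new branching node is a prefix of `U` that is left by some `V ∈ F`
    have new : ∀ v, IsBranching (insert U F) v → ¬ IsBranching F v →
        (∃ a, v ++ [a] <+: U ∧ ∃ b, a ≠ b ∧ ∃ V ∈ F, v ++ [b] <+: V) := by
      rintro v ⟨a, b, hab, ⟨A, hA, hA'⟩, B, hB, hB'⟩ hn
      rcases Finset.mem_insert.mp hA with rfl | hA
      · rcases Finset.mem_insert.mp hB with rfl | hB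
        · refine absurd ?_ hab
          have := (List.prefix_of_prefix_length_le hA' hB' (by simp)).eq_of_length (by simp)
          simpa using this
        · exact ⟨a, hA', b, hab, B, hB, hB'⟩
      · rcases Finset.mem_insert.mp hB with rfl | hB
        · exact ⟨b, hB', a, hab.symm, A, ‹_›, hA'⟩
        · exact absurd ⟨a, b, hab, ⟨A, ‹_›, hA'⟩, B, hB, hB'⟩ hn
    have uniq : ∀ v v', IsBranching (insert U F) v → ¬ IsBranching F v →
        IsBranching (insert U F) v' → ¬ IsBranching F v' → v.length ≤ v'.length → v = v' := by
      intro v v' h1 h2 h3 h4 hlen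
      obtain ⟨a, ha, b, hab, V, hV, hV'⟩ := new v h1 h2
      obtain ⟨a', ha', b', -, V', hVV, hVV'⟩ := new v' h3 h4
      have hvU : v <+: U := (List.prefix_append _ _).trans ha
      have hvU' : v' <+: U := (List.prefix_append _ _).trans ha'
      by_contra hne
      have hlt : v.length < v'.length := by
        refine lt_of_le_of_ne hlen fun e => hne ?_
        exact (List.prefix_of_prefix_length_le hvU hvU' e.le).eq_of_length e
      have h5 : v ++ [a] <+: v' := List.prefix_of_prefix_length_le ha hvU' (by simp; omega)
      exact h2 ⟨a, b, hab, ⟨V', hVV, h5.trans ((List.prefix_append _ _).trans hVV')⟩, V, hV, hV'⟩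
    by_cases hex : ∃ v, IsBranching (insert U F) v ∧ ¬ IsBranching F v
    · obtain ⟨v, h1, h2⟩ := hex
      refine ⟨insert v S, ?_, fun v' h => ?_⟩
      · rw [Finset.card_insert_of_notMem hU]
        exact (Finset.card_insert_le _ _).trans (Nat.succ_le_succ hS)
      · by_cases h' : IsBranching F v'
        · exact Finset.mem_insert_of_mem (hv v' h')
        · rcases le_total v.length v'.length with hl | hl
          · rw [uniq v v' h1 h2 h h' hl]; exact Finset.mem_insert_self _ _
          · rw [uniq v' v h h' h1 h2 hl]; exact Finset.mem_insert_self _ _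
    · push Not at hex
      exact ⟨S, hS.trans (Finset.card_le_card (Finset.subset_insert _ _)),
        fun v h => hv v (hex v h)⟩

theorem CompactedTrie.size_le {F : Finset Str} (T : CompactedTrie F) :
    T.size ≤ 2 * F.card + 1 := by
  classical
  obtain ⟨S, hS, hv⟩ := exists_branching_finset F
  have : Finset.univ.image T.node ⊆ insert [] (F ∪ S) := by
    intro v hv'
    obtain ⟨i, -, rfl⟩ := Finset.mem_image.mp hv'
    rcases (T.isNode_iff _).mpr ⟨i, rfl⟩ with h | h | h
    · rw [h]; exact Finset.mem_insert_self _ _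
    · exact Finset.mem_insert_of_mem (Finset.mem_union_left _ h)
    · exact Finset.mem_insert_of_mem (Finset.mem_union_right _ (hv _ h))
  have h1 := Finset.card_le_card this
  rw [Finset.card_image_of_injective _ T.node_injective, Finset.card_univ, Fintype.card_fin] at h1
  have h2 := Finset.card_insert_le ([] : Str) (F ∪ S)
  have h3 := Finset.card_union_le F S
  omega

/-! ### Linked lists in memory -/

/-- The linked list with start `p`, successors `next` and null pointer `null` has the entries `l`. -/
def Chain (next : ℕ → ℕ) (null : ℕ) : ℕ → List ℕ → Prop
  | p, [] => p = null
  | p, x :: l => p = x ∧ x ≠ null ∧ Chain next null (next x) l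

theorem Chain.congr {next next' : ℕ → ℕ} {null p : ℕ} {l : List ℕ}
    (h : ∀ x ∈ l, next x = next' x) (hl : Chain next null p l) : Chain next' null p l := by
  induction l generalizing p with
  | nil => exact hl
  | cons x l ih =>
    obtain ⟨h1, h2, h3⟩ := hl
    refine ⟨h1, h2, ih (fun y hy => h y (List.mem_cons_of_mem _ hy)) ?_⟩
    rw [← h x List.mem_cons_self]
    exact h3

theorem Chain.eq_nil_iff {next : ℕ → ℕ} {null p : ℕ} {l : List ℕ} (h : Chain next null p l) :
    p = null ↔ l = [] := by
  cases l with
  | nil => simpa [Chain] using h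
  | cons x l =>
    obtain ⟨rfl, h2, -⟩ := h
    simp [h2]

theorem Chain.exists_cons {next : ℕ → ℕ} {null p : ℕ} {l : List ℕ} (h : Chain next null p l)
    (hp : p ≠ null) : ∃ l', l = p :: l' ∧ Chain next null (next p) l' := by
  cases l with
  | nil => exact absurd h hp
  | cons x l =>
    obtain ⟨rfl, -, h3⟩ := h
    exact ⟨l, rfl, h3⟩

/-- The stack of height `t` stored in `f` has the entries `l`, from top to bottom. -/
def StackRep (f : ℕ → ℕ) : ℕ → List ℕ → Prop
  | 0, l => l = []
  | t + 1, l => ∃ l', l = f t :: l' ∧ StackRep f t l'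

theorem StackRep.congr {f f' : ℕ → ℕ} {t : ℕ} {l : List ℕ} (h : ∀ i < t, f i = f' i)
    (hl : StackRep f t l) : StackRep f' t l := by
  induction t generalizing l with
  | zero => exact hl
  | succ t ih =>
    obtain ⟨l', rfl, h'⟩ := hl
    exact ⟨l', by rw [h t (Nat.lt_succ_self t)], ih (fun i hi => h i (hi.trans (Nat.lt_succ_self t))) h'⟩

theorem StackRep.length {f : ℕ → ℕ} {t : ℕ} {l : List ℕ} (h : StackRep f t l) : l.length = t := by
  induction t generalizing l with
  | zero => rw [show l = [] from h]; rfl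
  | succ t ih =>
    obtain ⟨l', rfl, h'⟩ := h
    rw [List.length_cons, ih h']

theorem IsLinked.eq_of {β : Type} {next : β → Option β} {p : Option β} {l l' : List β}
    (h : IsLinked next p l) (h' : IsLinked next p l') : l = l' := by
  induction l generalizing p l' with
  | nil =>
    cases l' with
    | nil => rfl
    | cons y l' => rw [show p = none from h] at h'; exact absurd h'.1 (by simp)
  | cons x l ih =>
    cases l' with
    | nil => rw [show p = none from h'] at h; exact absurd h.1 (by simp)
    | cons y l' =>
      obtain ⟨h1, h2⟩ := h
      obtain ⟨h3, h4⟩ := h'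
      have : x = y := by simpa [h1] using h3
      subst this
      rw [ih h2 h4]

theorem IsLinked.append {β : Type} {next : β → Option β} {p : Option β} {l l' : List β} {x : β}
    (h : IsLinked next p (l ++ x :: l')) : IsLinked next (next x) l' := by
  induction l generalizing p with
  | nil => exact h.2
  | cons y l ih => exact ih h.2

/-- The successor pointer determines the rest of the list, so an entry occurring twice would be
followed by two lists of different lengths. -/
theorem IsLinked.nodup {β : Type} {next : β → Option β} {p : Option β} {l : List β}
    (h : IsLinked next p l) : l.Nodup := by
  induction l generalizing p with
  | nil => exact List.nodup_nil
  | cons x l ih =>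
    refine List.nodup_cons.mpr ⟨fun hx => ?_, ih h.2⟩
    obtain ⟨a, b, rfl⟩ := List.append_of_mem hx
    have h1 := IsLinked.eq_of h.2 (IsLinked.append h.2)
    have := congrArg List.length h1
    simp at this
    omega

/-! ### The nodes of a compacted trie, numbered by natural numbers -/

/-- The tree structure of a compacted trie: node `v < n` spells `str v`, has the children `ch v`,
and `pd v` is one plus the depth of its parent. -/
structure TrieView (n root : ℕ) (str : ℕ → Str) (ch : ℕ → List ℕ) (pd : ℕ → ℕ) : Prop where
  root_lt : root < n
  str_root : str root = []
  pd_root : pd root = 0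
  inj : ∀ u < n, ∀ v < n, str u = str v → u = v
  ch_nodup : ∀ u < n, (ch u).Nodup
  ch_lt : ∀ u < n, ∀ v ∈ ch u, v < n
  ch_prefix : ∀ u < n, ∀ v ∈ ch u, str u <+: str v ∧ str u ≠ str v
  ch_pd : ∀ u < n, ∀ v ∈ ch u, pd v = (str u).length + 1
  siblings : ∀ u < n, ∀ v ∈ ch u, ∀ v' ∈ ch u, v ≠ v' →
    LCP (str v) (str v') = (str u).length ∧ ¬ str v <+: str v'
  cover : ∀ u < n, ∀ x < n, str u <+: str x → u ≠ x → ∃ v ∈ ch u, str v <+: str x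

theorem IsNode.exists_prefix {F : Finset Str} {v : Str} (h : IsNode F v) (hv : v ≠ []) :
    ∃ U ∈ F, v <+: U := by
  rcases h with h | h | ⟨a, b, _, ⟨U, hU, hU'⟩, _⟩
  · exact absurd h hv
  · exact ⟨v, h, List.prefix_rfl⟩
  · exact ⟨U, hU, (List.prefix_append _ _).trans hU'⟩

theorem IsChild.ne_nil {F : Finset Str} {u v : Str} (h : IsChild F u v) : v ≠ [] := by
  rintro rfl
  exact h.2.2.2.1 (List.prefix_nil.mp h.2.2.1)

theorem IsChild.parent_unique {F : Finset Str} {u u' v : Str} (h : IsChild F u v)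
    (h' : IsChild F u' v) : u = u' := by
  rcases List.prefix_or_prefix_of_prefix h.2.2.1 h'.2.2.1 with hp | hp
  · rcases h.2.2.2.2 u' h'.1 hp h'.2.2.1 with e | e
    · exact e.symm
    · exact absurd e h'.2.2.2.1
  · rcases h'.2.2.2.2 u h.1 hp h.2.2.1 with e | e
    · exact e
    · exact absurd e h.2.2.2.1

/-- The point where the two children diverge is a branching node lying between `u` and `v`. No node
lies strictly between them, and it is shorter than `v`, so it is `u`. -/
theorem IsChild.siblings {F : Finset Str} {u v v' : Str} (h : IsChild F u v)
    (h' : IsChild F u v') (hne : v ≠ v') : LCP v v' = u.length ∧ ¬ v <+: v' := by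
  have inc : ∀ {v v'}, IsChild F u v → IsChild F u v' → v ≠ v' → ¬ v <+: v' := by
    intro v v' h h' hne hp
    rcases h'.2.2.2.2 v h.2.1 h.2.2.1 hp with e | e
    · exact h.2.2.2.1 e.symm
    · exact hne e
  refine ⟨?_, inc h h' hne⟩
  obtain ⟨z, a, b, hab, ha, hb⟩ := exists_diverge (inc h h' hne) (inc h' h hne.symm)
  rw [LCP_eq_of_diverge hab ha hb]
  obtain ⟨U, hU, hvU⟩ := h.2.1.exists_prefix h.ne_nil
  obtain ⟨V, hV, hvV⟩ := h'.2.1.exists_prefix h'.ne_nil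
  have hz : IsNode F z := .inr (.inr ⟨a, b, hab, ⟨U, hU, ha.trans hvU⟩, V, hV, hb.trans hvV⟩)
  have hlt : z.length < v.length := by simpa using ha.length_le
  have hle : u.length ≤ z.length := by
    rw [← LCP_eq_of_diverge hab ha hb]
    obtain ⟨s, hs⟩ := h.2.2.1
    obtain ⟨s', hs'⟩ := h'.2.2.1
    exact le_LCP_iff.mpr ⟨h.2.2.1.length_le, h'.2.2.1.length_le, by simp [← hs, ← hs']⟩
  have hzv : z <+: v := (List.prefix_append _ _).trans ha
  rcases h.2.2.2.2 z hz (List.prefix_of_prefix_length_le h.2.2.1 hzv hle) hzv with e | e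
  · rw [e]
  · rw [e] at hlt; omega

/-- Take the shortest node that properly extends `u` and is a prefix of `x`. -/
theorem exists_child {F : Finset Str} {u x : Str} (hu : IsNode F u) (hx : IsNode F x)
    (h : u <+: x) (hne : u ≠ x) : ∃ v, IsChild F u v ∧ v <+: x := by
  classical
  have hex : ∃ k, ∃ v, IsNode F v ∧ u <+: v ∧ u ≠ v ∧ v <+: x ∧ v.length = k :=
    ⟨_, x, hx, h, hne, List.prefix_rfl, rfl⟩
  obtain ⟨v, h1, h2, h3, h4, h5⟩ := Nat.find_spec hex
  refine ⟨v, ⟨hu, h1, h2, h3, fun y hy hy1 hy2 => ?_⟩, h4⟩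
  by_cases he : y = u
  · exact .inl he
  · refine .inr (hy2.eq_of_length (hy2.length_le.antisymm ?_))
    rw [h5]
    exact Nat.find_min' hex ⟨y, hy, hy1, Ne.symm he, hy2.trans h4, rfl⟩

namespace CompactedTrie

variable {F : Finset Str} (T : CompactedTrie F)

/-- The string spelled by node number `v`. -/
def nodeStr (v : ℕ) : Str := if h : v < T.size then T.node ⟨v, h⟩ else []

/-- The children of node number `u`, in the order of the linked list. -/
noncomputable def childList (u : ℕ) : List ℕ :=
  if h : u < T.size then (T.children ⟨u, h⟩).choose.map Fin.val else []

open Classical in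
/-- One plus the depth of the parent of node number `v`. -/
noncomputable def parentDepth (v : ℕ) : ℕ :=
  if h : ∃ u, IsChild F u (T.nodeStr v) then h.choose.length + 1 else 0

theorem nodeStr_val (v : Fin T.size) : T.nodeStr v = T.node v := by
  simp [nodeStr]

theorem mem_childList {u : Fin T.size} {v : ℕ} :
    v ∈ T.childList u ↔ v < T.size ∧ IsChild F (T.node u) (T.nodeStr v) := by
  have h := (T.children u).choose_spec.2
  simp only [childList, u.2, dite_true, List.mem_map]
  constructor
  · rintro ⟨x, hx, rfl⟩
    refine ⟨x.2, ?_⟩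
    rw [nodeStr_val]
    exact (h x).mp hx
  · rintro ⟨hv, hc⟩
    refine ⟨⟨v, hv⟩, (h _).mpr ?_, rfl⟩
    simpa [nodeStr, hv] using hc

theorem isNode_nodeStr {v : ℕ} (h : v < T.size) : IsNode F (T.nodeStr v) :=
  (T.isNode_iff _).mpr ⟨⟨v, h⟩, (T.nodeStr_val _).symm⟩

theorem parentDepth_eq {u : Str} {v : ℕ} (h : IsChild F u (T.nodeStr v)) :
    T.parentDepth v = u.length + 1 := by
  have hex : ∃ u, IsChild F u (T.nodeStr v) := ⟨u, h⟩
  rw [parentDepth, dif_pos hex, IsChild.parent_unique hex.choose_spec h]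

theorem trieView : TrieView T.size T.root T.nodeStr T.childList T.parentDepth where
  root_lt := T.root.2
  str_root := by rw [nodeStr_val, T.node_root]
  pd_root := by
    refine dif_neg ?_
    rw [nodeStr_val, T.node_root]
    exact fun ⟨u, hu⟩ => hu.ne_nil rfl
  inj u hu v hv h := by
    have := T.node_injective (a₁ := ⟨u, hu⟩) (a₂ := ⟨v, hv⟩) (by simpa [nodeStr, hu, hv] using h)
    simpa using this
  ch_nodup u hu := by
    have h := (T.children ⟨u, hu⟩).choose_spec.1.nodup
    simp only [childList, hu, dite_true]
    exact h.map Fin.val_injective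
  ch_lt u hu v hv := ((T.mem_childList (u := ⟨u, hu⟩)).mp hv).1
  ch_prefix u hu v hv := by
    have h := ((T.mem_childList (u := ⟨u, hu⟩)).mp hv).2
    rw [← nodeStr_val] at h
    exact ⟨h.2.2.1, h.2.2.2.1⟩
  ch_pd u hu v hv := by
    have h := ((T.mem_childList (u := ⟨u, hu⟩)).mp hv).2
    rw [T.parentDepth_eq h, ← nodeStr_val]
  siblings u hu v hv v' hv' hne := by
    have h := (T.mem_childList (u := ⟨u, hu⟩)).mp hv
    have h' := (T.mem_childList (u := ⟨u, hu⟩)).mp hv'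
    rw [← nodeStr_val] at h h'
    refine h.2.siblings h'.2 fun e => hne ?_
    have := T.node_injective (a₁ := ⟨v, h.1⟩) (a₂ := ⟨v', h'.1⟩)
      (by simpa [nodeStr, h.1, h'.1] using e)
    simpa using this
  cover u hu x hx hp hne := by
    have hs : T.nodeStr u ≠ T.nodeStr x := by
      intro e
      have := T.node_injective (a₁ := ⟨u, hu⟩) (a₂ := ⟨x, hx⟩) (by simpa [nodeStr, hu, hx] using e)
      exact hne (by simpa using this)
    obtain ⟨v, hv, hvx⟩ := exists_child (T.isNode_nodeStr hu) (T.isNode_nodeStr hx) hp hs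
    obtain ⟨i, rfl⟩ := (T.isNode_iff v).mp hv.2.1
    rw [← nodeStr_val] at hv hvx
    exact ⟨i, (T.mem_childList (u := ⟨u, hu⟩)).mpr ⟨i.2, by rw [← nodeStr_val]; exact hv⟩, hvx⟩

end CompactedTrie

end TwoFamilies

/-! ### The algorithm and its analysis -/

namespace TwoFamilies

set_option linter.unusedSimpArgs false

open WordRAM Expr Prog

local infixr:60 " ;; " => Prog.seq

/-! ### Bucketing the items by node -/

/-- Pointers to the items below `i` with the given key, the largest one first. -/
def bucket (key : ℕ → ℕ) (i v : ℕ) : List ℕ :=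
  (((List.range i).filter fun x => key x = v).map (· + 1)).reverse

theorem mem_bucket {key : ℕ → ℕ} {i v p : ℕ} :
    p ∈ bucket key i v ↔ ∃ x < i, key x = v ∧ x + 1 = p := by
  simp [bucket, and_assoc]

theorem nodup_bucket (key : ℕ → ℕ) (i v : ℕ) : (bucket key i v).Nodup := by
  rw [bucket, List.nodup_reverse]
  exact (List.nodup_range.filter _).map fun a b h => Nat.succ_injective h

theorem bucket_succ (key : ℕ → ℕ) (i v : ℕ) :
    bucket key (i + 1) v = if key i = v then (i + 1) :: bucket key i v else bucket key i v := by
  by_cases h : key i = v <;> simp [bucket, List.range_succ, h]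

/-- The body of `bucketProg`. -/
def bucketBody (a b o : ℕ) : Prog :=
  ite (op .lt (reg 7) (reg 3)) (assign 8 (load a (reg 7)))
    (assign 8 (load b (op .sub (reg 7) (reg 3)))) ;;
  -- Item `x` is represented by the pointer `x + 1`, because unused memory is `0` and thus acts as
  -- the null pointer.
  store (o + 21) (op .add (reg 7) (const 1)) (load (o + 20) (reg 8)) ;;
  store (o + 20) (reg 8) (op .add (reg 7) (const 1)) ;;
  assign 7 (op .add (reg 7) (const 1))

/-- Link all items with the same key in a list; the keys are stored in the arrays `a` and `b`. -/
def bucketProg (a b o : ℕ) : Prog :=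
  assign 7 (const 0) ;; loop (op .lt (reg 7) (reg 5)) (bucketBody a b o)

/-- The key of item `x`. -/
def itemKey (s : State) (a b x : ℕ) : ℕ :=
  if x < s.reg 3 then s.mem a x else s.mem b (x - s.reg 3)

theorem runs_bucketProg {w a b o N : ℕ} {s : State} (ha : a < 20) (hb : b < 20)
    (hw : N + 2 ≤ 2 ^ w) (hN : s.reg 5 = N) (hhead : ∀ v, s.mem (o + 20) v = 0) :
    Runs w (bucketProg a b o) s (40 * N + 10) fun s' =>
      ∀ v, Chain (s'.mem (o + 21)) 0 (s'.mem (o + 20) v) (bucket (itemKey s a b) N v) := by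
  have h1w : 1 < 2 ^ w := by omega
  have h0 : ∀ s, (const 0).eval w s = 0 := fun s => eval_const (by omega)
  have h1 : ∀ s, (const 1).eval w s = 1 := fun s => eval_const (by omega)
  have e1 : a ≠ o + 20 := by omega
  have e2 : a ≠ o + 21 := by omega
  have e3 : b ≠ o + 20 := by omega
  have e4 : b ≠ o + 21 := by omega
  refine (Runs.seq (n := 2) (m := 40 * N + 8) (Runs.den (Q := (· = _)) rfl rfl) ?_).mono
    (by omega) fun _ h => h
  rintro s₀ - rfl
  refine (Runs.loop (c := (bucketBody a b o).bound) (m := N) (fun m s' => ∃ i, s'.reg 7 = i ∧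
    i ≤ N ∧ m = N - i ∧ ∀ v, Chain (s'.mem (o + 21)) 0 (s'.mem (o + 20) v)
      (bucket (itemKey s a b) i v)) ?_ ?_).mono ?_ ?_
  · rintro m s' hf ⟨i, hi, hiN, rfl, hch⟩ hcond
    have r3 : s'.reg 3 = s.reg 3 := by rw [hf.1 3 rfl]; simp [h0]
    have r5 : s'.reg 5 = N := by rw [hf.1 5 rfl]; simp [hN]
    have ma : s'.mem a = s.mem a := by
      rw [hf.2 a (by simp [bucketBody, writesMem, e1, e2])]; simp
    have mb : s'.mem b = s.mem b := by
      rw [hf.2 b (by simp [bucketBody, writesMem, e3, e4])]; simp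
    have hlt : i < N := by simpa [Op.eval_lt h1w, hi, r5] using hcond
    have key : ((ite (op .lt (reg 7) (reg 3)) (assign 8 (load a (reg 7)))
        (assign 8 (load b (op .sub (reg 7) (reg 3))))).den w s') =
        s'.setReg 8 (itemKey s a b i) := by
      by_cases hc : i < s.reg 3
      · rw [den_ite_true (by simp [Op.eval_lt h1w, hi, r3, hc])]
        simp [itemKey, hc, ma, hi]
      · rw [den_ite_false (by simp [Op.eval_lt h1w, hi, r3, hc])]
        simp (disch := omega) [itemKey, hc, mb, hi, r3, Op.eval_sub]
    refine Runs.den rfl ⟨N - (i + 1), by omega, i + 1, ?_, hlt, rfl, fun v => ?_⟩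
    · simp (disch := omega) [bucketBody, key, h1, hi, Op.eval_add]
    · have hch' := hch v
      -- The older lists contain only smaller pointers, so writing the successor cell of the new
      -- item leaves them intact.
      have hne : ∀ x ∈ bucket (itemKey s a b) i v, x ≠ i + 1 := by
        intro x hx
        obtain ⟨y, hy, -, rfl⟩ := mem_bucket.mp hx
        omega
      by_cases hv : itemKey s a b i = v
      · simp (disch := omega) [bucketBody, key, h1, hi, Op.eval_add, bucket_succ, hv, Chain]
        exact hch'.congr fun x hx => by simp [hne x hx]
      · simp (disch := omega) [bucketBody, key, h1, hi, Op.eval_add, bucket_succ, hv]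
        exact hch'.congr fun x hx => by simp [hne x hx]
  · refine ⟨0, by simp [h0], Nat.zero_le _, rfl, fun v => ?_⟩
    simp [bucket, Chain, hhead]
  · simp only [bucketBody, bound, cost]
    omega
  · rintro s' ⟨hf, hcond, m, i, hi, hiN, -, hch⟩
    have r5 : s'.reg 5 = N := by rw [hf.1 5 rfl]; simp [hN]
    have : N ≤ i := by simpa [Op.eval_lt h1w, hi, r5] using hcond
    rw [show N = i by omega]
    exact hch

/-! ### The depth-first search, abstractly -/

/-- `y` is visited after `x`, neither is an ancestor of the other one. -/
def Apart (str : ℕ → Str) (pd : ℕ → ℕ) (x y : ℕ) : Prop :=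
  LCP (str x) (str y) + 1 = pd y ∧ pd y ≤ pd x ∧ ¬ str x <+: str y ∧ ¬ str y <+: str x

/-- The state of the search: `V` are the visited nodes, the last of which spells `us`, `bl` are
pointers to its items that are still to be output, `cl` are its children that are still to be put on
the stack `St`.  The `k` items output so far are `ord 0, …, ord (k - 1)`. -/
structure SearchInv (n : ℕ) (str : ℕ → Str) (pd : ℕ → ℕ) (N : ℕ) (key : ℕ → ℕ) (top : ℕ)
    (V bl cl St : List ℕ) (us : Str) (du cur k : ℕ) (ord l rank : ℕ → ℕ) : Prop where
  nodup : (V ++ (cl ++ St)).Nodup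
  lt : ∀ v ∈ V ++ (cl ++ St), v < n
  cover : ∀ v < n, v ∈ V ∨ ∃ y ∈ cl ++ St, str y <+: str v
  visited : ∀ v ∈ V, ∀ y ∈ cl ++ St, ¬ str y <+: str v
  apart_cl : ∀ x ∈ cl, ∀ y ∈ cl, x ≠ y → Apart str pd x y
  apart_cl_St : ∀ x ∈ cl, ∀ y ∈ St, Apart str pd x y
  apart_St : St.Pairwise (Apart str pd)
  du_eq : du = us.length + 1
  du_le : us.length + 1 ≤ top
  ch_pd : ∀ y ∈ cl, pd y = du
  -- `cur` is the minimum of the values `pd` of all nodes popped since the last output, and of one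
  -- plus the depth of the node of that output. It becomes the next entry of `l`.
  current : ∀ a < k, min (rangeMin top l (a + 1) k) cur = LCP (str (key (ord a))) us + 1
  -- The guard exempts the initial state, where the empty string stands in for a visited node while
  -- the root, with `pd` equal to `0`, is still on the stack.
  current_pending : bl ≠ [] → ∀ y ∈ cl ++ St,
    LCP us (str y) + 1 = pd y ∧ ¬ str y <+: us
  pending : ∀ a < k, ∀ y ∈ cl ++ St,
    min (rangeMin top l (a + 1) k) (min cur (pd y)) = LCP (str (key (ord a))) (str y) + 1 ∧
      ¬ str y <+: str (key (ord a))
  out : ∀ a b, a < b → b < k →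
    rangeMin top l (a + 1) (b + 1) = LCP (str (key (ord a))) (str (key (ord b))) + 1
  cur_zero : k = 0 → cur = 0
  l_zero : 0 < k → l 0 = 0
  l_beyond : ∀ j, k ≤ j → l j = 0
  ord_lt : ∀ a < k, ord a < N ∧ rank (ord a) = a
  done : ∀ x < N, key x ∈ V → x + 1 ∈ bl ∨ (rank x < k ∧ ord (rank x) = x)
  todo : ∀ p ∈ bl, ∃ x < N, p = x + 1 ∧ str (key x) = us ∧ ∀ a < k, ord a ≠ x
  bl_nodup : bl.Nodup

namespace SearchInv

variable {n root : ℕ} {str : ℕ → Str} {ch : ℕ → List ℕ} {pd : ℕ → ℕ} {N : ℕ} {key : ℕ → ℕ}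
  {top : ℕ} {V bl cl St : List ℕ} {us : Str} {du cur k : ℕ} {ord l rank : ℕ → ℕ}

/-- The outputs are distinct, since `rank` inverts `ord` on them, and the pending item is not among
them. -/
theorem lt_N_of_cons {x : ℕ}
    (h : SearchInv n str pd N key top V ((x + 1) :: bl) cl St us du cur k ord l rank) : k < N := by
  obtain ⟨x', hx, hx', -, hne⟩ := h.todo (x + 1) List.mem_cons_self
  obtain rfl : x = x' := by omega
  have hsub : (Finset.range k).image ord ⊆ (Finset.range N).erase x := by
    intro y hy
    obtain ⟨a, ha, rfl⟩ := Finset.mem_image.mp hy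
    rw [Finset.mem_range] at ha
    exact Finset.mem_erase.mpr ⟨hne a ha, Finset.mem_range.mpr (h.ord_lt a ha).1⟩
  have hcard := Finset.card_le_card hsub
  rw [Finset.card_image_of_injOn, Finset.card_erase_of_mem (Finset.mem_range.mpr hx),
    Finset.card_range, Finset.card_range] at hcard
  · omega
  · intro a ha b hb hab
    have ha' := (h.ord_lt a (by simpa using ha)).2
    have hb' := (h.ord_lt b (by simpa using hb)).2
    rw [← ha', ← hb', hab]

/-- The accumulated minimum becomes `l k`, which turns `current` into `out`. Restarting `cur` at
`du` loses nothing, since no LCP with `us` exceeds the length of `us`. -/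
theorem emit {x : ℕ}
    (h : SearchInv n str pd N key top V ((x + 1) :: bl) cl St us du cur k ord l rank) :
    SearchInv n str pd N key top V bl cl St us du du (k + 1) (Function.update ord k x)
      (Function.update l k cur) (Function.update rank x k) := by
  obtain ⟨x', hx, hx', hus, hne⟩ := h.todo (x + 1) List.mem_cons_self
  obtain rfl : x = x' := by omega
  have hord : ∀ a < k, Function.update ord k x a = ord a := fun a ha =>
    Function.update_of_ne (by omega) _ _
  have hrm : ∀ a b, b ≤ k → rangeMin top (Function.update l k cur) a b = rangeMin top l a b :=
    fun a b hb => rangeMin_congr fun t _ _ => Function.update_of_ne (by omega) _ _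
  have hcurd : ∀ a < k, rangeMin top (Function.update l k cur) (a + 1) (k + 1) =
      LCP (str (key (ord a))) us + 1 := by
    intro a ha
    rw [rangeMin_succ ha, hrm _ _ le_rfl, Function.update_self, h.current a ha]
  have hpend := h.current_pending (List.cons_ne_nil _ _)
  refine { h with
    current := ?_, current_pending := ?_, pending := ?_, out := ?_, cur_zero := ?_, l_zero := ?_
    l_beyond := ?_, ord_lt := ?_, done := ?_, todo := ?_, bl_nodup := ?_ }
  · intro a ha
    rcases Nat.lt_succ_iff_lt_or_eq.mp ha with ha | rfl
    · rw [hcurd a ha, hord a ha, min_eq_left]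
      rw [h.du_eq]
      exact Nat.succ_le_succ (LCP_le_right _ _)
    · rw [rangeMin_of_le le_rfl, Function.update_self, hus, LCP_self, h.du_eq, min_eq_right h.du_le]
  · exact fun _ => hpend
  · intro a ha y hy
    rcases Nat.lt_succ_iff_lt_or_eq.mp ha with ha | rfl
    · obtain ⟨h1, h2⟩ := h.pending a ha y hy
      refine ⟨?_, by rwa [hord a ha]⟩
      rw [hcurd a ha, hord a ha, ← h1, ← min_assoc, ← min_assoc, h.current a ha, min_eq_left (b := du)]
      rw [h.du_eq]
      exact Nat.succ_le_succ (LCP_le_right _ _)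
    · obtain ⟨h1, h2⟩ := hpend y hy
      rw [rangeMin_of_le le_rfl, Function.update_self, hus, ← h1]
      refine ⟨?_, h2⟩
      have h3 := LCP_le_left us (str y)
      have h4 := h.du_eq
      have h5 := h.du_le
      omega
  · intro a b hab hb
    rcases Nat.lt_succ_iff_lt_or_eq.mp hb with hb | rfl
    · rw [hrm _ _ hb, hord a (hab.trans hb), hord b hb, h.out a b hab hb]
    · rw [hcurd a hab, hord a hab, Function.update_self, hus]
  · omega
  · intro _
    rcases Nat.eq_zero_or_pos k with rfl | hk
    · rw [Function.update_self, h.cur_zero rfl]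
    · rw [Function.update_of_ne hk.ne, h.l_zero hk]
  · intro j hj
    rw [Function.update_of_ne (by omega), h.l_beyond j (by omega)]
  · intro a ha
    rcases Nat.lt_succ_iff_lt_or_eq.mp ha with ha | rfl
    · rw [hord a ha, Function.update_of_ne (hne a ha)]
      exact h.ord_lt a ha
    · rw [Function.update_self, Function.update_self]
      exact ⟨hx, rfl⟩
  · intro y hy hyV
    by_cases hyx : y = x
    · subst hyx
      right
      rw [Function.update_self, Function.update_self]
      exact ⟨Nat.lt_succ_self _, rfl⟩
    · rw [Function.update_of_ne hyx]
      rcases h.done y hy hyV with h1 | ⟨h1, h2⟩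
      · rcases List.mem_cons.mp h1 with h1 | h1
        · omega
        · exact .inl h1
      · exact .inr ⟨by omega, by rw [hord _ h1, h2]⟩
  · intro p hp
    obtain ⟨y, hy, rfl, hys, hyne⟩ := h.todo p (List.mem_cons_of_mem _ hp)
    refine ⟨y, hy, rfl, hys, fun a ha => ?_⟩
    rcases Nat.lt_succ_iff_lt_or_eq.mp ha with ha | rfl
    · rw [hord a ha]; exact hyne a ha
    · rw [Function.update_self]
      rintro rfl
      exact (List.nodup_cons.mp h.bl_nodup).1 hp
  · exact (List.nodup_cons.mp h.bl_nodup).2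

/-- Any two children of a node are `Apart` in both directions, so the order in which siblings are
pushed is irrelevant. -/
theorem push {v : ℕ}
    (h : SearchInv n str pd N key top V bl (v :: cl) St us du cur k ord l rank) :
    SearchInv n str pd N key top V bl cl (v :: St) us du cur k ord l rank := by
  have hperm : (cl ++ v :: St).Perm (v :: cl ++ St) := List.perm_middle
  have hmem : ∀ y, y ∈ cl ++ v :: St ↔ y ∈ v :: cl ++ St := fun y => hperm.mem_iff
  have hv : v ∉ cl := fun hv => by
    have := (List.nodup_append.mp h.nodup).2.1
    rw [List.cons_append, List.nodup_cons] at this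
    exact this.1 (List.mem_append_left _ hv)
  refine { h with nodup := ?_, lt := ?_, cover := ?_, visited := ?_, apart_cl := ?_, apart_cl_St := ?_,
                  apart_St := ?_, ch_pd := ?_, current_pending := ?_, pending := ?_ }
  · exact (hperm.append_left V).nodup_iff.mpr h.nodup
  · exact fun y hy => h.lt y ((hperm.append_left V).mem_iff.mp hy)
  · intro y hy
    simp only [hmem]
    exact h.cover y hy
  · simp only [hmem]
    exact h.visited
  · exact fun x hx y hy => h.apart_cl x (List.mem_cons_of_mem _ hx) y (List.mem_cons_of_mem _ hy)
  · intro x hx y hy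
    rcases List.mem_cons.mp hy with rfl | hy
    · exact h.apart_cl x (List.mem_cons_of_mem _ hx) y List.mem_cons_self
        fun e => hv (e ▸ hx)
    · exact h.apart_cl_St x (List.mem_cons_of_mem _ hx) y hy
  · exact List.pairwise_cons.mpr ⟨h.apart_cl_St v List.mem_cons_self, h.apart_St⟩
  · exact fun y hy => h.ch_pd y (List.mem_cons_of_mem _ hy)
  · simp only [hmem]
    exact h.current_pending
  · simp only [hmem]
    exact h.pending

/-- The LCPs of output items with `u` are provided by `pending`. The children of `u` inherit them
because `u` is not a prefix of any earlier item. For the nodes remaining on the stack, taking the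
minimum with `pd u` changes nothing, as their `pd` is at most `pd u`. -/
theorem pop (hT : TrieView n root str ch pd) {u : ℕ}
    (htop : (str u).length + 1 ≤ top)
    (h : SearchInv n str pd N key top V [] [] (u :: St) us du cur k ord l rank) :
    SearchInv n str pd N key top (u :: V) (bucket key N u) (ch u) St (str u)
      ((str u).length + 1) (min cur (pd u)) k ord l rank := by
  have hun : u < n := h.lt u (by simp)
  have huV : u ∉ V := fun hu =>
    (List.nodup_append.mp h.nodup).2.2 u hu u (by simp) rfl
  have hsep := (List.pairwise_cons.mp h.apart_St).1
  have hch : ∀ c ∈ ch u, ∀ y ∈ St, Apart str pd c y := by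
    intro c hc y hy
    obtain ⟨h1, h2, h3, h4⟩ := hsep y hy
    have hp := (hT.ch_prefix u hun c hc).1
    refine ⟨by rw [LCP_eq_of_prefix_of_not_prefix hp h3, h1], ?_, fun hcy => h3 (hp.trans hcy),
      fun hyc => ?_⟩
    · rw [hT.ch_pd u hun c hc, ← h1]
      exact Nat.succ_le_succ (LCP_le_left _ _)
    · rcases List.prefix_or_prefix_of_prefix hyc hp with h5 | h5
      · exact h4 h5
      · exact h3 h5
  have hchu : ∀ c ∈ ch u, ¬ str c <+: str u := fun c hc hcu =>
    (hT.ch_prefix u hun c hc).2 ((hT.ch_prefix u hun c hc).1.eq_of_length_le hcu.length_le)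
  have hfreshV : ∀ c ∈ ch u, c ∉ V := fun c hc hcV =>
    h.visited c hcV u (by simp) (hT.ch_prefix u hun c hc).1
  have hfreshS : ∀ c ∈ ch u, c ∉ St := fun c hc hcS =>
    (hsep c hcS).2.2.1 (hT.ch_prefix u hun c hc).1
  have hnd : (V ++ u :: St).Nodup := h.nodup
  have hchne : ∀ c ∈ ch u, c ≠ u := fun c hc e => hchu c hc (by rw [e])
  have hpd : ∀ y ∈ St, pd y ≤ pd u := fun y hy => (hsep y hy).2.1
  refine { h with
    nodup := ?_, lt := ?_, cover := ?_, visited := ?_, apart_cl := ?_, apart_cl_St := hch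
    apart_St := (List.pairwise_cons.mp h.apart_St).2, du_eq := rfl, du_le := htop
    ch_pd := hT.ch_pd u hun, current := ?_, current_pending := ?_, pending := ?_
    cur_zero := ?_, done := ?_, todo := ?_, bl_nodup := nodup_bucket _ _ _ }
  · obtain ⟨h1, h2, h3⟩ := List.nodup_append.mp hnd
    obtain ⟨h4, h5⟩ := List.nodup_cons.mp h2
    refine List.nodup_append.mpr ⟨List.nodup_cons.mpr ⟨huV, h1⟩, List.nodup_append.mpr
      ⟨hT.ch_nodup u hun, h5, fun a ha b hb e => hfreshS a ha (e ▸ hb)⟩, ?_⟩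
    rintro a ha b hb rfl
    rcases List.mem_cons.mp ha with rfl | ha
    · rcases List.mem_append.mp hb with hb | hb
      · exact hchne _ hb rfl
      · exact h4 hb
    · rcases List.mem_append.mp hb with hb | hb
      · exact hfreshV _ hb ha
      · exact h3 a ha a (List.mem_cons_of_mem _ hb) rfl
  · intro v hv
    rcases List.mem_append.mp hv with hv | hv
    · rcases List.mem_cons.mp hv with rfl | hv
      · exact hun
      · exact h.lt v (List.mem_append_left _ hv)
    · rcases List.mem_append.mp hv with hv | hv
      · exact hT.ch_lt u hun v hv
      · exact h.lt v (by simp [hv])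
  · intro v hv
    rcases h.cover v hv with h1 | ⟨y, hy, hyv⟩
    · exact .inl (List.mem_cons_of_mem _ h1)
    · rcases List.mem_cons.mp hy with rfl | hy
      · by_cases e : y = v
        · exact .inl (by simp [e])
        · obtain ⟨c, hc, hcv⟩ := hT.cover y hun v hv hyv e
          exact .inr ⟨c, List.mem_append_left _ hc, hcv⟩
      · exact .inr ⟨y, List.mem_append_right _ hy, hyv⟩
  · intro v hv y hy hyv
    rcases List.mem_cons.mp hv with rfl | hv
    · rcases List.mem_append.mp hy with hy | hy
      · exact hchu y hy hyv
      · exact (hsep y hy).2.2.2 hyv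
    · rcases List.mem_append.mp hy with hy | hy
      · exact h.visited v hv u (by simp) ((hT.ch_prefix u hun y hy).1.trans hyv)
      · exact h.visited v hv y (by simp [hy]) hyv
  · intro x hx y hy hxy
    obtain ⟨h1, h2⟩ := hT.siblings u hun x hx y hy hxy
    obtain ⟨-, h3⟩ := hT.siblings u hun y hy x hx hxy.symm
    exact ⟨by rw [h1, hT.ch_pd u hun y hy],
      by rw [hT.ch_pd u hun y hy, hT.ch_pd u hun x hx], h2, h3⟩
  · exact fun a ha => (h.pending a ha u (by simp)).1
  · intro _ y hy
    rcases List.mem_append.mp hy with hy | hy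
    · have hp := (hT.ch_prefix u hun y hy).1
      refine ⟨?_, hchu y hy⟩
      rw [hT.ch_pd u hun y hy, LCP_eq_of_prefix hp]
    · exact ⟨(hsep y hy).1, (hsep y hy).2.2.2⟩
  · intro a ha y hy
    obtain ⟨h1, h2⟩ := h.pending a ha u (by simp)
    rcases List.mem_append.mp hy with hy | hy
    · have hp := (hT.ch_prefix u hun y hy).1
      refine ⟨?_, fun h3 => h2 (hp.trans h3)⟩
      rw [LCP_comm, LCP_eq_of_prefix_of_not_prefix hp h2, LCP_comm, ← min_assoc, h1,
        hT.ch_pd u hun y hy, min_eq_left]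
      exact Nat.succ_le_succ (LCP_le_right _ _)
    · obtain ⟨h3, h4⟩ := h.pending a ha y (by simp [hy])
      rw [← h3, min_assoc cur, min_eq_right (hpd y hy)]
      exact ⟨rfl, h4⟩
  · intro hk
    rw [h.cur_zero hk, Nat.zero_min]
  · intro x hx hxV
    rcases List.mem_cons.mp hxV with hxu | hxV
    · exact .inl (mem_bucket.mpr ⟨x, hx, hxu, rfl⟩)
    · exact .inr ((h.done x hx hxV).resolve_left (by simp))
  · intro p hp
    obtain ⟨x, hx, hxu, rfl⟩ := mem_bucket.mp hp
    refine ⟨x, hx, rfl, by rw [hxu], fun a ha e => ?_⟩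
    refine (h.pending a ha u (by simp)).2 ?_
    rw [e, hxu]

theorem init (hT : TrieView n root str ch pd) (htop : 1 ≤ top) (ord rank : ℕ → ℕ) :
    SearchInv n str pd N key top [] [] [] [root] [] 1 0 0 ord (fun _ => 0) rank := by
  constructor <;> simp [hT.root_lt, hT.str_root, htop]

/-- All nodes have been visited. -/
theorem finish (hkey : ∀ x < N, key x < n)
    (h : SearchInv n str pd N key top V [] [] [] us du cur k ord l rank) :
    k = N ∧ ∀ x < N, rank x < N ∧ ord (rank x) = x := by
  have hdone : ∀ x < N, rank x < k ∧ ord (rank x) = x := by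
    intro x hx
    refine (h.done x hx ?_).resolve_left (by simp)
    exact (h.cover _ (hkey x hx)).resolve_right (by simp)
  have h1 : k ≤ N := by
    have hsub : (Finset.range k).image ord ⊆ Finset.range N := by
      intro y hy
      obtain ⟨a, ha, rfl⟩ := Finset.mem_image.mp hy
      exact Finset.mem_range.mpr (h.ord_lt a (Finset.mem_range.mp ha)).1
    have hcard := Finset.card_le_card hsub
    rwa [Finset.card_image_of_injOn, Finset.card_range, Finset.card_range] at hcard
    intro a ha b hb hab
    rw [← (h.ord_lt a (by simpa using ha)).2, ← (h.ord_lt b (by simpa using hb)).2, hab]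
  have h2 : N ≤ k := by
    have hsub : (Finset.range N).image rank ⊆ Finset.range k := by
      intro y hy
      obtain ⟨a, ha, rfl⟩ := Finset.mem_image.mp hy
      exact Finset.mem_range.mpr (hdone a (Finset.mem_range.mp ha)).1
    have hcard := Finset.card_le_card hsub
    rwa [Finset.card_image_of_injOn, Finset.card_range, Finset.card_range] at hcard
    intro a ha b hb hab
    rw [← (hdone a (by simpa using ha)).2, ← (hdone b (by simpa using hb)).2, hab]
  obtain rfl : k = N := le_antisymm h1 h2
  exact ⟨rfl, hdone⟩

end SearchInv

/-! ### The depth-first search, on the machine -/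

/-- Output the item to which register 9 points. -/
def emitProg (o : ℕ) : Prog :=
  assign 14 (op .sub (reg 9) (const 1)) ;;
  store (o + 25) (reg 13) (reg 14) ;;
  store (o + 26) (reg 13) (reg 12) ;;
  store (o + 27) (reg 14) (reg 13) ;;
  assign 13 (op .add (reg 13) (const 1)) ;;
  assign 12 (reg 11) ;;
  assign 9 (load (o + 21) (reg 9))

/-- Put the node in register 10 on the stack. -/
def pushProg (o : ℕ) : Prog :=
  -- Register 11 holds one plus the depth of the parent; adding the label length gives one plus the
  -- depth of the child.
  store (o + 23) (reg 10) (op .add (reg 11) (op .sub (load 5 (reg 10)) (load 4 (reg 10)))) ;;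
  store (o + 24) (reg 10) (reg 11) ;;
  store (o + 22) (reg 8) (reg 10) ;;
  assign 8 (op .add (reg 8) (const 1)) ;;
  assign 10 (load 1 (reg 10))

/-- Visit the node on the top of the stack. -/
def popProg (o : ℕ) : Prog :=
  assign 8 (op .sub (reg 8) (const 1)) ;;
  assign 14 (load (o + 22) (reg 8)) ;;
  minReg 12 (load (o + 24) (reg 14)) ;;
  assign 11 (load (o + 23) (reg 14)) ;;
  assign 9 (load (o + 20) (reg 14)) ;;
  assign 10 (load 0 (reg 14))

/-- A sum of comparison bits serves as a disjunction; it is at most three, so it does not overflow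
when `4 ≤ 2 ^ w`. -/
def searchCond : Expr :=
  op .add (op .lt (const 0) (reg 9))
    (op .add (op .lt (reg 10) (reg 0)) (op .lt (const 0) (reg 8)))

def searchBody (o : ℕ) : Prog :=
  ite (reg 9) (emitProg o) (ite (op .lt (reg 10) (reg 0)) (pushProg o) (popProg o))

def searchInit (o : ℕ) : Prog :=
  store (o + 22) (const 0) (reg 1) ;;
  store (o + 23) (reg 1) (const 1) ;;
  assign 8 (const 1) ;;
  assign 9 (const 0) ;;
  assign 10 (reg 0) ;;
  assign 11 (const 1) ;;
  assign 12 (const 0) ;;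
  assign 13 (const 0)

def searchProg (o : ℕ) : Prog := searchInit o ;; loop searchCond (searchBody o)

/-- The memory of `s` contains the tree structure of a compacted trie. -/
structure TrieMem (w n root : ℕ) (str : ℕ → Str) (ch : ℕ → List ℕ) (s : State) : Prop where
  reg_size : s.reg 0 = n
  reg_root : s.reg 1 = root
  size_lt : n < 2 ^ w
  chain : ∀ u < n, Chain (s.mem 1) n (s.mem 0 u) (ch u)
  stop_lt : ∀ v, s.mem 5 v < 2 ^ w
  depth : ∀ u < n, ∀ v ∈ ch u, s.mem 4 v ≤ s.mem 5 v ∧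
    (str v).length = (str u).length + (s.mem 5 v - s.mem 4 v)
  depth_lt : ∀ u < n, (str u).length + 1 < 2 ^ w

theorem TrieMem.congr {w n root : ℕ} {str : ℕ → Str} {ch : ℕ → List ℕ} {s s' : State}
    (h : TrieMem w n root str ch s) (h0 : s'.reg 0 = s.reg 0) (h1 : s'.reg 1 = s.reg 1)
    (hm : ∀ a < 20, s'.mem a = s.mem a) : TrieMem w n root str ch s' := by
  obtain ⟨a, b, c, d, e, f, g⟩ := h
  refine ⟨h0.trans a, h1.trans b, c, ?_, ?_, ?_, g⟩
  · rwa [hm 0 (by omega), hm 1 (by omega)]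
  · rwa [hm 5 (by omega)]
  · rwa [hm 5 (by omega), hm 4 (by omega)]

/-- `ord` lists the items in such an order that the values `X x y` are minima over ranges of `l`;
`rank` is the inverse of `ord`. -/
structure Ordered (N : ℕ) (X : ℕ → ℕ → ℕ) (top : ℕ) (ord l rank : ℕ → ℕ) : Prop where
  ord_lt : ∀ a < N, ord a < N ∧ rank (ord a) = a
  rank_lt : ∀ x < N, rank x < N ∧ ord (rank x) = x
  out : ∀ a b, a < b → b < N → rangeMin top l (a + 1) (b + 1) = X (ord a) (ord b) + 1
  l_zero : l 0 = 0
  l_beyond : ∀ j, N ≤ j → l j = 0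

/-- The invariant of the main loop of the search. -/
def SearchLoop (n : ℕ) (str : ℕ → Str) (pd : ℕ → ℕ) (N : ℕ) (key : ℕ → ℕ) (top o : ℕ)
    (s₀ : State) (m : ℕ) (s : State) : Prop :=
  ∃ (V bl cl St : List ℕ) (us : Str),
    SearchInv n str pd N key top V bl cl St us (s.reg 11) (s.reg 12) (s.reg 13)
      (s.mem (o + 25)) (s.mem (o + 26)) (s.mem (o + 27)) ∧
    Chain (s₀.mem (o + 21)) 0 (s.reg 9) bl ∧
    Chain (s₀.mem 1) n (s.reg 10) cl ∧
    StackRep (s.mem (o + 22)) (s.reg 8) St ∧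
    (∀ v ∈ St, s.mem (o + 23) v = (str v).length + 1 ∧ s.mem (o + 24) v = pd v) ∧
    (∀ v ∈ cl, s₀.mem 4 v ≤ s₀.mem 5 v ∧
      (str v).length = us.length + (s₀.mem 5 v - s₀.mem 4 v)) ∧
    s.reg 13 ≤ N ∧
    -- Every round lowers this by one: an output lowers the first term, an unseen node counts two, a
    -- node on the stack one and a visited node nothing.
    m = (N - s.reg 13) + 2 * (n - V.length - St.length) + St.length

theorem SearchInv.length_le {n : ℕ} {str : ℕ → Str} {pd : ℕ → ℕ} {N : ℕ} {key : ℕ → ℕ}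
    {top : ℕ} {V bl cl St : List ℕ} {us : Str} {du cur k : ℕ} {ord l rank : ℕ → ℕ}
    (h : SearchInv n str pd N key top V bl cl St us du cur k ord l rank) :
    V.length + cl.length + St.length ≤ n := by
  have h1 : (V ++ (cl ++ St)).toFinset ⊆ Finset.range n := fun v hv =>
    Finset.mem_range.mpr (h.lt v (List.mem_toFinset.mp hv))
  have h2 := Finset.card_le_card h1
  rw [List.toFinset_card_of_nodup h.nodup, Finset.card_range] at h2
  simp at h2
  omega

theorem searchCond_eval {w n : ℕ} {s : State} (hw : 4 ≤ 2 ^ w) (hn : s.reg 0 = n) :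
    searchCond.eval w s ≠ 0 ↔ s.reg 9 ≠ 0 ∨ s.reg 10 < n ∨ s.reg 8 ≠ 0 := by
  have h0 : ∀ s, (const 0).eval w s = 0 := fun s => eval_const (by omega)
  have h1w : 1 < 2 ^ w := by omega
  by_cases h1 : s.reg 9 = 0 <;> by_cases h2 : s.reg 10 < n <;> by_cases h3 : s.reg 8 = 0 <;>
    simp (disch := omega) [searchCond, h0, hn, h1, h2, h3, Op.eval_lt h1w, Op.eval_add,
      Nat.pos_iff_ne_zero]

theorem runs_searchBody {w n root : ℕ} {str : ℕ → Str} {ch : ℕ → List ℕ} {pd : ℕ → ℕ} {N : ℕ}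
    {key : ℕ → ℕ} {o m : ℕ} {s₀ s : State} (hT : TrieView n root str ch pd)
    (hM : TrieMem w n root str ch s₀) (hw : N + 4 ≤ 2 ^ w)
    (hbucket : ∀ u < n, Chain (s₀.mem (o + 21)) 0 (s₀.mem (o + 20) u) (bucket key N u))
    (hf : Frame (searchBody o) s₀ s) (hI : SearchLoop n str pd N key (2 ^ w - 1) o s₀ m s)
    (hcond : searchCond.eval w s ≠ 0) :
    Runs w (searchBody o) s (searchBody o).bound fun s' =>
      ∃ m' < m, SearchLoop n str pd N key (2 ^ w - 1) o s₀ m' s' := by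
  obtain ⟨V, bl, cl, St, us, hinv, hbl, hcl, hSt, hdep, hlen, hkN, rfl⟩ := hI
  have h1w : 1 < 2 ^ w := by omega
  have h1 : ∀ s, (const 1).eval w s = 1 := fun s => eval_const (by omega)
  have r0 : s.reg 0 = n := by rw [hf.1 0 rfl, hM.reg_size]
  have hmem : ∀ a < 20, s.mem a = s₀.mem a := fun a ha => hf.2 a (by
    simp [searchBody, emitProg, pushProg, popProg, minReg, writesMem]; omega)
  have m0 := hmem 0 (by omega)
  have m1 := hmem 1 (by omega)
  have m4 := hmem 4 (by omega)
  have m5 := hmem 5 (by omega)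
  have m20 : s.mem (o + 20) = s₀.mem (o + 20) := hf.2 _ (by
    simp [searchBody, emitProg, pushProg, popProg, minReg, writesMem])
  have m21 : s.mem (o + 21) = s₀.mem (o + 21) := hf.2 _ (by
    simp [searchBody, emitProg, pushProg, popProg, minReg, writesMem])
  have hnw := hM.size_lt
  have hlength := hinv.length_le
  have hStl := hSt.length
  rw [searchCond_eval (by omega) r0] at hcond
  refine Runs.den rfl ?_
  by_cases hb : s.reg 9 = 0
  · obtain rfl := hbl.eq_nil_iff.mp hb
    rw [searchBody, den_ite_false (by simpa using hb)]
    by_cases hc : s.reg 10 < n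
    · rw [den_ite_true (by simpa [Op.eval_lt h1w, r0] using hc)]
      obtain ⟨cl, rfl, hcl'⟩ := hcl.exists_cons hc.ne
      have hinv' := hinv.push
      have hlength' := hinv'.length_le
      obtain ⟨hd1, hd2⟩ := hlen (s.reg 10) List.mem_cons_self
      have hdu := hinv.du_eq
      have hpd := hinv.ch_pd (s.reg 10) List.mem_cons_self
      have hvn := hM.depth_lt _ hc
      have hlabel := hM.stop_lt (s.reg 10)
      rw [List.length_cons] at hlength' hlength
      rw [← m4, ← m5] at hd1 hd2
      rw [← m5] at hlabel
      have hden : (pushProg o).den w s = (((((s.setMem (o + 23) (s.reg 10)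
          ((str (s.reg 10)).length + 1)).setMem (o + 24) (s.reg 10) (pd (s.reg 10))).setMem
          (o + 22) (s.reg 8) (s.reg 10)).setReg 8 (s.reg 8 + 1)).setReg 10
          (s.mem 1 (s.reg 10))) := by
        have e : s.reg 11 + (s.mem 5 (s.reg 10) - s.mem 4 (s.reg 10)) =
          (str (s.reg 10)).length + 1 := by omega
        simp (disch := omega) [pushProg, h1, Op.eval_sub, Op.eval_add, hpd, e]
      rw [hden]
      refine ⟨(N - s.reg 13) + 2 * (n - V.length - (St.length + 1)) + (St.length + 1),
        by omega, V, [], cl, s.reg 10 :: St, us, ?_, ?_, ?_, ?_, ?_, ?_, ?_, ?_⟩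
      · simpa using hinv'
      · simpa using hbl
      · simpa [m1] using hcl'
      · simp only [State.reg_setReg, State.mem_setReg, State.mem_setMem, State.reg_setMem]
        refine ⟨St, by simp, hSt.congr fun i hi => ?_⟩
        simp [hi.ne]
      · intro v hv
        by_cases hvv : v = s.reg 10
        · simp [hvv]
        · simpa [hvv] using hdep v (by simpa [hvv] using hv)
      · exact fun v hv => hlen v (List.mem_cons_of_mem _ hv)
      · simpa using hkN
      · simp
    · rw [den_ite_false (by simpa [Op.eval_lt h1w, r0] using hc)]
      have hcn : cl = [] := by
        cases cl with
        | nil => rfl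
        | cons x cl => exact absurd (hcl.1 ▸ hinv.lt x (by simp)) hc
      subst hcn
      obtain ⟨t, ht⟩ := Nat.exists_eq_add_one_of_ne_zero ((hcond.resolve_left (by simpa using hb)).resolve_left hc)
      rw [ht] at hSt
      obtain ⟨St, rfl, hSt'⟩ := hSt
      set u := s.mem (o + 22) t with hu
      obtain ⟨hdu, hpu⟩ := hdep u List.mem_cons_self
      have hun : u < n := hinv.lt u (by simp)
      have hvn := hM.depth_lt _ hun
      have hinv' := hinv.pop hT (by omega)
      rw [List.length_cons] at hlength hStl
      have hden : (popProg o).den w s = ((((((s.setReg 8 t).setReg 14 u).setReg 12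
          (min (s.reg 12) (pd u))).setReg 11 ((str u).length + 1)).setReg 9
          (s.mem (o + 20) u)).setReg 10 (s.mem 0 u)) := by
        simp (disch := omega) [popProg, h1, Op.eval_sub, ht, den_minReg h1w, ← hu, hdu, hpu]
      rw [hden]
      refine ⟨(N - s.reg 13) + 2 * (n - (V.length + 1) - St.length) + St.length,
        by rw [List.length_cons]; omega, u :: V, bucket key N u, ch u, St, str u,
        ?_, ?_, ?_, ?_, ?_, ?_, ?_, ?_⟩
      · simpa using hinv'
      · simpa [m20] using hbucket u hun
      · simpa [m0] using hM.chain u hun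
      · simpa using hSt'
      · intro v hv
        simpa using hdep v (List.mem_cons_of_mem _ hv)
      · exact hM.depth u hun
      · simpa using hkN
      · simp
  · rw [searchBody, den_ite_true (by simpa using hb)]
    obtain ⟨bl, rfl, hbl'⟩ := hbl.exists_cons hb
    obtain ⟨x, hx⟩ := Nat.exists_eq_add_one_of_ne_zero hb
    rw [hx] at hinv hbl'
    have hlt := hinv.lt_N_of_cons
    have hinv' := hinv.emit
    obtain ⟨_, hxN, hxx, -⟩ := hinv.todo (x + 1) List.mem_cons_self
    refine ⟨(N - (s.reg 13 + 1)) + 2 * (n - V.length - St.length) + St.length, by omega,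
      V, bl, cl, St, us, ?_, ?_, ?_, ?_, ?_, hlen, ?_, ?_⟩
    · simpa (disch := omega) [emitProg, h1, hx, Op.eval_sub, Op.eval_add] using hinv'
    · simpa (disch := omega) [emitProg, h1, hx, m21] using hbl'
    · simpa (disch := omega) [emitProg, h1, hx] using hcl
    · simpa (disch := omega) [emitProg, h1, hx] using hSt
    · simpa (disch := omega) [emitProg, h1, hx] using hdep
    · simpa (disch := omega) [emitProg, h1, hx, Op.eval_add] using hlt
    · simp (disch := omega) [emitProg, h1, hx, Op.eval_add]

theorem runs_searchProg {w n root : ℕ} {str : ℕ → Str} {ch : ℕ → List ℕ} {pd : ℕ → ℕ} {N : ℕ}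
    {key : ℕ → ℕ} {o : ℕ} {s : State} (hT : TrieView n root str ch pd)
    (hM : TrieMem w n root str ch s) (hw : N + 4 ≤ 2 ^ w) (hkey : ∀ x < N, key x < n)
    (hN : 0 < N)
    (hbucket : ∀ u < n, Chain (s.mem (o + 21)) 0 (s.mem (o + 20) u) (bucket key N u))
    (h24 : ∀ v, s.mem (o + 24) v = 0) (h26 : ∀ v, s.mem (o + 26) v = 0) :
    Runs w (searchProg o) s (200 * (N + n) + 200) fun s' =>
      Ordered N (fun x y => LCP (str (key x)) (str (key y))) (2 ^ w - 1)
        (s'.mem (o + 25)) (s'.mem (o + 26)) (s'.mem (o + 27)) := by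
  have h1w : 1 < 2 ^ w := by omega
  have h0 : ∀ s, (const 0).eval w s = 0 := fun s => eval_const (by omega)
  have h1 : ∀ s, (const 1).eval w s = 1 := fun s => eval_const (by omega)
  refine (Runs.seq (n := 40) (m := 200 * (N + n) + 100)
    ((Runs.den (p := searchInit o) (Q := (· = _)) rfl rfl).mono (by
      simp [searchInit, bound, cost]) fun _ h => h) ?_).mono
    (by omega) fun _ h => h
  rintro s₀ - rfl
  have hM' : TrieMem w n root str ch ((searchInit o).den w s) := hM.congr
    (by simp [searchInit]) (by simp [searchInit]) fun a ha => by
      have e1 : a ≠ o + 22 := by omega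
      have e2 : a ≠ o + 23 := by omega
      simp [searchInit, e1, e2]
  have hroot := hT.root_lt
  refine (Runs.loop (m := N + 2 * (n - 1) + 1) (SearchLoop n str pd N key (2 ^ w - 1) o _)
    (fun m s' hf hI hc => runs_searchBody hT hM' hw (fun u hu => ?_) hf hI hc) ?_).mono ?_ ?_
  · simpa [searchInit] using hbucket u hu
  · refine ⟨[], [], [], [root], [], ?_, ?_, ?_, ?_, ?_, ?_, ?_, ?_⟩
    · have := SearchInv.init (N := N) (key := key) hT (top := 2 ^ w - 1) (by omega)
        (s.mem (o + 25)) (s.mem (o + 27))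
      simpa [searchInit, h0, h1, show s.mem (o + 26) = fun _ => 0 from funext h26] using this
    · simp [searchInit, h0, Chain]
    · simp [searchInit, Chain, hM.reg_size]
    · simp [searchInit, h0, h1, StackRep, hM.reg_root]
    · simp [searchInit, h0, h1, hM.reg_root, hT.str_root, hT.pd_root, h24]
    · simp
    · simp [searchInit, h0]
    · simp [searchInit, h0]
  · simp only [searchBody, emitProg, pushProg, popProg, minReg, searchCond, bound, cost]
    omega
  · rintro s' ⟨hf, hc, m, V, bl, cl, St, us, hinv, hbl, hcl, hSt, -⟩
    have r0 : s'.reg 0 = n := by rw [hf.1 0 rfl, hM'.reg_size]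
    have hc' := mt (searchCond_eval (w := w) (s := s') (by omega) r0).mpr (not_not.mpr hc)
    push Not at hc'
    obtain ⟨h9, h10, h8⟩ := hc'
    obtain rfl := hbl.eq_nil_iff.mp h9
    have hcn : cl = [] := by
      cases cl with
      | nil => rfl
      | cons x cl =>
        have := hinv.lt x (by simp)
        have := hcl.1
        omega
    subst hcn
    rw [h8] at hSt
    obtain rfl : St = [] := hSt
    obtain ⟨hk, hdone⟩ := hinv.finish hkey
    rw [hk] at hinv
    exact ⟨hinv.ord_lt, hdone, hinv.out, hinv.l_zero hN, hinv.l_beyond⟩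

/-! ### Distances to the middle of a block -/

/-- For every position, the minimum of `l` between the position and the middle of its block;
blocks have size `S`, their halves have size `B`. -/
structure MidVals (S B N top : ℕ) (l V : ℕ → ℕ) : Prop where
  -- The middle is the first position of the right half. Its entry of `l` belongs to the left ranges
  -- only, so a left and a right range concatenate without gap or overlap.
  right : ∀ q r, B ≤ r → r < S → S * q + r < N →
    V (S * q + r) = rangeMin top l (S * q + B + 1) (S * q + r + 1)
  left : ∀ q r, r < B → S * q + r < N →
    V (S * q + r) = rangeMin top l (S * q + r + 1) (S * q + B + 1)

theorem mul_add_mod_of_lt' {S q r : ℕ} (hr : r < S) : (S * q + r) % S = r := by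
  rw [Nat.mul_add_mod, Nat.mod_eq_of_lt hr]

theorem div_half {S B q r : ℕ} (hS : S = 2 * B) (hr : r < S) :
    (S * q + r) / B = if r < B then 2 * q else 2 * q + 1 := by
  have hB : 0 < B := by omega
  have : S * q = B * (2 * q) := by rw [hS]; ring
  split_ifs with h
  · rw [this, Nat.mul_add_div hB, Nat.div_eq_of_lt h, Nat.add_zero]
  · rw [show S * q + r = B * (2 * q + 1) + (r - B) by rw [Nat.mul_add, ← this]; omega,
      Nat.mul_add_div hB, Nat.div_eq_of_lt (by omega), Nat.add_zero]

/-- In opposite halves the two one-sided ranges make up exactly the range between `i` and `j`. In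
the same half one of them contains that range, so the minimum can only be smaller. -/
theorem MidVals.le {S B N top : ℕ} {l V : ℕ → ℕ} (h : MidVals S B N top l V) (hS : S = 2 * B)
    (hB : 0 < B) {i j : ℕ} (hij : i < j) (hj : j < N) (hblock : i / S = j / S) :
    min (V i) (V j) ≤ rangeMin top l (i + 1) (j + 1) ∧
      (i / B ≠ j / B → min (V i) (V j) = rangeMin top l (i + 1) (j + 1)) := by
  have hS0 : 0 < S := by omega
  obtain ⟨q, hq⟩ : ∃ q, q = i / S := ⟨_, rfl⟩
  have hi : i = S * q + i % S := by rw [hq, Nat.div_add_mod]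
  have hj' : j = S * q + j % S := by rw [hq, hblock, Nat.div_add_mod]
  have hri := Nat.mod_lt i hS0
  have hrj := Nat.mod_lt j hS0
  generalize i % S = r at hi hri
  generalize j % S = r' at hj' hrj
  subst hi hj'
  rw [div_half hS hri, div_half hS hrj]
  rcases lt_or_ge r B with h1 | h1
  · rw [h.left q r h1 (by omega)]
    rcases lt_or_ge r' B with h2 | h2
    · refine ⟨(min_le_left _ _).trans (rangeMin_mono le_rfl (by omega)), fun h3 => ?_⟩
      simp [h1, h2] at h3
    · rw [h.right q r' h2 hrj hj, ← rangeMin_split (by omega) (by omega)]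
      exact ⟨le_rfl, fun _ => rfl⟩
  · rw [h.right q r' (by omega) hrj hj]
    refine ⟨(min_le_right _ _).trans (rangeMin_mono (by omega) le_rfl), fun h3 => ?_⟩
    simp [not_lt.mpr h1, show ¬ r' < B by omega] at h3

def upBody : Prog :=
  ite (op .eq (op .mod (reg 7) (reg 15)) (reg 16)) (assign 12 (reg 6))
    (minReg 12 (load 26 (reg 7))) ;;
  -- The values for left halves are provisional; the downward pass overwrites them.
  store 40 (reg 7) (reg 12) ;;
  store 41 (op .div (reg 7) (reg 16)) (op .mul (op .div (reg 7) (reg 16)) (reg 16)) ;;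
  assign 7 (op .add (reg 7) (const 1))

/-- The minima for the right halves of all blocks, and the start of every half in array 41. -/
def upProg : Prog :=
  assign 7 (const 0) ;; assign 12 (const 0) ;; loop (op .lt (reg 7) (reg 5)) upBody

def downBody : Prog :=
  assign 7 (op .sub (reg 7) (const 1)) ;;
  ite (op .eq (op .mod (reg 7) (reg 15)) (op .sub (reg 16) (const 1)))
    (assign 12 (reg 6)) skip ;;
  minReg 12 (load 26 (op .add (reg 7) (const 1))) ;;
  ite (op .lt (op .mod (reg 7) (reg 15)) (reg 16)) (store 40 (reg 7) (reg 12)) skip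

/-- The minima for the left halves of all blocks. -/
def downProg : Prog :=
  assign 7 (reg 5) ;; assign 12 (const 0) ;; loop (op .lt (const 0) (reg 7)) downBody

theorem runs_upProg {w N S B : ℕ} {s : State} (hw : N + 4 ≤ 2 ^ w) (h5 : s.reg 5 = N)
    (h6 : s.reg 6 = 2 ^ w - 1) (h15 : s.reg 15 = S) (h16 : s.reg 16 = B) (hS : S = 2 * B)
    (hB : 0 < B) :
    Runs w upProg s (60 * N + 20) fun s' =>
      (∀ q r, B ≤ r → r < S → S * q + r < N →
        s'.mem 40 (S * q + r) =
          rangeMin (2 ^ w - 1) (s.mem 26) (S * q + B + 1) (S * q + r + 1)) ∧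
      ∀ i < N, s'.mem 41 (i / B) = i / B * B := by
  have h1w : 1 < 2 ^ w := by omega
  have h0 : ∀ s, (const 0).eval w s = 0 := fun s => eval_const (by omega)
  have h1 : ∀ s, (const 1).eval w s = 1 := fun s => eval_const (by omega)
  refine (Runs.seq (n := 2) (m := 60 * N + 18) (Runs.den (Q := (· = _)) rfl rfl) ?_).mono
    (by omega) fun _ h => h
  rintro s₀ - rfl
  refine (Runs.seq (n := 2) (m := 60 * N + 16) (Runs.den (Q := (· = _)) rfl rfl) ?_).mono
    (by omega) fun _ h => h
  rintro s₀ - rfl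
  refine (Runs.loop (c := upBody.bound) (m := N) (fun m s' => ∃ i, s'.reg 7 = i ∧
    i ≤ N ∧ m = N - i ∧ (∀ q r, B ≤ r → r < S → i = S * q + r + 1 →
      s'.reg 12 = rangeMin (2 ^ w - 1) (s.mem 26) (S * q + B + 1) i) ∧
    (∀ q r, B ≤ r → r < S → S * q + r < i → s'.mem 40 (S * q + r) =
      rangeMin (2 ^ w - 1) (s.mem 26) (S * q + B + 1) (S * q + r + 1)) ∧
    ∀ j < i, s'.mem 41 (j / B) = j / B * B) ?_ ?_).mono ?_ ?_
  · rintro m s' hf ⟨i, hi, hiN, rfl, hcur, hV, hcnt⟩ hcond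
    have r5 : s'.reg 5 = N := by rw [hf.1 5 rfl]; simp [h5]
    have r6 : s'.reg 6 = 2 ^ w - 1 := by rw [hf.1 6 rfl]; simp [h6]
    have r15 : s'.reg 15 = S := by rw [hf.1 15 rfl]; simp [h15]
    have r16 : s'.reg 16 = B := by rw [hf.1 16 rfl]; simp [h16]
    have m26 : s'.mem 26 = s.mem 26 := by rw [hf.2 26 rfl]; simp
    have hlt : i < N := by simpa [Op.eval_lt h1w, hi, r5] using hcond
    set cur := if i % S = B then 2 ^ w - 1 else min (s'.reg 12) (s.mem 26 i) with hc
    have key : ((ite (op .eq (op .mod (reg 7) (reg 15)) (reg 16)) (assign 12 (reg 6))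
        (minReg 12 (load 26 (reg 7)))).den w s') = s'.setReg 12 cur := by
      by_cases hm : i % S = B
      · rw [den_ite_true (by simp (disch := omega) [Op.eval_eq h1w, Op.eval_mod, hi, r15, r16, hm])]
        simp [hc, hm, r6]
      · rw [den_ite_false
          (by simp (disch := omega) [Op.eval_eq h1w, Op.eval_mod, hi, r15, r16, hm])]
        simp [hc, hm, hi, m26, den_minReg h1w]
    have hdm : i / B * B ≤ i := Nat.div_mul_le_self i B
    have hden : upBody.den w s' = (((s'.setReg 12 cur).setMem 40 i cur).setMem 41 (i / B)
        (i / B * B)).setReg 7 (i + 1) := by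
      simp (disch := omega) [upBody, key, hi, h1, r16, Op.eval_div, Op.eval_mul, Op.eval_add]
    have hnew : ∀ q r, B ≤ r → r < S → i = S * q + r →
        cur = rangeMin (2 ^ w - 1) (s.mem 26) (S * q + B + 1) (i + 1) := by
      intro q r hBr hrS hiq
      have hmod : i % S = r := by rw [hiq, mul_add_mod_of_lt' hrS]
      by_cases hrB : r = B
      · rw [hc, if_pos (by omega), rangeMin_of_le (by omega)]
      · rw [hc, if_neg (by omega), hcur q (r - 1) (by omega) (by omega) (by omega),
          rangeMin_succ (by omega)]
    refine Runs.den rfl ⟨N - (i + 1), by omega, i + 1, ?_, hlt, rfl, ?_, ?_, ?_⟩ <;> rw [hden]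
    · simp
    · intro q r hBr hrS hiq
      simpa using hnew q r hBr hrS (by omega)
    · intro q r hBr hrS hiq
      by_cases hiq' : S * q + r = i
      · simpa [hiq'] using hnew q r hBr hrS hiq'.symm
      · simpa [hiq'] using hV q r hBr hrS (by omega)
    · intro j hj
      by_cases hji : j / B = i / B
      · simp [hji]
      · have : j ≠ i := fun e => hji (by rw [e])
        simpa [hji] using hcnt j (by omega)
  · exact ⟨0, by simp [h0], Nat.zero_le _, rfl, by omega, by omega, by omega⟩
  · simp only [upBody, minReg, bound, cost]
    omega
  · rintro s' ⟨hf, hcond, m, i, hi, hiN, -, hcur, hV, hcnt⟩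
    have r5 : s'.reg 5 = N := by rw [hf.1 5 rfl]; simp [h5]
    have : N ≤ i := by simpa [Op.eval_lt h1w, hi, r5] using hcond
    obtain rfl : i = N := by omega
    exact ⟨hV, hcnt⟩

theorem runs_downProg {w N S B : ℕ} {s : State} (hw : N + 4 ≤ 2 ^ w) (h5 : s.reg 5 = N)
    (h6 : s.reg 6 = 2 ^ w - 1) (h15 : s.reg 15 = S) (h16 : s.reg 16 = B) (hS : S = 2 * B)
    (hB : 0 < B) (hBw : B < 2 ^ w) (hl : ∀ j, s.mem 26 j < 2 ^ w)
    (hl0 : ∀ j, N ≤ j → s.mem 26 j = 0)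
    (hV : ∀ q r, B ≤ r → r < S → S * q + r < N →
        s.mem 40 (S * q + r) =
          rangeMin (2 ^ w - 1) (s.mem 26) (S * q + B + 1) (S * q + r + 1)) :
    Runs w downProg s (60 * N + 20) fun s' =>
      MidVals S B N (2 ^ w - 1) (s.mem 26) (s'.mem 40) := by
  have h1w : 1 < 2 ^ w := by omega
  have h0 : ∀ s, (const 0).eval w s = 0 := fun s => eval_const (by omega)
  have h1 : ∀ s, (const 1).eval w s = 1 := fun s => eval_const (by omega)
  refine (Runs.seq (n := 2) (m := 60 * N + 18) (Runs.den (Q := (· = _)) rfl rfl) ?_).mono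
    (by omega) fun _ h => h
  rintro s₀ - rfl
  refine (Runs.seq (n := 2) (m := 60 * N + 16) (Runs.den (Q := (· = _)) rfl rfl) ?_).mono
    (by omega) fun _ h => h
  rintro s₀ - rfl
  refine (Runs.loop (c := downBody.bound) (m := N) (fun m s' => s'.reg 7 = m ∧ m ≤ N ∧
    (∀ q r, 0 < r → r < B → m = S * q + r →
      s'.reg 12 = rangeMin (2 ^ w - 1) (s.mem 26) (m + 1) (S * q + B + 1)) ∧
    (∀ q r, B ≤ r → r < S → S * q + r < N → s'.mem 40 (S * q + r) = s.mem 40 (S * q + r)) ∧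
    (∀ q r, r < B → m ≤ S * q + r → S * q + r < N → s'.mem 40 (S * q + r) =
      rangeMin (2 ^ w - 1) (s.mem 26) (S * q + r + 1) (S * q + B + 1))) ?_ ?_).mono ?_ ?_
  · rintro m s' hf ⟨hi, hiN, hcur, hR, hL⟩ hcond
    have r5 : s'.reg 5 = N := by rw [hf.1 5 rfl]; simp [h5]
    have r6 : s'.reg 6 = 2 ^ w - 1 := by rw [hf.1 6 rfl]; simp [h6]
    have r15 : s'.reg 15 = S := by rw [hf.1 15 rfl]; simp [h15]
    have r16 : s'.reg 16 = B := by rw [hf.1 16 rfl]; simp [h16]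
    have m26 : s'.mem 26 = s.mem 26 := by rw [hf.2 26 rfl]; simp
    have hlt : m ≠ 0 := by simpa [Op.eval_lt h1w, hi, h0] using hcond
    obtain ⟨i, rfl⟩ := Nat.exists_eq_add_one_of_ne_zero hlt
    set cur := if i % S = B - 1 then s.mem 26 (i + 1) else min (s'.reg 12) (s.mem 26 (i + 1)) with hc
    have hden : downBody.den w s' = if i % S < B then ((s'.setReg 7 i).setReg 12 cur).setMem 40 i cur
        else ((s'.setReg 7 i).setReg 12 cur) := by
      have hli := hl (i + 1)
      have hmw : i % S < 2 ^ w := (Nat.mod_le _ _).trans_lt (by omega)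
      have e1 : (assign 7 (op .sub (reg 7) (const 1))).den w s' = s'.setReg 7 i := by
        simp (disch := omega) [h1, hi, Op.eval_sub]
      have e2 : (minReg 12 (load 26 (op .add (reg 7) (const 1)))).den w
          ((ite (op .eq (op .mod (reg 7) (reg 15)) (op .sub (reg 16) (const 1)))
            (assign 12 (reg 6)) skip).den w (s'.setReg 7 i)) = (s'.setReg 7 i).setReg 12 cur := by
        by_cases hm : i % S = B - 1
        · rw [den_ite_true (by
            simp (disch := omega) [Op.eval_eq h1w, Op.eval_mod, Op.eval_sub, h1, r15, r16, hm]),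
            den_minReg h1w]
          simp (disch := omega) [hc, hm, h1, r6, m26, Op.eval_add, State.setReg,
            show s.mem 26 (i + 1) ≤ 2 ^ w - 1 by omega]
        · rw [den_ite_false (by
            simp (disch := omega) [Op.eval_eq h1w, Op.eval_mod, Op.eval_sub, h1, r15, r16, hm]),
            den_minReg h1w]
          simp (disch := omega) [hc, hm, h1, m26, Op.eval_add]
      rw [downBody, den_seq, den_seq, den_seq, e1, e2]
      split_ifs with hiB
      · rw [den_ite_true (by
          simp (disch := omega) [Op.eval_lt h1w, Op.eval_mod, r15, r16, hiB])]
        simp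
      · rw [den_ite_false (by
          simp (disch := omega) [Op.eval_lt h1w, Op.eval_mod, r15, r16, hiB]), den_skip]
    have hnew : ∀ q r, r < B → i = S * q + r →
        cur = rangeMin (2 ^ w - 1) (s.mem 26) (i + 1) (S * q + B + 1) := by
      intro q r hrB hiq
      have hmod : i % S = r := by rw [hiq, mul_add_mod_of_lt' (by omega)]
      have hli := hl (i + 1)
      rw [rangeMin_succ_left (by omega) (by omega)]
      by_cases hrB' : r = B - 1
      · rw [hc, if_pos (by omega), rangeMin_of_le (by omega), min_eq_left (by omega)]
      · rw [hc, if_neg (by omega), hcur q (r + 1) (by omega) (by omega) (by omega), min_comm]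
    refine Runs.den rfl ⟨i, by omega, ?_, by omega, ?_, ?_, ?_⟩ <;> rw [hden]
    · split_ifs <;> simp
    · intro q r _ hrB hiq
      rw [← hnew q r hrB hiq]
      split_ifs <;> simp
    · intro q r hBr hrS hiq
      rw [← hR q r hBr hrS hiq]
      split_ifs with hiB
      · have : S * q + r ≠ i := fun e => by
          rw [← e, mul_add_mod_of_lt' hrS] at hiB; omega
        simp [this]
      · simp
    · intro q r hrB hir hiq
      by_cases hiq' : S * q + r = i
      · have : i % S < B := by rw [← hiq', mul_add_mod_of_lt' (by omega)]; exact hrB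
        rw [if_pos this, hiq', ← hnew q r hrB hiq'.symm]
        simp
      · rw [← hL q r hrB (by omega) hiq]
        split_ifs <;> simp [hiq']
  · refine ⟨by simp [h5], le_rfl, fun q r hr hrB hN => ?_, by simp, by omega⟩
    -- If `N` falls strictly inside a left half, the range to the middle reaches beyond the items,
    -- where `l` vanishes; this matches the initial `0` in register 12. Such a block has no right
    -- half, so these values are not needed for separated pairs.
    have : rangeMin (2 ^ w - 1) (s.mem 26) (N + 1) (S * q + B + 1) ≤ s.mem 26 (N + 1) :=
      rangeMin_le le_rfl (by omega)
    rw [hl0 (N + 1) (by omega)] at this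
    simp [h0]
    omega
  · simp only [downBody, minReg, bound, cost]
    omega
  · rintro s' ⟨hf, hcond, m, hi, hiN, hcur, hR, hL⟩
    obtain rfl : m = 0 := by simpa [Op.eval_lt h1w, hi, h0] using hcond
    refine ⟨fun q r h1 h2 h3 => (hR q r h1 h2 h3).trans (hV q r h1 h2 h3),
      fun q r h1 h2 => hL q r h1 (Nat.zero_le _) h2⟩

/-! ### Scanning a sequence with a stack -/

/-- The value of a pair of groups at distance `d`, where `m` is zero if there is no such pair. -/
def cand (d m : ℕ) : ℕ := if m = 0 then 0 else m + d

/-- The minimum of `L` between two positions. -/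
def between (top : ℕ) (L : ℕ → ℕ) (i j : ℕ) : ℕ := rangeMin top L (min i j + 1) (max i j + 1)

theorem between_comm (top : ℕ) (L : ℕ → ℕ) (i j : ℕ) : between top L i j = between top L j i := by
  rw [between, between, min_comm, max_comm]

theorem between_of_lt {top : ℕ} {L : ℕ → ℕ} {i j : ℕ} (h : i < j) :
    between top L i j = rangeMin top L (i + 1) (j + 1) := by
  rw [between, min_eq_left h.le, max_eq_right h.le]

/-- The positions below `j` form the groups `0, …, t`; the minimum of `L` between the group `s` and
any later group is `stk (s + 1)`, and `mp s`, `mq s` are the maxima of `vp`, `vq` on the group. -/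
structure ScanInv (top N : ℕ) (L vp vq : ℕ → ℕ) (a₀ U j t : ℕ) (stk mp mq : ℕ → ℕ) (ans : ℕ)
    (grp : ℕ → ℕ) : Prop where
  le_t : ∀ i < j, grp i ≤ t
  below : ∀ i < j, grp i < t → rangeMin top L (i + 1) j = stk (grp i + 1)
  on_top : ∀ i < j, grp i = t → L j ≤ rangeMin top L (i + 1) j
  pair : ∀ i < j, ∀ i' < j, grp i' < grp i →
    i' < i ∧ rangeMin top L (i' + 1) (i + 1) = stk (grp i' + 1)
  mono : ∀ s < t, stk s ≤ stk (s + 1)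
  stk_zero : stk 0 = 0
  mp_le : ∀ i < j, vp i ≤ mp (grp i)
  mq_le : ∀ i < j, vq i ≤ mq (grp i)
  -- Zero stands for a group without a usable item. Otherwise the maximum is attained, which makes
  -- every candidate the value of an actual pair.
  mp_mem : ∀ s ≤ t, mp s = 0 ∨ ∃ i < j, grp i = s ∧ vp i = mp s
  mq_mem : ∀ s ≤ t, mq s = 0 ∨ ∃ i < j, grp i = s ∧ vq i = mq s
  complete : ∀ i < j, ∀ i' < j, i ≠ i' → grp i = grp i' → 0 < min (vp i) (vq i') →
    between top L i i' + min (vp i) (vq i') ≤ ans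
  sound : ans ≤ U
  le_ans : a₀ ≤ ans
  t_le : t ≤ j
  j_le : j ≤ N

namespace ScanInv

variable {top N : ℕ} {L vp vq : ℕ → ℕ} {a₀ U j t : ℕ} {stk mp mq : ℕ → ℕ} {ans : ℕ} {grp : ℕ → ℕ}

/-- Group `0` is an empty sentinel of height zero. No value of `L` is below zero, so it is never
merged away. -/
theorem init (hU : a₀ ≤ U) (stk mp mq : ℕ → ℕ) (h1 : stk 0 = 0) (h2 : mp 0 = 0) (h3 : mq 0 = 0) :
    ScanInv top N L vp vq a₀ U 0 0 stk mp mq a₀ grp := by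
  constructor <;> simp [h1, h2, h3, hU]

theorem stk_le (h : ScanInv top N L vp vq a₀ U j t stk mp mq ans grp) {s : ℕ} (hs : s ≤ t) :
    stk s ≤ stk t := by
  have key : ∀ d s, s + d ≤ t → stk s ≤ stk (s + d) := by
    intro d
    induction d with
    | zero => exact fun _ _ => le_rfl
    | succ d ih => exact fun s hs => (ih s (by omega)).trans (h.mono (s + d) (by omega))
  obtain ⟨d, rfl⟩ := Nat.exists_eq_add_of_le hs
  exact key d s le_rfl

theorem between_eq (h : ScanInv top N L vp vq a₀ U j t stk mp mq ans grp) {i i' : ℕ} (hi : i < j)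
    (hi' : i' < j) (hlt : grp i' < grp i) : between top L i i' = stk (grp i' + 1) := by
  obtain ⟨h1, h2⟩ := h.pair i hi i' hi' hlt
  rw [between_comm, between_of_lt h1, h2]

/-- Positive group maxima are attained by items of the two top groups, and all pairs across these
groups are at distance `stk (t + 1)`. -/
theorem cand_le (h : ScanInv top N L vp vq a₀ U j (t + 1) stk mp mq ans grp)
    (hU : ∀ i < N, ∀ i' < N, i ≠ i' → 0 < between top L i i' → 0 < min (vp i) (vq i') →
      between top L i i' + min (vp i) (vq i') ≤ U) (hlt : 0 < stk (t + 1)) :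
    cand (stk (t + 1)) (min (mp (t + 1)) (mq t)) ≤ U ∧
      cand (stk (t + 1)) (min (mq (t + 1)) (mp t)) ≤ U := by
  have hjN := h.j_le
  constructor
  · rw [cand]
    split_ifs with hm
    · exact Nat.zero_le _
    · have hm1 : mp (t + 1) ≠ 0 := by omega
      have hm2 : mq t ≠ 0 := by omega
      obtain ⟨i, hi, hgi, hvi⟩ := (h.mp_mem (t + 1) le_rfl).resolve_left hm1
      obtain ⟨i', hi', hgi', hvi'⟩ := (h.mq_mem t (by omega)).resolve_left hm2
      have hb := h.between_eq hi hi' (by omega)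
      rw [hgi'] at hb
      have := hU i (by omega) i' (by omega) (by rintro rfl; omega) (by omega) (by omega)
      omega
  · rw [cand]
    split_ifs with hm
    · exact Nat.zero_le _
    · have hm1 : mq (t + 1) ≠ 0 := by omega
      have hm2 : mp t ≠ 0 := by omega
      obtain ⟨i', hi', hgi', hvi'⟩ := (h.mq_mem (t + 1) le_rfl).resolve_left hm1
      obtain ⟨i, hi, hgi, hvi⟩ := (h.mp_mem t (by omega)).resolve_left hm2
      have hb := h.between_eq hi' hi (by omega)
      rw [hgi, between_comm] at hb
      have := hU i (by omega) i' (by omega) (by rintro rfl; omega) (by omega) (by omega)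
      omega

/-- All pairs across the two top groups have the same distance, so the best one is governed by the
largest `min (vp i) (vq i')`, which is the minimum of the two maxima. The two candidates correspond
to the two ways of assigning the roles of `P` and `Q` to the groups. -/
theorem merge (h : ScanInv top N L vp vq a₀ U j (t + 1) stk mp mq ans grp)
    (hU : ∀ i < N, ∀ i' < N, i ≠ i' → 0 < between top L i i' → 0 < min (vp i) (vq i') →
      between top L i i' + min (vp i) (vq i') ≤ U) (hlt : L j < stk (t + 1)) :
    ScanInv top N L vp vq a₀ U j t stk (Function.update mp t (max (mp (t + 1)) (mp t)))
      (Function.update mq t (max (mq (t + 1)) (mq t)))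
      (max (max ans (cand (stk (t + 1)) (min (mp (t + 1)) (mq t))))
        (cand (stk (t + 1)) (min (mq (t + 1)) (mp t)))) (fun i => min (grp i) t) := by
  obtain ⟨hc1, hc2⟩ := h.cand_le hU (by omega)
  have hcase : ∀ i < j, grp i = t + 1 ∨ grp i = t ∨ grp i < t := fun i hi => by
    have := h.le_t i hi; omega
  -- the maxima of the merged group
  have hmax : ∀ (v m : ℕ → ℕ), (∀ i < j, v i ≤ m (grp i)) →
      (∀ s ≤ t + 1, m s = 0 ∨ ∃ i < j, grp i = s ∧ v i = m s) →
      (∀ i < j, v i ≤ Function.update m t (max (m (t + 1)) (m t)) (min (grp i) t)) ∧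
      ∀ s ≤ t, Function.update m t (max (m (t + 1)) (m t)) s = 0 ∨
        ∃ i < j, min (grp i) t = s ∧ v i = Function.update m t (max (m (t + 1)) (m t)) s := by
    intro v m hle hmem
    constructor
    · intro i hi
      have := hle i hi
      rcases hcase i hi with hg | hg | hg
      · rw [hg] at this
        simp [hg, this]
      · rw [hg] at this
        simp [hg, this]
      · rw [min_eq_left hg.le, Function.update_of_ne hg.ne]
        exact this
    · intro s hs
      rcases hs.eq_or_lt with rfl | hs
      · rw [Function.update_self]
        rcases le_total (m s) (m (s + 1)) with hm | hm
        · rw [max_eq_left hm]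
          refine (hmem (s + 1) le_rfl).imp_right ?_
          rintro ⟨i, hi, hgi, hv⟩
          exact ⟨i, hi, by omega, hv⟩
        · rw [max_eq_right hm]
          refine (hmem s (by omega)).imp_right ?_
          rintro ⟨i, hi, hgi, hv⟩
          exact ⟨i, hi, by omega, hv⟩
      · rw [Function.update_of_ne hs.ne]
        refine (hmem s (by omega)).imp_right ?_
        rintro ⟨i, hi, hgi, hv⟩
        exact ⟨i, hi, by omega, hv⟩
  obtain ⟨hp1, hp2⟩ := hmax vp mp h.mp_le h.mp_mem
  obtain ⟨hq1, hq2⟩ := hmax vq mq h.mq_le h.mq_mem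
  refine ⟨fun i _ => min_le_right _ _, ?_, ?_, ?_, fun s hs => h.mono s (by omega), h.stk_zero,
    hp1, hq1, hp2, hq2, ?_, ?_, ?_, by have := h.t_le; omega, h.j_le⟩
  · intro i hi hg
    rw [min_eq_left (by omega)]
    exact h.below i hi (by omega)
  · intro i hi hg
    rcases hcase i hi with hg' | hg' | hg'
    · exact h.on_top i hi hg'
    · rw [h.below i hi (by omega), hg']
      exact hlt.le
    · omega
  · intro i hi i' hi' hg
    rw [min_eq_left (a := grp i') (by omega)]
    exact h.pair i hi i' hi' (by omega)
  · intro i hi i' hi' hne hg hpos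
    have hv := h.mp_le i hi
    have hv' := h.mq_le i' hi'
    rcases lt_trichotomy (grp i) (grp i') with hgg | hgg | hgg
    · have hb := h.between_eq hi' hi hgg
      have := h.le_t i' hi'
      have e1 : grp i = t := by omega
      have e2 : grp i' = t + 1 := by omega
      rw [e1] at hb hv
      rw [e2] at hv'
      rw [between_comm, hb]
      refine le_max_of_le_right ?_
      rw [cand, if_neg (by omega)]
      omega
    · exact le_max_of_le_left (le_max_of_le_left (h.complete i hi i' hi' hne hgg hpos))
    · have hb := h.between_eq hi hi' hgg
      have := h.le_t i hi
      have e1 : grp i = t + 1 := by omega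
      have e2 : grp i' = t := by omega
      rw [e1] at hv
      rw [e2] at hb hv'
      rw [hb]
      refine le_max_of_le_left (le_max_of_le_right ?_)
      rw [cand, if_neg (by omega)]
      omega
  · exact max_le (max_le h.sound hc1) hc2
  · exact le_max_of_le_left (le_max_of_le_left h.le_ans)

/-- The heights are nondecreasing and at most `L j`, so including position `j` does not change the
minima from lower groups. For the previous top group the minimum becomes `L j` itself. -/
theorem push (h : ScanInv top N L vp vq a₀ U j t stk mp mq ans grp) (hL : ∀ i, L i ≤ top)
    (hj : j < N) (hle : stk t ≤ L j) :
    ScanInv top N L vp vq a₀ U (j + 1) (t + 1) (Function.update stk (t + 1) (L j))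
      (Function.update mp (t + 1) (vp j)) (Function.update mq (t + 1) (vq j)) ans
      (Function.update grp j (t + 1)) := by
  have hgrp : ∀ i < j, Function.update grp j (t + 1) i = grp i := fun i hi =>
    Function.update_of_ne hi.ne _ _
  have hlt : ∀ i < j, grp i < t + 1 := fun i hi => Nat.lt_succ_of_le (h.le_t i hi)
  have hcases : ∀ i, i < j + 1 → i = j ∨ i < j := fun i hi => by omega
  have hrm : ∀ i < j, rangeMin top L (i + 1) (j + 1) =
      Function.update stk (t + 1) (L j) (grp i + 1) := by
    intro i hi
    rw [rangeMin_succ hi]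
    rcases (h.le_t i hi).eq_or_lt with hg | hg
    · rw [hg, Function.update_self, min_eq_right (h.on_top i hi hg)]
    · rw [Function.update_of_ne (by omega), h.below i hi hg, min_eq_left]
      exact (h.stk_le hg).trans hle
  have hmax : ∀ (v m : ℕ → ℕ), (∀ i < j, v i ≤ m (grp i)) →
      (∀ s ≤ t, m s = 0 ∨ ∃ i < j, grp i = s ∧ v i = m s) →
      (∀ i < j + 1, v i ≤ Function.update m (t + 1) (v j) (Function.update grp j (t + 1) i)) ∧
      ∀ s ≤ t + 1, Function.update m (t + 1) (v j) s = 0 ∨ ∃ i < j + 1,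
        Function.update grp j (t + 1) i = s ∧ v i = Function.update m (t + 1) (v j) s := by
    intro v m hle hmem
    constructor
    · intro i hi
      rcases hcases i hi with rfl | hi
      · simp
      · rw [hgrp i hi, Function.update_of_ne (hlt i hi).ne]
        exact hle i hi
    · intro s hs
      rcases hs.eq_or_lt with rfl | hs
      · exact .inr ⟨j, by omega, by simp⟩
      · rw [Function.update_of_ne hs.ne]
        refine (hmem s (by omega)).imp_right ?_
        rintro ⟨i, hi, hgi, hv⟩
        exact ⟨i, by omega, by rw [hgrp i hi, hgi], hv⟩
  obtain ⟨hp1, hp2⟩ := hmax vp mp h.mp_le h.mp_mem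
  obtain ⟨hq1, hq2⟩ := hmax vq mq h.mq_le h.mq_mem
  refine ⟨?_, ?_, ?_, ?_, ?_, ?_, hp1, hq1, hp2, hq2, ?_, h.sound, h.le_ans,
    by have := h.t_le; omega, hj⟩
  · intro i hi
    rcases hcases i hi with rfl | hi
    · simp
    · rw [hgrp i hi]; exact (hlt i hi).le
  · intro i hi hg
    rcases hcases i hi with rfl | hi
    · simp at hg
    · rw [hgrp i hi, hrm i hi]
  · intro i hi hg
    rcases hcases i hi with rfl | hi
    · rw [rangeMin_of_le le_rfl]; exact hL _
    · rw [hgrp i hi] at hg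
      exact absurd hg (hlt i hi).ne
  · intro i hi i' hi' hg
    rcases hcases i hi with rfl | hi
    · rcases hcases i' hi' with rfl | hi'
      · exact absurd hg (lt_irrefl _)
      · rw [hgrp i' hi', hrm i' hi']
        exact ⟨hi', rfl⟩
    · rcases hcases i' hi' with rfl | hi'
      · rw [hgrp i hi, Function.update_self] at hg
        exact absurd hg (hlt i hi).le.not_gt
      · rw [hgrp i hi, hgrp i' hi'] at hg
        rw [hgrp i' hi', Function.update_of_ne (by have := hlt i hi; omega)]
        exact h.pair i hi i' hi' hg
  · intro s hs
    rcases (Nat.lt_succ_iff.mp hs).eq_or_lt with rfl | hs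
    · simpa using hle
    · rw [Function.update_of_ne (by omega), Function.update_of_ne (by omega)]
      exact h.mono s hs
  · rw [Function.update_of_ne (by omega), h.stk_zero]
  · intro i hi i' hi' hne hg hpos
    rcases hcases i hi with rfl | hi
    · have := hlt i' (by omega)
      rw [hgrp i' (by omega), Function.update_self] at hg
      omega
    · rcases hcases i' hi' with rfl | hi'
      · have := hlt i hi
        rw [hgrp i hi, Function.update_self] at hg
        omega
      · rw [hgrp i hi, hgrp i' hi'] at hg
        exact h.complete i hi i' hi' hne hg hpos

/-- If the top height is zero, monotonicity makes all heights zero. Positions in different groups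
are then at distance zero, so a pair at positive distance lies in one group. -/
theorem finish (h : ScanInv top N L vp vq a₀ U N t stk mp mq ans grp) (ht : stk t = 0) {i i' : ℕ}
    (hi : i < N) (hi' : i' < N) (hne : i ≠ i') (hb : 0 < between top L i i')
    (hpos : 0 < min (vp i) (vq i')) : between top L i i' + min (vp i) (vq i') ≤ ans := by
  rcases lt_trichotomy (grp i) (grp i') with hg | hg | hg
  · rw [between_comm, h.between_eq hi' hi hg] at hb
    have := h.stk_le (s := grp i + 1) (hg.trans_le (h.le_t i' hi'))
    omega
  · exact h.complete i hi i' hi' hne hg hpos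
  · rw [h.between_eq hi hi' hg] at hb
    have := h.stk_le (s := grp i' + 1) (hg.trans_le (h.le_t i hi))
    omega

end ScanInv

/-! ### The scan on the machine -/

/-- Raise register 17 to the sum of `e` and register 9, unless the latter is zero. -/
def candProg (e : Expr) : Prog := ite (reg 9) (maxReg 17 (op .add (reg 9) e)) skip

theorem den_candProg {w : ℕ} {e : Expr} {s : State} (h1w : 1 < 2 ^ w)
    (h : cand (e.eval w s) (s.reg 9) < 2 ^ w) :
    (candProg e).den w s = s.setReg 17 (max (s.reg 17) (cand (e.eval w s) (s.reg 9))) := by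
  by_cases h9 : s.reg 9 = 0
  · rw [candProg, den_ite_false (by simpa using h9)]
    simp [cand, h9, State.setReg_self]
  · rw [cand, if_neg h9] at h
    rw [candProg, den_ite_true (by simpa using h9), den_maxReg h1w]
    simp [cand, h9, Op.eval_add h]

def mergeProg : Prog :=
  assign 10 (op .sub (reg 8) (const 1)) ;;
  assign 9 (load 43 (reg 8)) ;; minReg 9 (load 44 (reg 10)) ;; candProg (load 42 (reg 8)) ;;
  assign 9 (load 44 (reg 8)) ;; minReg 9 (load 43 (reg 10)) ;; candProg (load 42 (reg 8)) ;;
  assign 9 (load 43 (reg 8)) ;; maxReg 9 (load 43 (reg 10)) ;; store 43 (reg 10) (reg 9) ;;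
  assign 9 (load 44 (reg 8)) ;; maxReg 9 (load 44 (reg 10)) ;; store 44 (reg 10) (reg 9) ;;
  assign 8 (reg 10)

def pushGroupProg : Prog :=
  assign 9 (load 40 (load 27 (load 35 (reg 7)))) ;;
  assign 8 (op .add (reg 8) (const 1)) ;;
  store 42 (reg 8) (load 36 (reg 7)) ;;
  store 43 (reg 8) (const 0) ;;
  store 44 (reg 8) (const 0) ;;
  ite (op .lt (load 35 (reg 7)) (reg 3)) (store 43 (reg 8) (reg 9)) (store 44 (reg 8) (reg 9)) ;;
  assign 7 (op .add (reg 7) (const 1))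

def scanBody : Prog :=
  ite (op .lt (load 36 (reg 7)) (load 42 (reg 8))) mergeProg pushGroupProg

/-- After the last position the scan continues while the top height is positive. The sentinel `L N =
0` then always selects the merge. -/
def scanCond : Expr :=
  op .add (op .lt (reg 7) (reg 5)) (op .lt (const 0) (load 42 (reg 8)))

def scanInit : Prog :=
  assign 7 (const 0) ;; assign 8 (const 0) ;; store 42 (const 0) (const 0) ;;
  store 43 (const 0) (const 0) ;; store 44 (const 0) (const 0)

def scanProg : Prog := scanInit ;; loop scanCond scanBody

/-- The distance to the middle for the item at position `i` if it is less than `nP`. -/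
def valP (nP : ℕ) (V rank A : ℕ → ℕ) (i : ℕ) : ℕ := if A i < nP then V (rank (A i)) else 0

/-- The distance to the middle for the item at position `i` if it is at least `nP`. -/
def valQ (nP : ℕ) (V rank A : ℕ → ℕ) (i : ℕ) : ℕ := if A i < nP then 0 else V (rank (A i))

theorem runs_scanBody {w N U a₀ m : ℕ} {s₀ s : State} {vp vq : ℕ → ℕ} (hw : N + 4 ≤ 2 ^ w)
    (hUw : U < 2 ^ w) (h5 : s₀.reg 5 = N) (hL : ∀ i, s₀.mem 36 i ≤ 2 ^ w - 1)
    (hLN : s₀.mem 36 N = 0)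
    (hvp : vp = valP (s₀.reg 3) (s₀.mem 40) (s₀.mem 27) (s₀.mem 35))
    (hvq : vq = valQ (s₀.reg 3) (s₀.mem 40) (s₀.mem 27) (s₀.mem 35))
    (hU : ∀ i < N, ∀ i' < N, i ≠ i' → 0 < between (2 ^ w - 1) (s₀.mem 36) i i' →
      0 < min (vp i) (vq i') →
      between (2 ^ w - 1) (s₀.mem 36) i i' + min (vp i) (vq i') ≤ U)
    (hf : Frame scanBody s₀ s)
    (hI : (∃ grp, ScanInv (2 ^ w - 1) N (s₀.mem 36) vp vq a₀ U (s.reg 7) (s.reg 8) (s.mem 42)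
      (s.mem 43) (s.mem 44) (s.reg 17) grp) ∧ m = 2 * (N - s.reg 7) + s.reg 8)
    (hcond : scanCond.eval w s ≠ 0) :
    Runs w scanBody s scanBody.bound fun s' => ∃ m' < m,
      (∃ grp, ScanInv (2 ^ w - 1) N (s₀.mem 36) vp vq a₀ U (s'.reg 7) (s'.reg 8) (s'.mem 42)
        (s'.mem 43) (s'.mem 44) (s'.reg 17) grp) ∧ m' = 2 * (N - s'.reg 7) + s'.reg 8 := by
  obtain ⟨⟨grp, hinv⟩, rfl⟩ := hI
  have h1w : 1 < 2 ^ w := by omega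
  have h0 : ∀ s, (const 0).eval w s = 0 := fun s => eval_const (by omega)
  have h1 : ∀ s, (const 1).eval w s = 1 := fun s => eval_const (by omega)
  have r3 : s.reg 3 = s₀.reg 3 := hf.1 3 rfl
  have r5 : s.reg 5 = N := by rw [hf.1 5 rfl, h5]
  have m36 : s.mem 36 = s₀.mem 36 := hf.2 36 rfl
  have m27 : s.mem 27 = s₀.mem 27 := hf.2 27 rfl
  have m35 : s.mem 35 = s₀.mem 35 := hf.2 35 rfl
  have m40 : s.mem 40 = s₀.mem 40 := hf.2 40 rfl
  have htj := hinv.t_le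
  have hjN := hinv.j_le
  refine Runs.den rfl ?_
  by_cases hlt : s₀.mem 36 (s.reg 7) < s.mem 42 (s.reg 8)
  · rw [scanBody, den_ite_true (by simpa [Op.eval_lt h1w, m36] using hlt)]
    obtain ⟨t, ht⟩ : ∃ t, s.reg 8 = t + 1 := by
      refine Nat.exists_eq_add_one_of_ne_zero fun e => ?_
      rw [e, hinv.stk_zero] at hlt
      omega
    rw [ht] at hinv hlt
    have hinv' := hinv.merge hU hlt
    obtain ⟨hc1, hc2⟩ := hinv.cand_le hU (by omega)
    replace hc1 := hc1.trans_lt hUw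
    replace hc2 := hc2.trans_lt hUw
    have hden : (mergeProg.den w s).reg 7 = s.reg 7 ∧ (mergeProg.den w s).reg 8 = t ∧
        (mergeProg.den w s).reg 17 =
          max (max (s.reg 17) (cand (s.mem 42 (t + 1)) (min (s.mem 43 (t + 1)) (s.mem 44 t))))
            (cand (s.mem 42 (t + 1)) (min (s.mem 44 (t + 1)) (s.mem 43 t))) ∧
        (mergeProg.den w s).mem 42 = s.mem 42 ∧
        (mergeProg.den w s).mem 43 =
          Function.update (s.mem 43) t (max (s.mem 43 (t + 1)) (s.mem 43 t)) ∧
        (mergeProg.den w s).mem 44 =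
          Function.update (s.mem 44) t (max (s.mem 44 (t + 1)) (s.mem 44 t)) := by
      refine ⟨?_, ?_, ?_, ?_, ?_, ?_⟩ <;>
      simp (disch := first | omega | simp [ht, hc1, hc2]) [mergeProg, h1, ht, Op.eval_sub, den_minReg h1w,
        den_maxReg h1w, den_candProg h1w]
    obtain ⟨d7, d8, d17, d42, d43, d44⟩ := hden
    refine ⟨2 * (N - s.reg 7) + t, by omega, ?_, by rw [d7, d8]⟩
    rw [d7, d8, d17, d42, d43, d44]
    exact ⟨_, hinv'⟩
  · rw [scanBody, den_ite_false (by simpa [Op.eval_lt h1w, m36] using hlt)]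
    have hj : s.reg 7 < N := by
      by_contra hj
      refine hcond ?_
      obtain rfl : s.reg 7 = N := by omega
      rw [hLN] at hlt
      simp (disch := omega) [scanCond, h0, r5, Op.eval_lt h1w, Op.eval_add,
        show s.mem 42 (s.reg 8) = 0 by omega]
    have hinv' := hinv.push hL hj (not_lt.mp hlt)
    have hden : (pushGroupProg.den w s).reg 7 = s.reg 7 + 1 ∧
        (pushGroupProg.den w s).reg 8 = s.reg 8 + 1 ∧
        (pushGroupProg.den w s).reg 17 = s.reg 17 ∧
        (pushGroupProg.den w s).mem 42 =
          Function.update (s.mem 42) (s.reg 8 + 1) (s₀.mem 36 (s.reg 7)) ∧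
        (pushGroupProg.den w s).mem 43 =
          Function.update (s.mem 43) (s.reg 8 + 1) (vp (s.reg 7)) ∧
        (pushGroupProg.den w s).mem 44 =
          Function.update (s.mem 44) (s.reg 8 + 1) (vq (s.reg 7)) := by
      rw [hvp, hvq]
      by_cases hc : s₀.mem 35 (s.reg 7) < s₀.reg 3 <;>
      refine ⟨?_, ?_, ?_, ?_, ?_, ?_⟩ <;>
      simp (disch := omega) [pushGroupProg, h0, h1, Op.eval_add, Op.eval_lt h1w, Prog.den, hc,
        m35, m36, m40, m27, r3, valP, valQ]
    obtain ⟨d7, d8, d17, d42, d43, d44⟩ := hden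
    refine ⟨2 * (N - (s.reg 7 + 1)) + (s.reg 8 + 1), by omega, ?_, by rw [d7, d8]⟩
    rw [d7, d8, d17, d42, d43, d44]
    exact ⟨_, hinv'⟩

theorem runs_scanProg {w N U : ℕ} {s : State} {vp vq : ℕ → ℕ} (hw : N + 4 ≤ 2 ^ w)
    (hUw : U < 2 ^ w) (h5 : s.reg 5 = N) (hL : ∀ i, s.mem 36 i ≤ 2 ^ w - 1)
    (hLN : s.mem 36 N = 0) (hans : s.reg 17 ≤ U)
    (hvp : vp = valP (s.reg 3) (s.mem 40) (s.mem 27) (s.mem 35))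
    (hvq : vq = valQ (s.reg 3) (s.mem 40) (s.mem 27) (s.mem 35))
    (hU : ∀ i < N, ∀ i' < N, i ≠ i' → 0 < between (2 ^ w - 1) (s.mem 36) i i' →
      0 < min (vp i) (vq i') →
      between (2 ^ w - 1) (s.mem 36) i i' + min (vp i) (vq i') ≤ U) :
    Runs w scanProg s (400 * N + 40) fun s' =>
      s.reg 17 ≤ s'.reg 17 ∧ s'.reg 17 ≤ U ∧
      ∀ i < N, ∀ i' < N, i ≠ i' → 0 < between (2 ^ w - 1) (s.mem 36) i i' →
        0 < min (vp i) (vq i') →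
        between (2 ^ w - 1) (s.mem 36) i i' + min (vp i) (vq i') ≤ s'.reg 17 := by
  have h1w : 1 < 2 ^ w := by omega
  have h0 : ∀ s, (const 0).eval w s = 0 := fun s => eval_const (by omega)
  refine (Runs.seq (n := 20) (m := 400 * N + 20)
    ((Runs.den (p := scanInit) (Q := (· = _)) rfl rfl).mono (by
      simp [scanInit, bound, cost]) fun _ h => h) ?_).mono
    (by omega) fun _ h => h
  rintro s₀ - rfl
  obtain ⟨s₀, hs₀⟩ : ∃ s₀, s₀ = scanInit.den w s := ⟨_, rfl⟩
  rw [← hs₀]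
  have i3 : s₀.reg 3 = s.reg 3 := by simp [hs₀, scanInit]
  have i5 : s₀.reg 5 = s.reg 5 := by simp [hs₀, scanInit]
  have i17 : s₀.reg 17 = s.reg 17 := by simp [hs₀, scanInit]
  have i27 : s₀.mem 27 = s.mem 27 := by simp [hs₀, scanInit]
  have i35 : s₀.mem 35 = s.mem 35 := by simp [hs₀, scanInit]
  have i36 : s₀.mem 36 = s.mem 36 := by simp [hs₀, scanInit]
  have i40 : s₀.mem 40 = s.mem 40 := by simp [hs₀, scanInit]
  rw [← i5] at h5
  rw [← i36] at hL hLN hU ⊢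
  rw [← i3, ← i40, ← i27, ← i35] at hvp hvq
  rw [← i17] at hans ⊢
  refine (Runs.loop (m := 2 * N) (fun m s' =>
    (∃ grp, ScanInv (2 ^ w - 1) N (s₀.mem 36) vp vq (s₀.reg 17) U (s'.reg 7) (s'.reg 8)
      (s'.mem 42) (s'.mem 43) (s'.mem 44) (s'.reg 17) grp) ∧ m = 2 * (N - s'.reg 7) + s'.reg 8)
    (fun m s' hf hI hc => runs_scanBody hw hUw h5 hL hLN hvp hvq hU hf hI hc) ?_).mono ?_ ?_
  · have e7 : s₀.reg 7 = 0 := by simp [hs₀, scanInit, h0]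
    have e8 : s₀.reg 8 = 0 := by simp [hs₀, scanInit, h0]
    rw [e7, e8]
    exact ⟨⟨fun _ => 0, ScanInv.init hans _ _ _ (by simp [hs₀, scanInit, h0])
      (by simp [hs₀, scanInit, h0]) (by simp [hs₀, scanInit, h0])⟩, by omega⟩
  · simp only [scanBody, mergeProg, pushGroupProg, candProg, minReg, maxReg, scanCond, bound, cost]
    omega
  · rintro s' ⟨hf, hc, m, ⟨grp, hinv⟩, -⟩
    have r5 : s'.reg 5 = N := by rw [hf.1 5 rfl, h5]
    have hjN := hinv.j_le
    have hend : s'.reg 7 = N ∧ s'.mem 42 (s'.reg 8) = 0 := by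
      by_cases c1 : s'.reg 7 < N <;> by_cases c2 : s'.mem 42 (s'.reg 8) = 0 <;>
        simp (disch := omega) [scanCond, h0, r5, c1, c2, Op.eval_lt h1w, Op.eval_add,
          Nat.pos_iff_ne_zero] at hc ⊢
      omega
    rw [hend.1] at hinv
    exact ⟨hinv.le_ans, hinv.sound, fun i hi i' hi' hne hb hpos =>
      hinv.finish hend.2 hi hi' hne hb hpos⟩

/-! ### Splitting blocks into halves -/

/-- The items are listed in `A`, by blocks of size `S` of their ranks; within every block, `L` stores
the distances of neighbours with respect to `X`. -/
structure Level (N S top : ℕ) (rank : ℕ → ℕ) (X : ℕ → ℕ → ℕ) (A L : ℕ → ℕ) : Prop where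
  A_lt : ∀ j < N, A j < N
  A_inj : ∀ i < N, ∀ j < N, A i = A j → i = j
  block : ∀ j < N, rank (A j) / S = j / S
  start : ∀ j < N, j % S = 0 → L j = 0
  dist : ∀ i j, i < j → j < N → i / S = j / S →
    rangeMin top L (i + 1) (j + 1) = X (A i) (A j) + 1
  L_end : L N = 0

theorem exists_of_injOn {N : ℕ} {f : ℕ → ℕ} (hlt : ∀ j < N, f j < N)
    (hinj : ∀ i < N, ∀ j < N, f i = f j → i = j) {x : ℕ} (hx : x < N) : ∃ j < N, f j = x := by
  have h := Finset.surjOn_of_injOn_of_card_le (s := Finset.range N) (t := Finset.range N) f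
    (fun j hj => by simpa using hlt j (by simpa using hj))
    (fun i hi j hj => hinj i (by simpa using hi) j (by simpa using hj)) le_rfl
  obtain ⟨j, hj, hjx⟩ := h (show x ∈ (Finset.range N : Set ℕ) by simpa using hx)
  exact ⟨j, by simpa using hj, hjx⟩

theorem Level.exists_pos {N S top : ℕ} {rank : ℕ → ℕ} {X : ℕ → ℕ → ℕ} {A L : ℕ → ℕ}
    (h : Level N S top rank X A L) {x : ℕ} (hx : x < N) : ∃ j < N, A j = x :=
  exists_of_injOn h.A_lt h.A_inj hx

theorem Level.congr {N S top : ℕ} {rank : ℕ → ℕ} {X : ℕ → ℕ → ℕ} {A L A' L' : ℕ → ℕ}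
    (h : Level N S top rank X A L) (hA : ∀ j < N, A' j = A j) (hL : ∀ j ≤ N, L' j = L j) :
    Level N S top rank X A' L' := by
  refine ⟨?_, ?_, ?_, ?_, ?_, by rw [hL N le_rfl, h.L_end]⟩
  · intro j hj
    rw [hA j hj]
    exact h.A_lt j hj
  · intro i hi j hj hij
    rw [hA i hi, hA j hj] at hij
    exact h.A_inj i hi j hj hij
  · intro j hj
    rw [hA j hj]
    exact h.block j hj
  · intro j hj h0
    rw [hL j hj.le]
    exact h.start j hj h0
  · intro i j hij hj hb
    rw [hA i (hij.trans hj), hA j hj, ← h.dist i j hij hj hb]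
    exact rangeMin_congr fun t _ ht => hL t (by omega)

/-- The position of the next element of class `c`, after `j` elements have been distributed. -/
def nextPos (B : ℕ) (h : ℕ → ℕ) (j c : ℕ) : ℕ :=
  c * B + ((Finset.range j).filter fun i => h i = c).card

theorem nextPos_zero (B : ℕ) (h : ℕ → ℕ) (c : ℕ) : nextPos B h 0 c = c * B := by
  simp [nextPos]

theorem nextPos_succ (B : ℕ) (h : ℕ → ℕ) (j c : ℕ) :
    nextPos B h (j + 1) c = if h j = c then nextPos B h j c + 1 else nextPos B h j c := by
  rw [nextPos, nextPos, Finset.range_add_one, Finset.filter_insert]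
  split_ifs
  · rw [Finset.card_insert_of_notMem (by simp)]
    omega
  · rfl

theorem nextPos_mono (B : ℕ) (h : ℕ → ℕ) {i j : ℕ} (hij : i ≤ j) (c : ℕ) :
    nextPos B h i c ≤ nextPos B h j c := by
  refine Nat.add_le_add_left (Finset.card_le_card (Finset.filter_subset_filter _ ?_)) _
  exact Finset.range_subset_range.mpr hij

theorem le_nextPos (B : ℕ) (h : ℕ → ℕ) (j c : ℕ) : c * B ≤ nextPos B h j c := Nat.le_add_right _ _

/-- The ranks `ρ` of the elements are distinct and determine their classes. -/
structure Classes (N B : ℕ) (ρ h : ℕ → ℕ) : Prop where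
  pos : 0 < B
  lt : ∀ i < N, ρ i < N
  inj : ∀ i < N, ∀ j < N, ρ i = ρ j → i = j
  eq : ∀ i, h i = ρ i / B

namespace Classes

variable {N B : ℕ} {ρ h : ℕ → ℕ}

/-- Elements of class `c` have distinct ranks in the interval of length `B` starting at `c * B`, cut
off at `N`. So the slots reserved for a class suffice, even in an incomplete last half. -/
theorem nextPos_le (H : Classes N B ρ h) {j : ℕ} (hj : j ≤ N) (c : ℕ) :
    nextPos B h j c ≤ c * B + (min (c * B + B) N - c * B) := by
  refine Nat.add_le_add_left ?_ _
  rw [← Nat.card_Ico]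
  refine Finset.card_le_card_of_injOn ρ (fun i hi => ?_) fun i hi i' hi' e => ?_
  · simp only [Finset.coe_filter, Finset.mem_range, Set.mem_ofPred_eq] at hi
    have h1 := H.lt i (by omega)
    have h2 := H.eq i
    rw [hi.2] at h2
    have h3 : c * B ≤ ρ i := by rw [h2]; exact Nat.div_mul_le_self _ _
    have h4 : ρ i < c * B + B := by
      rw [h2]; exact Nat.lt_div_mul_add H.pos
    simp [h1, h3, h4]
  · simp only [Finset.coe_filter, Finset.mem_range, Set.mem_ofPred_eq] at hi hi'
    exact H.inj i (by omega) i' (by omega) e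

theorem nextPos_le_add (H : Classes N B ρ h) {j : ℕ} (hj : j ≤ N) (c : ℕ) :
    nextPos B h j c ≤ c * B + B := by
  have := H.nextPos_le hj c
  omega

theorem pos_lt (H : Classes N B ρ h) {i : ℕ} (hi : i < N) :
    nextPos B h i (h i) < N ∧ nextPos B h i (h i) < h i * B + B := by
  have h1 := H.nextPos_le (j := i + 1) hi (h i)
  have h2 := nextPos_succ B h i (h i)
  rw [if_pos rfl] at h2
  have h3 := le_nextPos B h i (h i)
  omega

theorem div_eq (H : Classes N B ρ h) {t c : ℕ} (h1 : c * B ≤ t) (h2 : t < c * B + B) :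
    t / B = c := by
  rw [Nat.div_eq_iff H.pos]
  omega

theorem pos_lt_pos {i j : ℕ} (hij : i < j) (hc : h i = h j) :
    nextPos B h i (h i) < nextPos B h j (h j) := by
  have h1 := nextPos_succ B h i (h i)
  rw [if_pos rfl] at h1
  have h2 := nextPos_mono B h (show i + 1 ≤ j from hij) (h i)
  rw [← hc]
  omega

theorem pos_div (H : Classes N B ρ h) {i : ℕ} (hi : i < N) : nextPos B h i (h i) / B = h i :=
  H.div_eq (le_nextPos _ _ _ _) (H.pos_lt hi).2

theorem pos_inj (H : Classes N B ρ h) {i j : ℕ} (hi : i < N) (hj : j < N)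
    (e : nextPos B h i (h i) = nextPos B h j (h j)) : i = j := by
  have hc : h i = h j := by rw [← H.pos_div hi, ← H.pos_div hj, e]
  rcases lt_trichotomy i j with h1 | h1 | h1
  · exact absurd e (pos_lt_pos h1 hc).ne
  · exact h1
  · exact absurd e (pos_lt_pos h1 hc.symm).ne'

end Classes

/-- The state of the distribution after `j` elements; `mn` contains the minima of `L` since the last
element of either half. -/
structure SplitInv (N S B top : ℕ) (h A L : ℕ → ℕ) (j : ℕ) (A' L' cnt mn : ℕ → ℕ) : Prop where
  cnt_eq : ∀ i < N, cnt (h i) = nextPos B h j (h i)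
  A_eq : ∀ i < j, A' (nextPos B h i (h i)) = A i
  start : ∀ i < j, nextPos B h i (h i) % B = 0 → L' (nextPos B h i (h i)) = 0
  dist : ∀ i i', i < i' → i' < j → h i = h i' →
    rangeMin top L' (nextPos B h i (h i) + 1) (nextPos B h i' (h i') + 1) =
      rangeMin top L (i + 1) (i' + 1)
  -- Only elements in the block of `j` are concerned. Hence the two running minima need no reset at
  -- a block boundary; stale values are not used, since the first entry of every half is set to
  -- zero.
  last : ∀ i < j, i / S = j / S →
    min (rangeMin top L' (nextPos B h i (h i) + 1) (nextPos B h j (h i))) (mn (h i % 2)) =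
      rangeMin top L (i + 1) j

/-- The halves of block `q` are the classes `2 * q` and `2 * q + 1`, so parity tells them apart.
Between consecutive elements of one half, the new neighbour value is the minimum of `L` accumulated
since the former. The write at the new position does not affect ranges between elements placed
earlier. -/
theorem SplitInv.step {N S B top : ℕ} {ρ h A L : ℕ → ℕ} {j : ℕ} {A' L' cnt mn mn' : ℕ → ℕ}
    (H : Classes N B ρ h) (hS : S = 2 * B) (hρ : ∀ i < N, ρ i / S = i / S)
    (I : SplitInv N S B top h A L j A' L' cnt mn) (hj : j < N)
    (hmn1 : mn' (h j % 2) = top)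
    (hmn2 : ∀ c, c < 2 → c ≠ h j % 2 → mn' c = min (mn c) (L j)) :
    SplitInv N S B top h A L (j + 1) (Function.update A' (nextPos B h j (h j)) (A j))
      (Function.update L' (nextPos B h j (h j))
        (if nextPos B h j (h j) % B = 0 then 0 else min (mn (h j % 2)) (L j)))
      (Function.update cnt (h j) (nextPos B h j (h j) + 1)) mn' := by
  have hcases : ∀ i, i < j + 1 → i = j ∨ i < j := fun i hi => by omega
  have hne : ∀ i < j, nextPos B h i (h i) ≠ nextPos B h j (h j) := fun i hi e =>
    hi.ne (H.pos_inj (hi.trans hj) hj e)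
  have hhalf : ∀ i < N, h i / 2 = i / S := fun i hi => by
    rw [H.eq, Nat.div_div_eq_div_mul, mul_comm, ← hS, hρ i hi]
  have hlast : ∀ i < j, h i = h j →
      rangeMin top (Function.update L' (nextPos B h j (h j))
        (if nextPos B h j (h j) % B = 0 then 0 else min (mn (h j % 2)) (L j)))
        (nextPos B h i (h i) + 1) (nextPos B h j (h j) + 1) = rangeMin top L (i + 1) (j + 1) := by
    intro i hi hc
    have hlt := Classes.pos_lt_pos (B := B) hi hc
    have h1 := le_nextPos B h i (h i)
    have h2 := (H.pos_lt hj).2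
    -- An element `i` of the same half has already been placed, so `j` does not receive the first
    -- slot.
    have h3 : nextPos B h j (h j) % B ≠ 0 := by
      intro h0
      have h4 := Nat.div_add_mod (nextPos B h j (h j)) B
      rw [h0, H.pos_div hj, mul_comm, ← hc] at h4
      rw [← hc] at hlt
      omega
    rw [rangeMin_succ hlt, Function.update_self, if_neg h3, rangeMin_succ hi,
      ← I.last i hi (by rw [← hhalf i (hi.trans hj), ← hhalf j hj, hc]), ← min_assoc, hc]
    congr 2
    exact rangeMin_congr fun t _ ht => Function.update_of_ne ht.ne _ _
  refine ⟨?_, ?_, ?_, ?_, ?_⟩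
  · intro i hi
    rw [nextPos_succ]
    by_cases hc : h j = h i
    · rw [if_pos hc, hc, Function.update_self]
    · rw [if_neg hc, Function.update_of_ne (Ne.symm hc), I.cnt_eq i hi]
  · intro i hi
    rcases hcases i hi with rfl | hi
    · rw [Function.update_self]
    · rw [Function.update_of_ne (hne i hi), I.A_eq i hi]
  · intro i hi h0
    rcases hcases i hi with rfl | hi
    · rw [Function.update_self, if_pos h0]
    · rw [Function.update_of_ne (hne i hi), I.start i hi h0]
  · intro i i' hii hi' hc
    rcases hcases i' hi' with rfl | hi'
    · exact hlast i hii hc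
    · rw [← I.dist i i' hii hi' hc]
      refine rangeMin_congr fun t ht ht' => Function.update_of_ne ?_ _ _
      -- A slot between two slots of one class belongs to that class. But the slot of `j` comes
      -- after all slots its class has received so far.
      rintro rfl
      have h1 := le_nextPos B h i (h i)
      have h2 := (H.pos_lt (hi'.trans hj)).2
      rw [← hc] at h2 ht'
      have h3 := H.div_eq (t := nextPos B h j (h j)) (c := h i) (by omega) (by omega)
      rw [H.pos_div hj] at h3
      have := Classes.pos_lt_pos (B := B) hi' (hc.symm.trans h3.symm)
      rw [hc] at ht'
      omega
  · intro i hi hb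
    rcases hcases i hi with rfl | hi
    · rw [nextPos_succ, if_pos rfl, rangeMin_of_le le_rfl, rangeMin_of_le le_rfl, hmn1, min_self]
    · have hb' : i / S = j / S := by
        have h1 := Nat.div_le_div_right (c := S) hi.le
        have h2 := Nat.div_le_div_right (c := S) (Nat.le_succ j)
        simp only [Nat.succ_eq_add_one] at h2
        omega
      by_cases hc : h i = h j
      · rw [nextPos_succ, if_pos hc.symm, hc, hmn1]
        have := hlast i hi hc
        rw [hc] at this
        rw [this, min_eq_left (rangeMin_le_top _ _ _ _)]
      · have h1 := hhalf i (hi.trans hj)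
        have h2 := hhalf j hj
        rw [nextPos_succ, if_neg (Ne.symm hc), hmn2 _ (Nat.mod_lt _ (by omega)) (by omega),
          rangeMin_succ hi, ← I.last i hi hb', ← min_assoc]
        congr 2
        refine rangeMin_congr fun t ht ht' => Function.update_of_ne ?_ _ _
        rintro rfl
        have h3 := le_nextPos B h i (h i)
        have h4 := H.nextPos_le_add hj.le (h i)
        have h5 := H.div_eq (t := nextPos B h j (h j)) (c := h i) (by omega) (by omega)
        rw [H.pos_div hj] at h5
        exact hc h5.symm

/-- The placement is injective from the positions below `N` to themselves, hence bijective. So every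
claim about new positions pulls back to old ones, and stability preserves the order within each
half. -/
theorem SplitInv.level {N S B top : ℕ} {rank A L : ℕ → ℕ} {X : ℕ → ℕ → ℕ} {h : ℕ → ℕ}
    {A' L' cnt mn : ℕ → ℕ} (H : Classes N B (fun i => rank (A i)) h) (hS : S = 2 * B)
    (hlev : Level N S top rank X A L) (I : SplitInv N S B top h A L N A' L' cnt mn)
    (hend : L' N = 0) : Level N B top rank X A' L' := by
  have hex : ∀ q < N, ∃ i < N, nextPos B h i (h i) = q := fun q hq =>
    exists_of_injOn (f := fun i => nextPos B h i (h i)) (fun i hi => (H.pos_lt hi).1)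
      (fun i hi j hj e => H.pos_inj hi hj e) hq
  refine ⟨?_, ?_, ?_, ?_, ?_, hend⟩
  · intro q hq
    obtain ⟨i, hi, rfl⟩ := hex q hq
    rw [I.A_eq i hi]
    exact hlev.A_lt i hi
  · intro q hq q' hq' e
    obtain ⟨i, hi, rfl⟩ := hex q hq
    obtain ⟨i', hi', rfl⟩ := hex q' hq'
    rw [I.A_eq i hi, I.A_eq i' hi'] at e
    rw [hlev.A_inj i hi i' hi' e]
  · intro q hq
    obtain ⟨i, hi, rfl⟩ := hex q hq
    rw [I.A_eq i hi, H.pos_div hi, H.eq]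
  · intro q hq h0
    obtain ⟨i, hi, rfl⟩ := hex q hq
    exact I.start i hi h0
  · intro q q' hqq hq' hb
    obtain ⟨i, hi, rfl⟩ := hex q (hqq.trans hq')
    obtain ⟨i', hi', rfl⟩ := hex q' hq'
    rw [H.pos_div hi, H.pos_div hi'] at hb
    have hlt : i < i' := by
      rcases lt_trichotomy i i' with h1 | h1 | h1
      · exact h1
      · rw [h1] at hqq; exact absurd hqq (lt_irrefl _)
      · exact absurd hqq (Classes.pos_lt_pos h1 hb.symm).le.not_gt
    rw [I.A_eq i hi, I.A_eq i' hi', I.dist i i' hlt hi' hb]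
    refine hlev.dist i i' hlt hi' ?_
    have h1 := hlev.block i hi
    have h2 := hlev.block i' hi'
    rw [H.eq, H.eq] at hb
    rw [← h1, ← h2, hS, mul_comm, ← Nat.div_div_eq_div_mul, ← Nat.div_div_eq_div_mul, hb]

/-! ### Splitting blocks on the machine -/

def splitBody : Prog :=
  assign 9 (op .div (load 27 (load 35 (reg 7))) (reg 16)) ;;
  assign 10 (load 45 (const 0)) ;; minReg 10 (load 36 (reg 7)) ;; store 45 (const 0) (reg 10) ;;
  assign 10 (load 45 (const 1)) ;; minReg 10 (load 36 (reg 7)) ;; store 45 (const 1) (reg 10) ;;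
  assign 10 (load 41 (reg 9)) ;;
  store 46 (reg 10) (load 35 (reg 7)) ;;
  -- The factor is a comparison bit; it makes the entry zero exactly at the start of a half.
  store 47 (reg 10) (op .mul (load 45 (op .mod (reg 9) (const 2)))
    (op .lt (const 0) (op .mod (reg 10) (reg 16)))) ;;
  -- The present element is now the last one of its half, so the minimum since then ranges over the
  -- empty set.
  store 45 (op .mod (reg 9) (const 2)) (reg 6) ;;
  store 41 (reg 9) (op .add (reg 10) (const 1)) ;;
  assign 7 (op .add (reg 7) (const 1))

/-- Distribute the elements of every block to its halves. -/
def splitProg : Prog := assign 7 (const 0) ;; loop (op .lt (reg 7) (reg 5)) splitBody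

def copyBody : Prog :=
  store 35 (reg 7) (load 46 (reg 7)) ;; store 36 (reg 7) (load 47 (reg 7)) ;;
  assign 7 (op .add (reg 7) (const 1))

/-- Copy the result of the distribution back. -/
def copyProg : Prog := assign 7 (const 0) ;; loop (op .lt (reg 7) (reg 5)) copyBody

theorem runs_splitProg {w N S B : ℕ} {s : State} {X : ℕ → ℕ → ℕ} (hw : N + 4 ≤ 2 ^ w)
    (hfit : s.Fits w) (h5 : s.reg 5 = N) (h6 : s.reg 6 = 2 ^ w - 1)
    (h16 : s.reg 16 = B) (hS : S = 2 * B) (hB : 0 < B)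
    (hrank : ∀ x < N, s.mem 27 x < N) (hinj : ∀ x < N, ∀ y < N, s.mem 27 x = s.mem 27 y → x = y)
    (hcnt : ∀ i < N, s.mem 41 (i / B) = i / B * B) (h47 : s.mem 47 N = 0)
    (hlev : Level N S (2 ^ w - 1) (s.mem 27) X (s.mem 35) (s.mem 36)) :
    Runs w splitProg s (80 * N + 20) fun s' =>
      Level N B (2 ^ w - 1) (s.mem 27) X (s'.mem 46) (s'.mem 47) ∧ s'.mem 47 N = 0 := by
  have h1w : 1 < 2 ^ w := by omega
  have h0 : ∀ s, (const 0).eval w s = 0 := fun s => eval_const (by omega)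
  have h1 : ∀ s, (const 1).eval w s = 1 := fun s => eval_const (by omega)
  have h2 : ∀ s, (const 2).eval w s = 2 := fun s => eval_const (by omega)
  obtain ⟨h, hh⟩ : ∃ h : ℕ → ℕ, h = fun i => s.mem 27 (s.mem 35 i) / B := ⟨_, rfl⟩
  have H : Classes N B (fun i => s.mem 27 (s.mem 35 i)) h :=
    ⟨hB, fun i hi => hrank _ (hlev.A_lt i hi), fun i hi j hj e =>
      hlev.A_inj i hi j hj (hinj _ (hlev.A_lt i hi) _ (hlev.A_lt j hj) e), fun i => by rw [hh]⟩
  refine (Runs.seq (n := 2) (m := 80 * N + 18) (Runs.den (Q := (· = _)) rfl rfl) ?_).mono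
    (by omega) fun _ h => h
  rintro s₀ - rfl
  refine (Runs.loop (c := splitBody.bound) (m := N) (fun m s' => s'.reg 7 ≤ N ∧
    m = N - s'.reg 7 ∧ s'.mem 47 N = 0 ∧ SplitInv N S B (2 ^ w - 1) h (s.mem 35) (s.mem 36)
      (s'.reg 7) (s'.mem 46) (s'.mem 47) (s'.mem 41) (s'.mem 45)) ?_ ?_).mono ?_ ?_
  · rintro m s' hf ⟨hiN, rfl, hend, hinv⟩ hcond
    have r5 : s'.reg 5 = N := by rw [hf.1 5 rfl]; simp [h5]
    have r6 : s'.reg 6 = 2 ^ w - 1 := by rw [hf.1 6 rfl]; simp [h6]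
    have r16 : s'.reg 16 = B := by rw [hf.1 16 rfl]; simp [h16]
    have m27 : s'.mem 27 = s.mem 27 := by rw [hf.2 27 rfl]; simp
    have m35 : s'.mem 35 = s.mem 35 := by rw [hf.2 35 rfl]; simp
    have m36 : s'.mem 36 = s.mem 36 := by rw [hf.2 36 rfl]; simp
    have hlt : s'.reg 7 < N := by simpa [Op.eval_lt h1w, r5] using hcond
    generalize hj : s'.reg 7 = j at *
    have hpos := (H.pos_lt hlt).1
    have hcj := hinv.cnt_eq j hlt
    have hhj : s.mem 27 (s.mem 35 j) / B = h j := by rw [hh]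
    have hρ := H.lt j hlt
    have hhlt : h j ≤ s.mem 27 (s.mem 35 j) := by rw [H.eq]; exact Nat.div_le_self _ _
    have hL := hfit.2 36 j
    generalize hp : nextPos B h j (h j) = pos at *
    obtain ⟨mn', hmn'⟩ : ∃ mn', mn' = Function.update (Function.update (Function.update (s'.mem 45) 0
      (min (s'.mem 45 0) (s.mem 36 j))) 1 (min (s'.mem 45 1) (s.mem 36 j))) (h j % 2) (2 ^ w - 1) :=
      ⟨_, rfl⟩
    have hpar : h j % 2 = 0 ∨ h j % 2 = 1 := by omega
    have step := hinv.step (mn' := mn') H hS hlev.block hlt (by simp [hmn']) (by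
      intro c hc hne
      rw [hmn', Function.update_of_ne hne]
      rcases (show c = 0 ∨ c = 1 by omega) with rfl | rfl <;> simp)
    rw [hp] at step
    have hmul : ∀ x, min x (s.mem 36 j) * (if 0 < pos % B then 1 else 0) < 2 ^ w := fun x =>
      (Nat.mul_le_mul (min_le_right _ _) (show _ ≤ 1 by split_ifs <;> simp)).trans_lt (by omega)
    have hden : (splitBody.den w s').reg 7 = j + 1 ∧
        (splitBody.den w s').mem 46 = Function.update (s'.mem 46) pos (s.mem 35 j) ∧
        (splitBody.den w s').mem 47 = Function.update (s'.mem 47) pos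
          (if pos % B = 0 then 0 else min (s'.mem 45 (h j % 2)) (s.mem 36 j)) ∧
        (splitBody.den w s').mem 41 = Function.update (s'.mem 41) (h j) (pos + 1) ∧
        (splitBody.den w s').mem 45 = mn' := by
      rw [hmn']
      rcases hpar with hpar | hpar <;> by_cases hz : pos % B = 0 <;>
      refine ⟨?_, ?_, ?_, ?_, ?_⟩ <;>
      simp (disch := first | omega | simp [hz]; omega) [splitBody, h0, h1, h2, hj, r6, r16, m27, m35, m36, hhj,
        hcj, den_minReg h1w, Op.eval_div, Op.eval_mod, Op.eval_add, Op.eval_lt h1w, Op.eval_mul,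
        hpar, hz, Nat.pos_iff_ne_zero]
    obtain ⟨d7, d46, d47, d41, d45⟩ := hden
    refine Runs.den rfl ⟨N - (j + 1), by omega, ?_⟩
    rw [d7, d46, d47, d41, d45]
    exact ⟨hlt, rfl, by rw [Function.update_of_ne (by omega), hend], step⟩
  · refine ⟨by simp [h0], by simp [h0], by simpa using h47, ?_⟩
    refine ⟨fun i hi => ?_, ?_, ?_, ?_, ?_⟩
    · rw [H.eq]
      simpa [h0, nextPos_zero] using hcnt _ (H.lt i hi)
    all_goals simp [h0]
  · simp only [splitBody, minReg, bound, cost]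
    omega
  · rintro s' ⟨hf, hcond, m, hiN, -, hend, hinv⟩
    have r5 : s'.reg 5 = N := by rw [hf.1 5 rfl]; simp [h5]
    have : N ≤ s'.reg 7 := by simpa [Op.eval_lt h1w, r5] using hcond
    rw [show s'.reg 7 = N by omega] at hinv
    exact ⟨hinv.level H hS hlev hend, hend⟩

theorem runs_copyProg {w N : ℕ} {s : State} (hw : N + 4 ≤ 2 ^ w) (h5 : s.reg 5 = N) :
    Runs w copyProg s (20 * N + 20) fun s' =>
      (∀ j < N, s'.mem 35 j = s.mem 46 j ∧ s'.mem 36 j = s.mem 47 j) ∧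
        s'.mem 36 N = s.mem 36 N := by
  have h1w : 1 < 2 ^ w := by omega
  have h0 : ∀ s, (const 0).eval w s = 0 := fun s => eval_const (by omega)
  have h1 : ∀ s, (const 1).eval w s = 1 := fun s => eval_const (by omega)
  refine (Runs.seq (n := 2) (m := 20 * N + 18) (Runs.den (Q := (· = _)) rfl rfl) ?_).mono
    (by omega) fun _ h => h
  rintro s₀ - rfl
  refine (Runs.loop (c := copyBody.bound) (m := N) (fun m s' => s'.reg 7 ≤ N ∧
    m = N - s'.reg 7 ∧ s'.mem 36 N = s.mem 36 N ∧
    ∀ j < s'.reg 7, s'.mem 35 j = s.mem 46 j ∧ s'.mem 36 j = s.mem 47 j) ?_ ?_).mono ?_ ?_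
  · rintro m s' hf ⟨hiN, rfl, hend, hcopy⟩ hcond
    have r5 : s'.reg 5 = N := by rw [hf.1 5 rfl]; simp [h5]
    have m46 : s'.mem 46 = s.mem 46 := by rw [hf.2 46 rfl]; simp
    have m47 : s'.mem 47 = s.mem 47 := by rw [hf.2 47 rfl]; simp
    have hlt : s'.reg 7 < N := by simpa [Op.eval_lt h1w, r5] using hcond
    generalize hj : s'.reg 7 = j at *
    have hden : copyBody.den w s' = ((s'.setMem 35 j (s.mem 46 j)).setMem 36 j
        (s.mem 47 j)).setReg 7 (j + 1) := by
      simp (disch := omega) [copyBody, h1, hj, m46, m47, Op.eval_add]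
    refine Runs.den rfl ⟨N - (j + 1), by omega, ?_⟩
    rw [hden]
    refine ⟨by simpa using hlt, by simp, by simp [hlt.ne', hend], fun i hi => ?_⟩
    by_cases hij : i = j
    · simp [hij]
    · simpa [hij] using hcopy i (by simp at hi; omega)
  · simp [h0]
  · simp only [copyBody, bound, cost]
    omega
  · rintro s' ⟨hf, hcond, m, hiN, -, hend, hcopy⟩
    have r5 : s'.reg 5 = N := by rw [hf.1 5 rfl]; simp [h5]
    have : N ≤ s'.reg 7 := by simpa [Op.eval_lt h1w, r5] using hcond
    exact ⟨fun j hj => hcopy j (by omega), hend⟩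

/-! ### Processing one level -/

theorem Level.between_eq {N S top : ℕ} {rank : ℕ → ℕ} {X : ℕ → ℕ → ℕ} {A L : ℕ → ℕ}
    (h : Level N S top rank X A L) (hX : ∀ x y, X x y = X y x) {i j : ℕ} (hi : i < N) (hj : j < N)
    (hij : i ≠ j) (hb : i / S = j / S) : between top L i j = X (A i) (A j) + 1 := by
  rcases lt_or_gt_of_ne hij with h1 | h1
  · rw [between_of_lt h1, h.dist i j h1 hj hb]
  · rw [between_comm, between_of_lt h1, h.dist j i h1 hi hb.symm, hX]

/-- A range that crosses a block boundary contains the zero stored at a block start. This is why one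
scan over the whole list never combines items of different blocks. -/
theorem Level.between_eq_zero {N S top : ℕ} {rank : ℕ → ℕ} {X : ℕ → ℕ → ℕ} {A L : ℕ → ℕ}
    (h : Level N S top rank X A L) {i j : ℕ} (hi : i < N) (hj : j < N)
    (hb : i / S ≠ j / S) : between top L i j = 0 := by
  have key : ∀ i j, i < j → j < N → i / S ≠ j / S → rangeMin top L (i + 1) (j + 1) = 0 := by
    intro i j hij hj hb
    have h1 : j / S * S ≤ j := Nat.div_mul_le_self j S
    have h2 : i < j / S * S := by
      by_contra h2
      refine hb (le_antisymm (Nat.div_le_div_right hij.le) ?_)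
      rcases Nat.eq_zero_or_pos S with rfl | hS
      · simp
      · exact (Nat.le_div_iff_mul_le hS).mpr (not_lt.mp h2)
    have h3 := h.start (j / S * S) (by omega) (Nat.mul_mod_left _ _)
    have h4 : rangeMin top L (i + 1) (j + 1) ≤ L (j / S * S) := rangeMin_le h2 (by omega)
    omega
  rcases lt_trichotomy i j with h1 | h1 | h1
  · rw [between_of_lt h1, key i j h1 hj hb]
  · exact absurd (by rw [h1]) hb
  · rw [between_comm, between_of_lt h1, key j i h1 hi hb.symm]

theorem Ordered.min_le {N S B top : ℕ} {X : ℕ → ℕ → ℕ} {ord l rank V : ℕ → ℕ}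
    (h : Ordered N X top ord l rank) (hX : ∀ x y, X x y = X y x) (hV : MidVals S B N top l V)
    (hS : S = 2 * B) (hB : 0 < B) {x y : ℕ} (hx : x < N) (hy : y < N) (hxy : x ≠ y)
    (hb : rank x / S = rank y / S) :
    min (V (rank x)) (V (rank y)) ≤ X x y + 1 ∧
      (rank x / B ≠ rank y / B → min (V (rank x)) (V (rank y)) = X x y + 1) := by
  have key : ∀ x y, x < N → y < N → rank x < rank y → rank x / S = rank y / S →
      min (V (rank x)) (V (rank y)) ≤ X x y + 1 ∧
        (rank x / B ≠ rank y / B → min (V (rank x)) (V (rank y)) = X x y + 1) := by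
    intro x y hx hy hlt hb
    obtain ⟨-, hox⟩ := h.rank_lt x hx
    obtain ⟨hry, hoy⟩ := h.rank_lt y hy
    have := hV.le hS hB hlt hry hb
    rwa [h.out _ _ hlt hry, hox, hoy] at this
  rcases lt_trichotomy (rank x) (rank y) with h1 | h1 | h1
  · exact key x y hx hy h1 hb
  · refine absurd ?_ hxy
    rw [← (h.rank_lt x hx).2, ← (h.rank_lt y hy).2, h1]
  · have := key y x hy hx h1 hb.symm
    rw [min_comm, hX x y]
    exact ⟨this.1, fun h2 => this.2 h2.symm⟩

/-- Handle all pairs that are separated when the blocks are split. -/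
def levelBody : Prog :=
  assign 16 (op .div (reg 15) (const 2)) ;; upProg ;; downProg ;; scanProg ;; splitProg ;;
    copyProg ;; assign 15 (reg 16)

/-- The state between two levels. -/
structure LevelState (w N nP U S : ℕ) (X₁ X₂ : ℕ → ℕ → ℕ) (s : State) : Prop where
  fits : s.Fits w
  reg3 : s.reg 3 = nP
  reg5 : s.reg 5 = N
  reg6 : s.reg 6 = 2 ^ w - 1
  reg15 : s.reg 15 = S
  ordered : Ordered N X₁ (2 ^ w - 1) (s.mem 25) (s.mem 26) (s.mem 27)
  level : Level N S (2 ^ w - 1) (s.mem 27) X₂ (s.mem 35) (s.mem 36)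
  zero : s.mem 47 N = 0
  ans_le : s.reg 17 ≤ U
  le_ans : ∀ x < nP, ∀ y, nP ≤ y → y < N → s.mem 27 x / S ≠ s.mem 27 y / S →
    X₁ x y + X₂ x y + 2 ≤ s.reg 17

/-- Pairs separated by the new halves receive their exact value in the scan. Unseparated pairs are
at most underestimated, so the bound `U` survives, and the bounds for previously separated pairs
persist because register 17 never decreases. -/
theorem runs_levelBody {w N nP U S B : ℕ} {X₁ X₂ : ℕ → ℕ → ℕ} {s : State} (hw : N + 4 ≤ 2 ^ w)
    (hUw : U < 2 ^ w) (hnP : nP ≤ N) (hX₁ : ∀ x y, X₁ x y = X₁ y x)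
    (hX₂ : ∀ x y, X₂ x y = X₂ y x)
    (hU : ∀ x < nP, ∀ y, nP ≤ y → y < N → X₁ x y + X₂ x y + 2 ≤ U) (hS : S = 2 * B) (hB : 0 < B)
    (I : LevelState w N nP U S X₁ X₂ s) :
    Runs w levelBody s (620 * N + 140) fun s' => LevelState w N nP U B X₁ X₂ s' := by
  have h1w : 1 < 2 ^ w := by omega
  have h2 : ∀ s, (const 2).eval w s = 2 := fun s => eval_const (by omega)
  have hSw : S < 2 ^ w := I.reg15 ▸ I.fits.1 15
  have hinj : ∀ x < N, ∀ y < N, s.mem 27 x = s.mem 27 y → x = y := fun x hx y hy e => by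
    rw [← (I.ordered.rank_lt x hx).2, ← (I.ordered.rank_lt y hy).2, e]
  refine (Runs.seq (n := 4) (m := 620 * N + 136) (Runs.den (Q := (· = _)) rfl rfl) ?_).mono
    (by omega) fun _ h => h
  rintro s₀ - hs₀
  have hd : s₀ = s.setReg 16 B := by
    rw [hs₀]
    simp (disch := omega) [h2, I.reg15, Op.eval_div, hS]
  have f₀ : s₀.Fits w := by
    rw [hd]
    refine ⟨fun r => ?_, I.fits.2⟩
    rw [State.reg_setReg]
    split_ifs
    · omega
    · exact I.fits.1 r
  have q3 : s₀.reg 3 = nP := by simp [hd, I.reg3]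
  have q5 : s₀.reg 5 = N := by simp [hd, I.reg5]
  have q6 : s₀.reg 6 = 2 ^ w - 1 := by simp [hd, I.reg6]
  have q15 : s₀.reg 15 = S := by simp [hd, I.reg15]
  have q16 : s₀.reg 16 = B := by simp [hd]
  have q17 : s₀.reg 17 = s.reg 17 := by simp [hd]
  have qm : s₀.mem = s.mem := by simp [hd]
  clear hs₀ hd
  refine (Runs.seq (n := 60 * N + 20) (m := 560 * N + 116)
    (runs_upProg hw q5 q6 q15 q16 hS hB).fits ?_).mono (by omega) fun _ h => h
  rintro s₁ g₁ ⟨f₁, hup, hcnt⟩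
  replace f₁ := f₁ f₀
  refine (Runs.seq (n := 60 * N + 20) (m := 500 * N + 96)
    (runs_downProg hw ((g₁.1 5 rfl).trans q5) ((g₁.1 6 rfl).trans q6) ((g₁.1 15 rfl).trans q15)
      ((g₁.1 16 rfl).trans q16) hS hB (by omega) (fun j => f₁.2 _ _) ?_ ?_).fits ?_).mono
      (by omega) fun _ h => h
  · rw [g₁.2 26 rfl, qm]
    exact I.ordered.l_beyond
  · rw [g₁.2 26 rfl]
    exact hup
  rintro s₂ g₂ ⟨f₂, hV⟩
  replace f₂ := f₂ f₁
  have k27 : s₂.mem 27 = s.mem 27 := by rw [g₂.2 27 rfl, g₁.2 27 rfl, qm]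
  have k26 : s₁.mem 26 = s.mem 26 := by rw [g₁.2 26 rfl, qm]
  have k35 : s₂.mem 35 = s.mem 35 := by rw [g₂.2 35 rfl, g₁.2 35 rfl, qm]
  have k36 : s₂.mem 36 = s.mem 36 := by rw [g₂.2 36 rfl, g₁.2 36 rfl, qm]
  have k47 : s₂.mem 47 = s.mem 47 := by rw [g₂.2 47 rfl, g₁.2 47 rfl, qm]
  have p3 : s₂.reg 3 = nP := by rw [g₂.1 3 rfl, g₁.1 3 rfl, q3]
  have p17 : s₂.reg 17 = s.reg 17 := by rw [g₂.1 17 rfl, g₁.1 17 rfl, q17]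
  rw [k26] at hV
  have hlevel := I.level
  -- the value of a pair of positions
  have hval : ∀ i < N, ∀ i' < N, i ≠ i' → s.mem 35 i < nP → ¬ s.mem 35 i' < nP →
      i / S = i' / S →
      between (2 ^ w - 1) (s.mem 36) i i' = X₂ (s.mem 35 i) (s.mem 35 i') + 1 ∧
      min (valP nP (s₂.mem 40) (s.mem 27) (s.mem 35) i)
        (valQ nP (s₂.mem 40) (s.mem 27) (s.mem 35) i') ≤ X₁ (s.mem 35 i) (s.mem 35 i') + 1 ∧
      (s.mem 27 (s.mem 35 i) / B ≠ s.mem 27 (s.mem 35 i') / B →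
        min (valP nP (s₂.mem 40) (s.mem 27) (s.mem 35) i)
        (valQ nP (s₂.mem 40) (s.mem 27) (s.mem 35) i') = X₁ (s.mem 35 i) (s.mem 35 i') + 1) := by
    intro i hi i' hi' hne hc hc' hb
    refine ⟨hlevel.between_eq hX₂ hi hi' hne hb, ?_⟩
    rw [valP, valQ, if_pos hc, if_neg hc']
    exact I.ordered.min_le hX₁ hV hS hB (hlevel.A_lt i hi) (hlevel.A_lt i' hi')
      (fun e => hc' (e ▸ hc)) (by rw [hlevel.block i hi, hlevel.block i' hi', hb])
  refine (Runs.seq (n := 400 * N + 40) (m := 100 * N + 56)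
    (runs_scanProg (U := U) hw hUw (by rw [g₂.1 5 rfl, g₁.1 5 rfl, q5])
      (fun i => by have := f₂.2 36 i; omega)
      (by rw [k36, hlevel.L_end]) (by rw [p17]; exact I.ans_le) rfl rfl ?_).fits ?_).mono
      (by omega) fun _ h => h
  · rw [p3, k27, k35, k36]
    intro i hi i' hi' hne hb hpos
    have hc : s.mem 35 i < nP := by
      by_contra hc
      simp [valP, hc] at hpos
    have hc' : ¬ s.mem 35 i' < nP := by
      intro hc'
      simp [valQ, hc'] at hpos
    have hbl : i / S = i' / S := by
      by_contra hbl
      rw [hlevel.between_eq_zero hi hi' hbl] at hb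
      omega
    obtain ⟨h3, h4, -⟩ := hval i hi i' hi' hne hc hc' hbl
    have := hU _ hc _ (not_lt.mp hc') (hlevel.A_lt i' hi')
    omega
  rintro s₃ g₃ ⟨f₃, ha1, ha2, ha3⟩
  replace f₃ := f₃ f₂
  rw [p17] at ha1
  rw [p3, k27, k35, k36] at ha3
  have j27 : s₃.mem 27 = s.mem 27 := by rw [g₃.2 27 rfl, k27]
  have j35 : s₃.mem 35 = s.mem 35 := by rw [g₃.2 35 rfl, k35]
  have j36 : s₃.mem 36 = s.mem 36 := by rw [g₃.2 36 rfl, k36]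
  have j47 : s₃.mem 47 = s.mem 47 := by rw [g₃.2 47 rfl, k47]
  refine (Runs.seq (n := 80 * N + 20) (m := 20 * N + 36)
    (runs_splitProg (X := X₂) (S := S) (B := B) hw f₃
      (by rw [g₃.1 5 rfl, g₂.1 5 rfl, g₁.1 5 rfl, q5])
      (by rw [g₃.1 6 rfl, g₂.1 6 rfl, g₁.1 6 rfl, q6])
      (by rw [g₃.1 16 rfl, g₂.1 16 rfl, g₁.1 16 rfl, q16]) hS hB
      (by rw [j27]; exact fun x hx => (I.ordered.rank_lt x hx).1) (by rw [j27]; exact hinj)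
      (by rw [g₃.2 41 rfl, g₂.2 41 rfl]; exact hcnt) (by rw [j47, I.zero])
      (by rw [j27, j35, j36]; exact hlevel)).fits ?_).mono
      (by omega) fun _ h => h
  rintro s₄ g₄ ⟨f₄, hl₄, hz₄⟩
  replace f₄ := f₄ f₃
  refine (Runs.seq (n := 20 * N + 20) (m := 2)
    (runs_copyProg hw (by rw [g₄.1 5 rfl, g₃.1 5 rfl, g₂.1 5 rfl, g₁.1 5 rfl, q5])).fits ?_).mono
      (by omega) fun _ h => h
  rintro s₅ g₅ ⟨f₅, hcopy, hend⟩
  replace f₅ := f₅ f₄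
  have i27 : s₅.mem 27 = s.mem 27 := by rw [g₅.2 27 rfl, g₄.2 27 rfl, j27]
  have i17 : s₅.reg 17 = s₃.reg 17 := by rw [g₅.1 17 rfl, g₄.1 17 rfl]
  refine Runs.den rfl ?_
  have e16 : s₅.reg 16 = B := by
    rw [g₅.1 16 rfl, g₄.1 16 rfl, g₃.1 16 rfl, g₂.1 16 rfl, g₁.1 16 rfl, q16]
  have hde : (assign 15 (reg 16)).den w s₅ = s₅.setReg 15 B := by simp [e16]
  rw [hde]
  refine ⟨?_, ?_, ?_, ?_, ?_, ?_, ?_, ?_, ?_, ?_⟩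
  · refine ⟨fun r => ?_, f₅.2⟩
    rw [State.reg_setReg]
    split_ifs
    · omega
    · exact f₅.1 r
  · simp [g₅.1 3 rfl, g₄.1 3 rfl, g₃.1 3 rfl, p3]
  · simp [g₅.1 5 rfl, g₄.1 5 rfl, g₃.1 5 rfl, g₂.1 5 rfl, g₁.1 5 rfl, q5]
  · simp [g₅.1 6 rfl, g₄.1 6 rfl, g₃.1 6 rfl, g₂.1 6 rfl, g₁.1 6 rfl, q6]
  · simp
  · rw [State.mem_setReg, i27, g₅.2 26 rfl, g₄.2 26 rfl, g₃.2 26 rfl, g₂.2 26 rfl, k26,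
      g₅.2 25 rfl, g₄.2 25 rfl, g₃.2 25 rfl, g₂.2 25 rfl, g₁.2 25 rfl, qm]
    exact I.ordered
  · rw [State.mem_setReg, i27, ← j27]
    refine hl₄.congr (fun j hj => (hcopy j hj).1) fun j hj => ?_
    rcases hj.eq_or_lt with rfl | hj
    · rw [hend, g₄.2 36 rfl, j36, hlevel.L_end, hz₄]
    · exact (hcopy j hj).2
  · rw [State.mem_setReg, g₅.2 47 rfl, hz₄]
  · rw [State.reg_setReg, if_neg (by omega), i17]
    exact ha2
  · rw [State.mem_setReg, State.reg_setReg, if_neg (by omega), i17, i27]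
    intro x hx y hy hyN hne
    -- Either the pair shared a block until now and the scan has handled it, or an earlier level
    -- did.
    by_cases hb : s.mem 27 x / S = s.mem 27 y / S
    · obtain ⟨i, hi, rfl⟩ := hlevel.exists_pos (show x < N by omega)
      obtain ⟨i', hi', rfl⟩ := hlevel.exists_pos hyN
      have hii : i ≠ i' := by rintro rfl; omega
      rw [hlevel.block i hi, hlevel.block i' hi'] at hb
      obtain ⟨h3, -, h5⟩ := hval i hi i' hi' hii hx (not_lt.mpr hy) hb
      have := ha3 i hi i' hi' hii (by omega) (by rw [h5 hne]; omega)
      rw [h3, h5 hne] at this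
      omega
    · exact (I.le_ans x hx y hy hyN hb).trans ha1

/-! ### All levels -/

/-- For `N ≤ S` there is a single block, so the complete second order is a valid starting level
whatever the ranks of the first order are. -/
theorem Ordered.level {N S top : ℕ} {X : ℕ → ℕ → ℕ} {ord l rank rank' : ℕ → ℕ}
    (h : Ordered N X top ord l rank) (hrank : ∀ x < N, rank' x < N) (hS : N ≤ S) :
    Level N S top rank' X ord l := by
  refine ⟨fun j hj => (h.ord_lt j hj).1, fun i hi j hj e => ?_, fun j hj => ?_, fun j hj h0 => ?_,
    fun i j hij hj _ => h.out i j hij hj, h.l_beyond N le_rfl⟩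
  · rw [← (h.ord_lt i hi).2, ← (h.ord_lt j hj).2, e]
  · have := hrank _ (h.ord_lt j hj).1
    rw [Nat.div_eq_of_lt (by omega), Nat.div_eq_of_lt (by omega)]
  · rw [Nat.mod_eq_of_lt (by omega)] at h0
    rw [h0, h.l_zero]

/-- Store the least power of two that is at least register 5 in register 15. -/
def blockSizeProg : Prog :=
  assign 15 (const 1) ;; loop (op .lt (reg 15) (reg 5)) (assign 15 (op .add (reg 15) (reg 15)))

theorem runs_blockSizeProg {w N : ℕ} {s : State} (hw : 2 * N + 4 ≤ 2 ^ w) (hN : 0 < N)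
    (h5 : s.reg 5 = N) :
    Runs w blockSizeProg s (8 * N + 8) fun s' =>
      ∃ k, s'.reg 15 = 2 ^ k ∧ N ≤ 2 ^ k ∧ 2 ^ k < 2 * N := by
  have h1w : 1 < 2 ^ w := by omega
  have h1 : ∀ s, (const 1).eval w s = 1 := fun s => eval_const (by omega)
  refine (Runs.seq (n := 2) (m := 8 * N + 6) (Runs.den (Q := (· = _)) rfl rfl) ?_).mono
    (by omega) fun _ h => h
  rintro s₀ - rfl
  -- Doubling stops after logarithmically many rounds, but this linear measure is good enough for
  -- the time bound.
  refine (Runs.loop (c := 4) (m := N - 1) (fun m s' => m = N - s'.reg 15 ∧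
    ∃ k, s'.reg 15 = 2 ^ k ∧ 2 ^ k < 2 * N) ?_ ?_).mono ?_ ?_
  · rintro m s' hf ⟨rfl, k, hk, hkN⟩ hcond
    have r5 : s'.reg 5 = N := by rw [hf.1 5 rfl]; simp [h5]
    have hlt : 2 ^ k < N := by simpa [Op.eval_lt h1w, hk, r5] using hcond
    have hpos : 0 < 2 ^ k := by positivity
    refine (Runs.den rfl ⟨N - 2 ^ (k + 1), ?_, ?_⟩).mono le_rfl fun _ h => h
    · rw [hk, pow_succ]; omega
    · have hd : (assign 15 (op .add (reg 15) (reg 15))).den w s' = s'.setReg 15 (2 ^ (k + 1)) := by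
        simp (disch := omega) [hk, Op.eval_add, pow_succ, mul_two]
      rw [hd]
      refine ⟨by simp, k + 1, by simp, by rw [pow_succ]; omega⟩
  · refine ⟨by simp [h1], 0, by simp [h1], by omega⟩
  · simp only [cost]
    omega
  · rintro s' ⟨hf, hcond, m, -, k, hk, hkN⟩
    have r5 : s'.reg 5 = N := by rw [hf.1 5 rfl]; simp [h5]
    exact ⟨k, hk, by simpa [Op.eval_lt h1w, hk, r5] using hcond, hkN⟩

/-- Combine the two orders. -/
def levelsProg : Prog :=
  blockSizeProg ;; assign 17 (const 0) ;; loop (op .lt (const 1) (reg 15)) levelBody ;;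
    assign 0 (op .sub (reg 17) (const 2))

theorem runs_levelsProg {w N nP U : ℕ} {X₁ X₂ : ℕ → ℕ → ℕ} {s : State} (hw : 2 * N + 4 ≤ 2 ^ w)
    (hUw : U < 2 ^ w) (hnP0 : 0 < nP) (hnP : nP < N) (hX₁ : ∀ x y, X₁ x y = X₁ y x)
    (hX₂ : ∀ x y, X₂ x y = X₂ y x)
    (hU : ∀ x < nP, ∀ y, nP ≤ y → y < N → X₁ x y + X₂ x y + 2 ≤ U)
    (hfit : s.Fits w) (h3 : s.reg 3 = nP) (h5 : s.reg 5 = N) (h6 : s.reg 6 = 2 ^ w - 1)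
    (hord₁ : Ordered N X₁ (2 ^ w - 1) (s.mem 25) (s.mem 26) (s.mem 27))
    (hord₂ : Ordered N X₂ (2 ^ w - 1) (s.mem 35) (s.mem 36) (s.mem 37))
    (h47 : s.mem 47 N = 0) :
    Runs w levelsProg s (8 * N + 40 + (Nat.log 2 N + 1) * (620 * N + 150)) fun s' =>
      s'.reg 0 + 2 ≤ U ∧ ∀ x < nP, ∀ y, nP ≤ y → y < N → X₁ x y + X₂ x y ≤ s'.reg 0 := by
  have h1w : 1 < 2 ^ w := by omega
  have h0 : ∀ s, (const 0).eval w s = 0 := fun s => eval_const (by omega)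
  have h1 : ∀ s, (const 1).eval w s = 1 := fun s => eval_const (by omega)
  have h2 : ∀ s, (const 2).eval w s = 2 := fun s => eval_const (by omega)
  refine (Runs.seq (n := 8 * N + 8) (m := 32 + (Nat.log 2 N + 1) * (620 * N + 150))
    (runs_blockSizeProg hw (by omega) h5).fits ?_).mono (by omega) fun _ h => h
  rintro s₁ g₁ ⟨f₁, k, hk, hk1, hk2⟩
  replace f₁ := f₁ hfit
  refine (Runs.seq (n := 2) (m := 30 + (Nat.log 2 N + 1) * (620 * N + 150))
    (Runs.den (Q := (· = _)) rfl rfl).fits ?_).mono (by omega) fun _ h => h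
  rintro s₂ - ⟨f₂, hs₂⟩
  replace f₂ := f₂ f₁
  have init : LevelState w N nP U (2 ^ k) X₁ X₂ s₂ := by
    have hrank : ∀ x < N, s.mem 27 x < N := fun x hx => (hord₁.rank_lt x hx).1
    refine ⟨f₂, ?_, ?_, ?_, ?_, ?_, ?_, ?_, ?_, ?_⟩
    · simp [hs₂, g₁.1 3 rfl, h3]
    · simp [hs₂, g₁.1 5 rfl, h5]
    · simp [hs₂, g₁.1 6 rfl, h6]
    · simp [hs₂, hk]
    · simpa [hs₂, g₁.2 25 rfl, g₁.2 26 rfl, g₁.2 27 rfl] using hord₁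
    · simpa [hs₂, g₁.2 27 rfl, g₁.2 35 rfl, g₁.2 36 rfl] using hord₂.level hrank hk1
    · simp [hs₂, g₁.2 47 rfl, h47]
    · simp [hs₂, h0]
    · intro x hx y _ hyN hne
      refine absurd ?_ hne
      have := hrank x (by omega)
      have := hrank y hyN
      simp only [hs₂, den_assign, State.mem_setReg, g₁.2 27 rfl]
      rw [Nat.div_eq_of_lt (by omega), Nat.div_eq_of_lt (by omega)]
  have hklog : k ≤ Nat.log 2 N + 1 := by
    rcases k with _ | k
    · omega
    · have : k ≤ Nat.log 2 N := Nat.le_log_of_pow_le (by omega) (by rw [pow_succ] at hk2; omega)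
      omega
  refine (Runs.seq (n := k * (620 * N + 150) + 4) (m := 4)
    ((Runs.loop (c := 620 * N + 140) (m := k) (fun m s' => LevelState w N nP U (2 ^ m) X₁ X₂ s')
      ?_ init).mono (n' := k * (620 * N + 150) + 4) ?_ fun _ h => h) ?_).mono ?_ fun _ h => h
  · rintro m s' - I hc
    rcases m with _ | m
    · simp [Op.eval_lt h1w, h1, I.reg15] at hc
    · exact (runs_levelBody (by omega) hUw hnP.le hX₁ hX₂ hU (by rw [pow_succ]; ring)
        (by positivity) I).mono le_rfl fun s'' h => ⟨m, Nat.lt_succ_self m, h⟩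
  · simp only [cost]
    have : k * (620 * N + 140 + (1 + 1 + 1) + 1) ≤ k * (620 * N + 150) := Nat.mul_le_mul_left _ (by omega)
    omega
  · rintro s₃ - ⟨-, hc, m, I⟩
    have hm : m = 0 := by
      rcases m with _ | m
      · rfl
      · exfalso
        have h3 : 1 < 2 ^ (m + 1) := Nat.one_lt_two_pow (by omega)
        simp [Op.eval_lt h1w, h1, I.reg15, h3] at hc
    subst hm
    -- With blocks of size one, different items have different ranks and are therefore separated.
    have hans : ∀ x < nP, ∀ y, nP ≤ y → y < N → X₁ x y + X₂ x y + 2 ≤ s₃.reg 17 := by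
      intro x hx y hy hyN
      refine I.le_ans x hx y hy hyN ?_
      rw [pow_zero, Nat.div_one, Nat.div_one]
      intro e
      have := (I.ordered.rank_lt x (by omega)).2
      rw [e, (I.ordered.rank_lt y hyN).2] at this
      omega
    -- There is at least one pair, so subtracting the two added units does not wrap around.
    have hans2 : 2 ≤ s₃.reg 17 := by
      have := hans 0 hnP0 nP le_rfl hnP
      omega
    have hU' := I.ans_le
    refine (Runs.den rfl ?_).mono (n := 4) le_rfl fun _ h => h
    simp (disch := omega) only [den_assign, eval_op, eval_reg, h2, Op.eval_sub, State.reg_setReg,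
      if_true]
    refine ⟨by omega, fun x hx y hy hyN => ?_⟩
    have := hans x hx y hy hyN
    omega
  · have : k * (620 * N + 150) ≤ (Nat.log 2 N + 1) * (620 * N + 150) :=
      Nat.mul_le_mul_right _ hklog
    omega

/-! ### The complete program -/

/-- Order the items by the positions of their keys in the trie. -/
def sortProg (a b o : ℕ) : Prog := bucketProg a b o ;; searchProg o

theorem writesMem_sortProg {a b o x : ℕ} (h : x < o + 20 ∨ o + 30 ≤ x) :
    (sortProg a b o).writesMem x = false := by
  simp [sortProg, bucketProg, bucketBody, searchProg, searchInit, searchBody, emitProg, pushProg,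
    popProg, minReg, writesMem]
  omega

theorem runs_sortProg {w n root N a b o : ℕ} {str : ℕ → Str} {ch : ℕ → List ℕ} {pd : ℕ → ℕ}
    {s : State} (hT : TrieView n root str ch pd) (hM : TrieMem w n root str ch s) (ha : a < 20)
    (hb : b < 20) (hw : N + 4 ≤ 2 ^ w) (hN : 0 < N) (h5 : s.reg 5 = N)
    (hkey : ∀ x < N, itemKey s a b x < n) (hzero : ∀ x, o + 20 ≤ x → x < o + 30 → s.mem x = 0) :
    Runs w (sortProg a b o) s (240 * N + 200 * n + 210) fun s' =>
      Ordered N (fun x y => LCP (str (itemKey s a b x)) (str (itemKey s a b y))) (2 ^ w - 1)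
        (s'.mem (o + 25)) (s'.mem (o + 26)) (s'.mem (o + 27)) := by
  refine (Runs.seq (runs_bucketProg ha hb (by omega) h5 fun v => ?_)
    fun s' hf hbucket => runs_searchProg hT (hM.congr (hf.1 0 rfl) (hf.1 1 rfl) fun x hx =>
      hf.2 x ?_) hw hkey hN (fun u _ => hbucket u) (fun v => ?_) fun v => ?_).mono
    (by omega) fun _ h => h
  · rw [hzero _ (by omega) (by omega)]; rfl
  · simp [bucketProg, bucketBody, writesMem]; omega
  · rw [hf.2 _ (by simp [bucketProg, bucketBody, writesMem]), hzero _ (by omega) (by omega)]; rfl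
  · rw [hf.2 _ (by simp [bucketProg, bucketBody, writesMem]), hzero _ (by omega) (by omega)]; rfl

/-- Compute `maxPairLCP`. -/
def maxPairProg : Prog :=
  -- The difference `0 - 1` wraps around to `2 ^ w - 1`, the neutral element for minima.
  assign 5 (op .add (reg 3) (reg 4)) ;; assign 6 (op .sub (const 0) (const 1)) ;;
    -- The offsets place the two orders in arrays 20–29 and 30–39. The second order, in arrays 35
    -- and 36, directly serves as the initial listing of the levels.
    sortProg 7 9 0 ;; sortProg 8 10 10 ;; levelsProg

theorem getD_ofFn {α : Type*} {n i : ℕ} (f : Fin n → α) (d : α) (h : i < n) :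
    (List.ofFn f).getD i d = f ⟨i, h⟩ := by
  simp [List.getD, h]

theorem chain_encodePtr {n : ℕ} {next : Fin n → Option (Fin n)} {p : Option (Fin n)}
    {l : List (Fin n)} (h : IsLinked next p l) :
    Chain ((List.ofFn fun v => encodePtr (next v)).getD · 0) n (encodePtr p) (l.map Fin.val) := by
  induction l generalizing p with
  | nil => rw [show p = none from h]; rfl
  | cons x l ih =>
    obtain ⟨rfl, h⟩ := h
    refine ⟨rfl, x.2.ne, ?_⟩
    simpa only [getD_ofFn _ _ x.2] using ih h

/-! ### Correctness on encoded inputs and the total cost -/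

section Input

variable {F : Finset Str} {P Q : Finset (Str × Str)} (T : CompactedTrie F)
  (LP : PairListing T P) (LQ : PairListing T Q) {w : ℕ}

theorem CompactedTrie.length_nodeStr_le {v : ℕ} (hv : v < T.size) :
    (T.nodeStr v).length ≤ F.sup List.length := by
  by_cases h : T.nodeStr v = []
  · simp [h]
  · obtain ⟨U, hU, hp⟩ := (T.isNode_nodeStr hv).exists_prefix h
    exact hp.length_le.trans (Finset.le_sup (f := List.length) hU)

theorem trieMem_inputState (hfit : (inputState T LP LQ).Fits w)
    (hlen : F.sup List.length + 1 < 2 ^ w) :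
    TrieMem w T.size T.root T.nodeStr T.childList (inputState T LP LQ) where
  reg_size := rfl
  reg_root := rfl
  size_lt := hfit.1 0
  chain u hu := by
    have h := chain_encodePtr (T.children ⟨u, hu⟩).choose_spec.1
    have e : (inputState T LP LQ).mem 0 u = encodePtr (T.firstChild ⟨u, hu⟩) :=
      getD_ofFn _ _ hu
    rw [e]
    simp only [CompactedTrie.childList, hu, dite_true]
    exact h
  stop_lt v := hfit.2 5 v
  depth u hu v hv := by
    obtain ⟨hv, hc⟩ := (T.mem_childList (u := ⟨u, hu⟩)).mp hv
    have e4 : (inputState T LP LQ).mem 4 v = T.labelStart ⟨v, hv⟩ := getD_ofFn _ _ hv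
    have e5 : (inputState T LP LQ).mem 5 v = T.labelStop ⟨v, hv⟩ := getD_ofFn _ _ hv
    have eu : T.nodeStr u = T.node ⟨u, hu⟩ := T.nodeStr_val ⟨u, hu⟩
    have ev : T.nodeStr v = T.node ⟨v, hv⟩ := T.nodeStr_val ⟨v, hv⟩
    rw [ev] at hc
    have h1 := T.labelStop_le _ _ hc
    have h2 := congrArg List.length (T.label_spec _ _ hc)
    rw [e4, e5, eu, ev]
    refine ⟨h1.1, ?_⟩
    rw [h2, List.length_append, List.length_take, List.length_drop]
    omega
  depth_lt u hu := by
    have := T.length_nodeStr_le hu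
    omega

/-- The nodes of the first strings of the pairs. -/
def fstKey (x : ℕ) : ℕ := itemKey (inputState T LP LQ) 7 9 x

/-- The nodes of the second strings of the pairs. -/
def sndKey (x : ℕ) : ℕ := itemKey (inputState T LP LQ) 8 10 x

theorem keys_of_lt {x : ℕ} (h : x < P.card) :
    fstKey T LP LQ x = LP.fst ⟨x, h⟩ ∧ sndKey T LP LQ x = LP.snd ⟨x, h⟩ := by
  have h' : x < (inputState T LP LQ).reg 3 := h
  simp only [fstKey, sndKey, itemKey, h', if_true]
  exact ⟨getD_ofFn _ _ h, getD_ofFn _ _ h⟩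

theorem keys_of_le {x : ℕ} (h : P.card ≤ x) (h' : x - P.card < Q.card) :
    fstKey T LP LQ x = LQ.fst ⟨_, h'⟩ ∧ sndKey T LP LQ x = LQ.snd ⟨_, h'⟩ := by
  have h'' : ¬ x < (inputState T LP LQ).reg 3 := not_lt.mpr h
  simp only [fstKey, sndKey, itemKey, h'', if_false]
  exact ⟨getD_ofFn _ _ h', getD_ofFn _ _ h'⟩

theorem keys_lt {x : ℕ} (h : x < P.card + Q.card) :
    fstKey T LP LQ x < T.size ∧ sndKey T LP LQ x < T.size := by
  rcases lt_or_ge x P.card with h' | h'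
  · rw [(keys_of_lt T LP LQ h').1, (keys_of_lt T LP LQ h').2]
    exact ⟨Fin.is_lt _, Fin.is_lt _⟩
  · have := keys_of_le T LP LQ h' (by omega)
    rw [this.1, this.2]
    exact ⟨Fin.is_lt _, Fin.is_lt _⟩

/-- The sum of the longest common prefixes of the pairs `x` and `y`. -/
def itemLCP (x y : ℕ) : ℕ :=
  LCP (T.nodeStr (fstKey T LP LQ x)) (T.nodeStr (fstKey T LP LQ y)) +
    LCP (T.nodeStr (sndKey T LP LQ x)) (T.nodeStr (sndKey T LP LQ y))

theorem itemLCP_eq {x y : ℕ} (hx : x < P.card) (hy : P.card ≤ y) (hy' : y - P.card < Q.card) :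
    itemLCP T LP LQ x y =
      LCP (T.node (LP.fst ⟨x, hx⟩)) (T.node (LQ.fst ⟨_, hy'⟩)) +
        LCP (T.node (LP.snd ⟨x, hx⟩)) (T.node (LQ.snd ⟨_, hy'⟩)) := by
  simp only [itemLCP, keys_of_lt T LP LQ hx, keys_of_le T LP LQ hy hy', T.nodeStr_val]

theorem itemLCP_le {x y : ℕ} (hx : x < P.card) (hy : P.card ≤ y) (hy' : y < P.card + Q.card) :
    itemLCP T LP LQ x y ≤ maxPairLCP P Q := by
  rw [itemLCP_eq T LP LQ hx hy (by omega)]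
  have hp := (LP.mem_iff _).mpr ⟨⟨x, hx⟩, rfl⟩
  have hq := (LQ.mem_iff _).mpr ⟨⟨y - P.card, by omega⟩, rfl⟩
  have hpq := Finset.mem_product (p := (_, _)).mpr ⟨hp, hq⟩
  exact Finset.le_sup (f := fun x : (Str × Str) × Str × Str => LCP x.1.1 x.2.1 + LCP x.1.2 x.2.2)
    hpq

theorem maxPairLCP_le {m : ℕ}
    (h : ∀ x < P.card, ∀ y, P.card ≤ y → y < P.card + Q.card → itemLCP T LP LQ x y ≤ m) :
    maxPairLCP P Q ≤ m := by
  refine Finset.sup_le fun z hz => ?_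
  obtain ⟨hp, hq⟩ := Finset.mem_product.mp hz
  obtain ⟨⟨i, hi⟩, hp⟩ := (LP.mem_iff _).mp hp
  obtain ⟨⟨j, hj⟩, hq⟩ := (LQ.mem_iff _).mp hq
  have := h i hi (P.card + j) (by omega) (by omega)
  rw [itemLCP_eq T LP LQ hi (by omega) (by omega)] at this
  simp only [Nat.add_sub_cancel_left] at this
  rw [← hp, ← hq]
  exact this

/-- Ensures that the answer, together with the two added units, fits into a word. -/
theorem maxPairLCP_le_two_mul (T : CompactedTrie F) (LP : PairListing T P)
    (LQ : PairListing T Q) : maxPairLCP P Q ≤ 2 * F.sup List.length := by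
  refine maxPairLCP_le T LP LQ fun x hx y hy hy' => ?_
  have hk := keys_lt T LP LQ (x := x) (by omega)
  have h1 := (LCP_le_left _ (T.nodeStr (fstKey T LP LQ y))).trans (T.length_nodeStr_le hk.1)
  have h2 := (LCP_le_left _ (T.nodeStr (sndKey T LP LQ y))).trans (T.length_nodeStr_le hk.2)
  unfold itemLCP
  omega

theorem runs_maxPairProg (hP : 0 < P.card) (hQ : 0 < Q.card)
    (hfit : (inputState T LP LQ).Fits w)
    (hw : 2 * (P.card + Q.card) + 2 * F.sup List.length + 4 ≤ 2 ^ w) :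
    Runs w maxPairProg (inputState T LP LQ)
      (500 * (P.card + Q.card) + 400 * T.size + 500 +
        (Nat.log 2 (P.card + Q.card) + 1) * (620 * (P.card + Q.card) + 150))
      fun s => s.reg 0 = maxPairLCP P Q := by
  have h0 : ∀ s, (const 0).eval w s = 0 := fun s => eval_const (by omega)
  have h1 : ∀ s, (const 1).eval w s = 1 := fun s => eval_const (by omega)
  have hM := trieMem_inputState T LP LQ hfit (by omega)
  have hzero : ∀ a, 11 ≤ a → (inputState T LP LQ).mem a = 0 := by
    intro a ha
    funext i
    obtain ⟨b, rfl⟩ := Nat.exists_eq_add_of_le' ha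
    rfl
  obtain ⟨N, hN⟩ : ∃ N, N = P.card + Q.card := ⟨_, rfl⟩
  rw [← hN] at hw ⊢
  have hmax := maxPairLCP_le_two_mul T LP LQ
  refine (Runs.seq (n := 4) (m := (4 + ((240 * N + 200 * T.size + 210) +
    ((240 * N + 200 * T.size + 210) +
      (8 * N + 40 + (Nat.log 2 N + 1) * (620 * N + 150))))))
    (Runs.den (Q := (· = _)) rfl rfl).fits ?_).mono (by omega) fun _ h => h
  rintro s₁ - ⟨f₁, hs₁⟩
  replace f₁ := f₁ hfit
  have r5 : s₁.reg 5 = N := by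
    rw [hs₁, hN]
    exact Op.eval_add (by change P.card + Q.card < _; omega)
  have hs₁ : (∀ r < 5, s₁.reg r = (inputState T LP LQ).reg r) ∧
      s₁.mem = (inputState T LP LQ).mem := by
    rw [hs₁]
    exact ⟨fun r hr => by simp [hr.ne], rfl⟩
  refine Runs.seq (n := 4) (Runs.den (Q := (· = _)) rfl rfl).fits ?_
  rintro s₂ - ⟨f₂, hs₂⟩
  replace f₂ := f₂ f₁
  have r6 : s₂.reg 6 = 2 ^ w - 1 := by
    simp only [hs₂, den_assign, State.reg_setReg, eval_op, h0, h1, if_true, Op.eval]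
    rw [zero_add, Nat.mod_eq_of_lt (by omega)]
  replace r5 : s₂.reg 5 = N := by simp [hs₂, r5]
  replace hs₂ : (∀ r < 5, s₂.reg r = (inputState T LP LQ).reg r) ∧
      s₂.mem = (inputState T LP LQ).mem := by
    rw [hs₂]
    exact ⟨fun r hr => by simp [show r ≠ 6 by omega, hs₁.1 r hr], hs₁.2⟩
  have key₂ : ∀ x, itemKey s₂ 7 9 x = fstKey T LP LQ x := fun x => by
    simp only [fstKey, itemKey, hs₂.1 3 (by omega), hs₂.2]
  refine Runs.seq (runs_sortProg T.trieView (hM.congr (hs₂.1 0 (by omega)) (hs₂.1 1 (by omega))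
    fun a _ => by rw [hs₂.2]) (by omega) (by omega) (by omega) (by omega) r5
    (fun x hx => by rw [key₂]; exact (keys_lt T LP LQ (hN ▸ hx)).1)
    fun a ha _ => by rw [hs₂.2, hzero a (by omega)]).fits ?_
  rintro s₃ g₃ ⟨f₃, hord₁⟩
  replace f₃ := f₃ f₂
  simp only [key₂] at hord₁
  have m₃ : ∀ a, a < 20 ∨ 30 ≤ a → s₃.mem a = (inputState T LP LQ).mem a := fun a ha => by
    rw [g₃.2 a (writesMem_sortProg (by omega)), hs₂.2]
  have key₃ : ∀ x, itemKey s₃ 8 10 x = sndKey T LP LQ x := fun x => by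
    simp only [sndKey, itemKey, g₃.1 3 rfl, hs₂.1 3 (by omega), m₃ 8 (by omega), m₃ 10 (by omega)]
  refine Runs.seq (runs_sortProg T.trieView (hM.congr
    ((g₃.1 0 rfl).trans (hs₂.1 0 (by omega))) ((g₃.1 1 rfl).trans (hs₂.1 1 (by omega)))
    fun a ha => m₃ a (by omega)) (by omega) (by omega) (by omega) (by omega) ((g₃.1 5 rfl).trans r5)
    (fun x hx => by rw [key₃]; exact (keys_lt T LP LQ (hN ▸ hx)).2)
    fun a ha _ => by rw [m₃ a (by omega), hzero a (by omega)]).fits ?_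
  rintro s₄ g₄ ⟨f₄, hord₂⟩
  replace f₄ := f₄ f₃
  simp only [key₃] at hord₂
  have m₄ : ∀ a, a < 30 ∨ 40 ≤ a → s₄.mem a = s₃.mem a := fun a ha =>
    g₄.2 a (writesMem_sortProg (by omega))
  rw [← m₄ _ (by omega), ← m₄ _ (by omega), ← m₄ _ (by omega)] at hord₁
  -- With this `U` the two bounds on the result coincide: it is at most the maximum and dominates
  -- every pair.
  refine (runs_levelsProg (U := maxPairLCP P Q + 2) (nP := P.card) (by omega) (by omega) hP
    (by omega) (fun x y => LCP_comm _ _) (fun x y => LCP_comm _ _) (fun x hx y hy hy' => ?_) f₄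
    (((g₄.1 3 rfl).trans (g₃.1 3 rfl)).trans (hs₂.1 3 (by omega)))
    (((g₄.1 5 rfl).trans (g₃.1 5 rfl)).trans r5) (((g₄.1 6 rfl).trans (g₃.1 6 rfl)).trans r6)
    hord₁ hord₂ ?_).mono le_rfl ?_
  · exact Nat.add_le_add_right (itemLCP_le T LP LQ hx hy (hN ▸ hy')) 2
  · rw [m₄ 47 (by omega), m₃ 47 (by omega), hzero 47 (by omega)]
    rfl
  · rintro s ⟨hle, hge⟩
    refine le_antisymm (by omega) (maxPairLCP_le T LP LQ fun x hx y hy hy' => ?_)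
    exact hge x hx y hy (hN ▸ hy')

end Input

/-- For `N ≥ 2` the logarithm exceeds `1/2`, so `N * log N` absorbs the linear terms, and `f ≥ 1`
absorbs the constants and the nodes of the trie. -/
theorem maxPairProg_cost {f n N : ℕ} (hn : n ≤ 2 * f + 1) (hf : 0 < f) (hN : 2 ≤ N) :
    ((500 * N + 400 * n + 500 + (Nat.log 2 N + 1) * (620 * N + 150) : ℕ) : ℝ) ≤
      10000 * ((f : ℝ) + (N : ℝ) * Real.log (N : ℝ)) := by
  have h2 := Real.log_two_gt_d9
  have hN' : (2 : ℝ) ≤ N := by exact_mod_cast hN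
  have hf' : (1 : ℝ) ≤ f := by exact_mod_cast hf
  have hn' : (n : ℝ) ≤ 2 * f + 1 := by exact_mod_cast hn
  have hl : Real.log 2 ≤ Real.log N := Real.log_le_log two_pos hN'
  have hL : (Nat.log 2 N : ℝ) * Real.log 2 ≤ Real.log N := by
    rw [← Real.log_pow]
    exact Real.log_le_log (by positivity) (by exact_mod_cast Nat.pow_log_le_self 2 (by omega))
  have hL0 : (0 : ℝ) ≤ Nat.log 2 N := Nat.cast_nonneg _
  have hL2 : (Nat.log 2 N : ℝ) ≤ 2 * Real.log N := by nlinarith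
  push_cast
  have e1 : ((Nat.log 2 N : ℝ) + 1) * (620 * N + 150) ≤ (4 * Real.log N) * (700 * N) :=
    mul_le_mul (by linarith) (by linarith) (by positivity) (by linarith)
  have e2 : (N : ℝ) * (1 / 2) ≤ N * Real.log N :=
    mul_le_mul_of_nonneg_left (by linarith) (by linarith)
  linarith

end TwoFamilies

theorem mainTheorem7 :
    ∃ (p : WordRAM.Prog) (C : ℝ) (c : ℕ),
      ∀ (F : Finset TwoFamilies.Str) (P Q : Finset (TwoFamilies.Str × TwoFamilies.Str)),
        P ⊆ F ×ˢ F → Q ⊆ F ×ˢ F → P.Nonempty → Q.Nonempty →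
        ∀ (T : TwoFamilies.CompactedTrie F)
          (LP : TwoFamilies.PairListing T P) (LQ : TwoFamilies.PairListing T Q) (w : ℕ),
          (F.card + (P.card + Q.card) + F.sup List.length) ^ c ≤ 2 ^ w →
          (TwoFamilies.inputState T LP LQ).Fits w →
          ∃ (s : WordRAM.State) (t : ℕ),
            WordRAM.Exec w p (TwoFamilies.inputState T LP LQ) s t ∧
            s.reg 0 = TwoFamilies.maxPairLCP P Q ∧
            (t : ℝ) ≤ C * ((F.card : ℝ) +
              ((P.card + Q.card : ℕ) : ℝ) * Real.log ((P.card + Q.card : ℕ) : ℝ)) := by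
  refine ⟨TwoFamilies.maxPairProg, 10000, 3, ?_⟩
  intro F P Q hPF _ hP hQ T LP LQ w hw hfit
  have hF : 0 < F.card := by
    obtain ⟨x, hx⟩ := hP
    exact Finset.card_pos.mpr ⟨x.1, (Finset.mem_product.mp (hPF hx)).1⟩
  have hP' := hP.card_pos
  have hQ' := hQ.card_pos
  have hX : 3 ≤ F.card + (P.card + Q.card) + F.sup List.length := by omega
  -- The exponent `3` is chosen here: since the base is at least `3`, its cube is at least nine
  -- times the base, which leaves room for all quantities computed.
  have h9 : 9 * (F.card + (P.card + Q.card) + F.sup List.length) ≤ 2 ^ w :=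
    (by nlinarith [Nat.mul_le_mul hX hX] : _ ≤ _).trans hw
  obtain ⟨s, t, h, ht, hs⟩ := TwoFamilies.runs_maxPairProg T LP LQ hP' hQ' hfit (by omega)
  exact ⟨s, t, h, hs, (Nat.cast_le.mpr ht).trans
    (TwoFamilies.maxPairProg_cost T.size_le hF (by omega))⟩
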